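/- Let $q\in L^1(0,\pi)$ be real-valued, and let each of $f$ and $F$ be either $\infty$ or a rational Herglotz--Nevanlinna function with real coefficients: $$f(\lambda)=h_0\lambda+h+\sum_{k=1}^{d}\frac{\delta_k}{h_k-\lambda},\qquad F(\lambda)=H_0\lambda+H+\sum_{k=1}^{D}\frac{\Delta_k}{H_k-\lambda},$$ with $h_0,H_0\ge 0$, $\delta_k,\Delta_k>0$, $h_1<\dots<h_d$, $H_1<\dots<H_D$. Consider the boundary value problem $$-y''+qy=\lambda y\ \text{ on } [0,\pi],\qquad \frac{y'(0)}{y(0)}=-f(\lambda),\qquad \frac{y'(\pi)}{y(\pi)}=F(\lambda),$$ where $y,y'$ are absolutely continuous, and where the first (second) condition means $y(0)=0$ ($y(\pi)=0$) if $f=\infty$ ($F=\infty$) or if $\lambda$ is a pole of $f$ (of $F$). Notation. For finite $f$ put $\operatorname{ind} f=2d$ if $h_0=0$ and $\operatorname{ind} f=2d+1$ if $h_0>0$; let $f_\downarrow(\lambda)=h_0'\prod_{k=1}^d(h_k-\lambda)$ with $h_0'=1/h_0$ if $h_0>0$ and $h_0'=1$ if $h_0=0$, and let $f_\uparrow=f\,f_\downarrow$,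 so that $f_\uparrow$ and $f_\downarrow$ are polynomials. For $f=\infty$ put $f_\uparrow=-1$, $f_\downarrow=0$, $\operatorname{ind} f=-1$. Let $\omega_1$ be the coefficient of $\lambda^{\operatorname{ind} f}$ in the monic polynomial $$(-1)^{\lfloor \operatorname{ind} f/2\rfloor}\lambda f_\downarrow(\lambda^2)-(-1)^{\lceil \operatorname{ind} f/2\rceil}f_\uparrow(\lambda^2)$$ of degree $\operatorname{ind} f+1$ ($\omega_1=0$ if $f=\infty$). Define $F_\uparrow,F_\downarrow,\operatorname{ind}F,\Omega_1$ in the same way from $F$. Let $\varphi(\cdot,\lambda)$ and $\psi(\cdot,\lambda)$ be the solutions of $-y''+qy=\lambda y$ with $\varphi(0,\lambda)=f_\downarrow(\lambda)$, $\varphi'(0,\lambda)=-f_\uparrow(\lambda)$, $\psi(\pi,\lambda)=F_\downarrow(\lambda)$, $\psi'(\pi,\lambda)=F_\uparrow(\lambda)$. Theorem. All eigenvalues of the problem are real, and they form a strictly increasing sequence $\lambda_0<\lambda_1<\lambda_2<\cdots$. For each $n$ there is a number $\beta_n\ne0$ with $\psi(\cdot,\lambda_n)=\beta_n\varphi(\cdot,\lambda_n)$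 on $[0,\pi]$, so that the norming constants $$\gamma_n=\int_0^\pi\varphi(x,\lambda_n)^2\,dx+f'(\lambda_n)f_\downarrow(\lambda_n)^2+\frac{1}{\beta_n^2}F'(\lambda_n)F_\downarrow(\lambda_n)^2$$ are defined (here $f'f_\downarrow^2=f_\uparrow'f_\downarrow-f_\uparrow f_\downarrow'$ is regarded as a polynomial, equal to $0$ if $f=\infty$; likewise for $F$). There are real sequences $(\xi_n)$ and $(\xi_n')$ such that, for all sufficiently large $n$, $$\sqrt{\lambda_n}=n-\frac{\operatorname{ind} f+\operatorname{ind} F}{2}+\frac{1}{\pi n}\left(\frac12\int_0^\pi q(x)\,dx+\omega_1+\Omega_1\right)+\frac{\xi_n}{n},$$ $$\gamma_n=\frac{\pi}{2}\left(n-\frac{\operatorname{ind} f+\operatorname{ind} F}{2}\right)^{2\operatorname{ind} f}\left(1+\frac{\xi_n'}{n}\right),$$ and $\xi_n\to0$, $\xi_n'\to0$ as $n\to\infty$. If moreover $q\in L^2(0,\pi)$, then $(\xi_n),(\xi_n')\in\ell^2$. -/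

import Mathlib

noncomputable section

namespace SturmLiouville

/-- A rational Herglotz-Nevanlinna function
`f(μ) = h₀ μ + h + ∑ k, δ k / (p k - μ)` with real coefficients, `h₀ ≥ 0`, `δ k > 0` and
`p 0 < p 1 < ⋯ < p (d - 1)`. -/
structure RatHN where
  h₀ : ℝ
  h : ℝ
  d : ℕ
  p : Fin d → ℝ
  δ : Fin d → ℝ
  h₀_nonneg : 0 ≤ h₀
  p_strictMono : StrictMono p
  δ_pos : ∀ k, 0 < δ k

namespace RatHN

/-- The value of the function at a point `μ` (meaningful when `μ` is not a pole). -/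
def eval (f : RatHN) (μ : ℝ) : ℝ := f.h₀ * μ + f.h + ∑ k, f.δ k / (f.p k - μ)

/-- The leading constant `h₀'` of the denominator: `1 / h₀` if `h₀ > 0`, and `1` if `h₀ = 0`. -/
def lead (f : RatHN) : ℝ := if 0 < f.h₀ then 1 / f.h₀ else 1

/-- The denominator `f_↓(μ) = h₀' ∏ k, (p k - μ)`. -/
def down (f : RatHN) : Polynomial ℝ :=
  Polynomial.C f.lead * ∏ k, (Polynomial.C (f.p k) - Polynomial.X)

/-- The numerator `f_↑`, that is, the polynomial `f * f_↓`. -/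
def up (f : RatHN) : Polynomial ℝ :=
  (Polynomial.C f.h₀ * Polynomial.X + Polynomial.C f.h) * f.down
    + ∑ k, Polynomial.C (f.lead * f.δ k)
        * ∏ j ∈ Finset.univ.erase k, (Polynomial.C (f.p j) - Polynomial.X)

/-- The index: `2 d` if `h₀ = 0` and `2 d + 1` if `h₀ > 0`. -/
def ind (f : RatHN) : ℤ := 2 * (f.d : ℤ) + if 0 < f.h₀ then 1 else 0

theorem lead_pos (f : RatHN) : 0 < f.lead := by
  unfold lead
  split_ifs with hpos
  · positivity
  · exact one_pos

/-- Away from the poles `f = f_↑ / f_↓`. -/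
theorem eval_eq_div (f : RatHN) (μ : ℝ) (hμ : ∀ k, μ ≠ f.p k) :
    f.down.eval μ ≠ 0 ∧ f.eval μ = f.up.eval μ / f.down.eval μ := by
  have hne : ∀ k, f.p k - μ ≠ 0 := fun k => sub_ne_zero.mpr (hμ k).symm
  have hd : f.down.eval μ = f.lead * ∏ k, (f.p k - μ) := by
    simp [down, Polynomial.eval_prod]
  have hd0 : f.down.eval μ ≠ 0 := by
    rw [hd]
    exact mul_ne_zero f.lead_pos.ne' (Finset.prod_ne_zero_iff.mpr fun k _ => hne k)
  refine ⟨hd0, ?_⟩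
  rw [eq_div_iff hd0]
  simp only [up, eval, Polynomial.eval_add, Polynomial.eval_mul, Polynomial.eval_C,
    Polynomial.eval_X, Polynomial.eval_finsetSum, Polynomial.eval_prod, Polynomial.eval_sub]
  rw [add_mul (f.h₀ * μ + f.h), Finset.sum_mul]
  congr 1
  refine Finset.sum_congr rfl fun k _ => ?_
  rw [hd, ← Finset.mul_prod_erase Finset.univ _ (Finset.mem_univ k)]
  have := hne k
  field_simp

end RatHN

/-- The coefficients admitted in the boundary conditions: rational Herglotz-Nevanlinna functions,
and `∞`, which stands for the Dirichlet condition. -/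
inductive BC where
  | dirichlet : BC
  | fn : RatHN → BC

namespace BC

/-- `f_↑`, with the convention `f_↑ = -1` for `f = ∞`. -/
def up : BC → Polynomial ℝ
  | dirichlet => -1
  | fn f => f.up

/-- `f_↓`, with the convention `f_↓ = 0` for `f = ∞`. -/
def down : BC → Polynomial ℝ
  | dirichlet => 0
  | fn f => f.down

/-- The index, with the convention `ind ∞ = -1`. -/
def ind : BC → ℤ
  | dirichlet => -1
  | fn f => f.ind

/-- The monic polynomial
`ω_f(μ) = (-1)^⌊ind f / 2⌋ μ f_↓(μ²) - (-1)^⌈ind f / 2⌉ f_↑(μ²)` of degree `ind f + 1`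
(the divisions below are integer divisions, which round down). -/
def omegaPoly (f : BC) : Polynomial ℝ :=
  Polynomial.C ((-1 : ℝ) ^ (f.ind / 2)) * Polynomial.X * f.down.comp (Polynomial.X ^ 2)
    - Polynomial.C ((-1 : ℝ) ^ ((f.ind + 1) / 2)) * f.up.comp (Polynomial.X ^ 2)

/-- The second coefficient `ω₁` of `ω_f`, the one of `μ ^ ind f`
(it is `0` for `f = ∞`, when `ω_f = 1`). -/
def omega₁ (f : BC) : ℝ :=
  if 0 ≤ f.ind then f.omegaPoly.coeff f.ind.toNat else 0

/-- The polynomial `f_↑' f_↓ - f_↑ f_↓'`. Away from the poles of `f` it equals `f' f_↓²`, so it is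
the continuous extension of `f' f_↓²` to the whole line. It is `0` for `f = ∞`. -/
def wronskian (f : BC) : Polynomial ℝ :=
  Polynomial.derivative f.up * f.down - f.up * Polynomial.derivative f.down

end BC

/-- `y` is a (Carathéodory) solution on `[0, π]` of `-y'' + q y = μ y` with derivative `y'`:
`y` is differentiable with derivative `y'`, and `y'` is absolutely continuous with
`y'' = (q - μ) y` almost everywhere, which is written in the integrated form. -/
structure IsSolution {𝕜 : Type*} [RCLike 𝕜] (q : ℝ → ℝ) (μ : 𝕜) (y y' : ℝ → 𝕜) : Prop where
  hasDeriv : ∀ x ∈ Set.Icc 0 Real.pi, HasDerivWithinAt y (y' x) (Set.Icc 0 Real.pi) x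
  deriv_eq : ∀ x ∈ Set.Icc 0 Real.pi, y' x = y' 0 + ∫ t in (0 : ℝ)..x, ((q t : 𝕜) - μ) * y t

/-- `μ` is an eigenvalue of the problem `-y'' + q y = μ y`, `y'(0) / y(0) = -f(μ)`,
`y'(π) / y(π) = F(μ)`: there is a nontrivial solution. The boundary conditions
are read as `f_↓(μ) y'(0) = -f_↑(μ) y(0)` and `F_↓(μ) y'(π) = F_↑(μ) y(π)`, so that at a pole of
`f`, and for `f = ∞`, the first one means `y(0) = 0`; similarly for `F`. -/
def IsEigenvalue (q : ℝ → ℝ) (f F : BC) (μ : ℂ) : Prop :=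
  ∃ y y' : ℝ → ℂ, IsSolution q μ y y' ∧ (∃ x ∈ Set.Icc 0 Real.pi, y x ≠ 0) ∧
    Polynomial.aeval μ f.down * y' 0 = -(Polynomial.aeval μ f.up * y 0) ∧
    Polynomial.aeval μ F.down * y' Real.pi = Polynomial.aeval μ F.up * y Real.pi

/-- `φ = φ(·, μ)` is the solution with `φ(0, μ) = f_↓(μ)` and `φ'(0, μ) = -f_↑(μ)`. -/
def IsPhi (q : ℝ → ℝ) (f : BC) (μ : ℝ) (φ φ' : ℝ → ℝ) : Prop :=
  IsSolution q μ φ φ' ∧ φ 0 = f.down.eval μ ∧ φ' 0 = -f.up.eval μ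

/-- `ψ = ψ(·, μ)` is the solution with `ψ(π, μ) = F_↓(μ)` and `ψ'(π, μ) = F_↑(μ)`. -/
def IsPsi (q : ℝ → ℝ) (F : BC) (μ : ℝ) (ψ ψ' : ℝ → ℝ) : Prop :=
  IsSolution q μ ψ ψ' ∧ ψ Real.pi = F.down.eval μ ∧ ψ' Real.pi = F.up.eval μ

/-- `g` is the norming constant that belongs to the eigenvalue `μ`:
`g = ∫₀^π φ(x, μ)² dx + f'(μ) f_↓(μ)² + F'(μ) F_↓(μ)² / β²`, where `β ≠ 0` is the number with
`ψ(x, μ) = β φ(x, μ)`. -/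
def IsNormingConstant (q : ℝ → ℝ) (f F : BC) (μ g : ℝ) : Prop :=
  ∃ (φ φ' ψ ψ' : ℝ → ℝ) (β : ℝ), IsPhi q f μ φ φ' ∧ IsPsi q F μ ψ ψ' ∧
    β ≠ 0 ∧ (∀ x ∈ Set.Icc 0 Real.pi, ψ x = β * φ x) ∧
    g = (∫ x in (0 : ℝ)..Real.pi, φ x ^ 2) + f.wronskian.eval μ
      + 1 / β ^ 2 * F.wronskian.eval μ

/-- `(ev n, nc n)`, `n = 0, 1, …`, is the spectral data of the problem: `ev` lists all the (complex)
eigenvalues in increasing order, and `nc n` is the norming constant of `ev n`. -/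
structure IsSpectralData (q : ℝ → ℝ) (f F : BC) (ev nc : ℕ → ℝ) : Prop where
  strictMono : StrictMono ev
  eigenvalues : {μ : ℂ | IsEigenvalue q f F μ} = Set.range fun n => (ev n : ℂ)
  norming : ∀ n, IsNormingConstant q f F (ev n) (nc n)

end SturmLiouville

end

/-! ### Absolutely continuous functions with a prescribed almost everywhere derivative -/

noncomputable section

namespace SturmLiouville

open MeasureTheory Set Filter Topology intervalIntegral

/-! Everything is read off the Prüfer angle. Write φ = r sin η, φ' = κ r cos η with κ = max(1,
√|μ|). The condition at 0 prescribes η(0) = `f.angle μ`, and the condition at π says that η(π) +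
`F.angle μ` is a multiple of π. So the real eigenvalues are the points where `charAngle` = η(π) - π
+ `F.angle μ`, a continuous function of μ, takes a value in πℤ. There are no others, because f and F
are Herglotz functions: multiplied by Im μ, the boundary terms of Im(y' ȳ) have the wrong sign for a
nonreal μ.

At an eigenvalue, Lagrange's identity computes the derivative of the suitably scaled characteristic
function. It is the norming constant, hence positive, so `charAngle` crosses every multiple of π
upwards (`charAngle_crossing`). Since it lies in (-π, 0) near -∞ and tends to ∞, it takes each of
the values 0, π, 2π, … exactly once and no other multiple of π (`exists_crossings`). Hence the
eigenvalue number n satisfies `charAngle` = nπ exactly, and the index in the asymptotics is never in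
doubt.

For μ = κ² the angle obeys η' = κ - κ⁻¹ q sin² η, so nπ = π√λ + `f.angle` + `F.angle` - π - λ^(-1/2)
∫ q sin² η at λ = λₙ. The boundary angles are π (ind + 1) / 2 - ω₁ / √λ + O(1/λ)
(`BC.angle_sub_isBigO`). Writing sin² η = (1 - cos 2η) / 2 leaves ½ ∫ q and the integral of q cos
2η. Uniformly in x, 2η is linear in x with an integer frequency up to O(1/n), so this integral is a
Fourier coefficient up to O(1/n): it tends to zero by Riemann-Lebesgue and is square summable by
Parseval if q ∈ L² (`isRemainder_fourier`).

For the norming constants, φ² = r² (1 - cos 2η) / 2 and r is nearly constant. Integration by parts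
gives ∫ φ² = r(0)² (π/2 + (2κ)⁻¹ ∫ q (π - t) sin 2η + O(κ⁻²)) at the eigenvalues
(`IsPruefer.abs_integral_sq_sub_le`). The two boundary terms are O(r(0)² / λ), and r(0)² = λ^(ind f)
(1 + O(1/λ)). The remainder is again a Fourier coefficient, now of q (π - t). -/

/-- `F` is absolutely continuous on `[0, π]` and `f` is its derivative almost everywhere. -/
structure HasACDeriv (F f : ℝ → ℝ) : Prop where
  ac : AbsolutelyContinuousOnInterval F 0 Real.pi
  ae_deriv : ∀ᵐ x, x ∈ Ioo 0 Real.pi → HasDerivAt F (f x) x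

theorem uIcc_pi : uIcc 0 Real.pi = Icc 0 Real.pi := uIcc_of_le Real.pi_pos.le

theorem _root_.AbsolutelyContinuousOnInterval.congr {F G : ℝ → ℝ} {a b : ℝ}
    (h : AbsolutelyContinuousOnInterval F a b) (e : EqOn F G (uIcc a b)) :
    AbsolutelyContinuousOnInterval G a b := by
  rw [absolutelyContinuousOnInterval_iff] at h ⊢
  intro ε hε
  obtain ⟨δ, hδ, H⟩ := h ε hε
  refine ⟨δ, hδ, fun E hE hs => ?_⟩
  convert! H E hE hs using 1
  refine Finset.sum_congr rfl fun i hi => ?_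
  rw [e (hE.1 i hi).1, e (hE.1 i hi).2]

/-- The range of F lies in a compact interval, where g is Lipschitz, and a Lipschitz map preserves
absolute continuity. -/
theorem _root_.AbsolutelyContinuousOnInterval.comp_contDiff {F g : ℝ → ℝ} {a b : ℝ}
    (h : AbsolutelyContinuousOnInterval F a b) (hg : ContDiff ℝ 1 g) :
    AbsolutelyContinuousOnInterval (fun x => g (F x)) a b := by
  obtain ⟨C, hC⟩ := h.exists_bound
  obtain ⟨K, hK⟩ := hg.contDiffOn.exists_lipschitzOnWith (s := Icc (-C) C) (by decide)
    (convex_Icc _ _) isCompact_Icc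
  have hmem : ∀ x ∈ uIcc a b, F x ∈ Icc (-C) C := fun x hx => abs_le.mp (hC x hx)
  rw [absolutelyContinuousOnInterval_iff] at h ⊢
  intro ε hε
  -- K + 1 instead of K, because the Lipschitz constant may be zero.
  obtain ⟨δ, hδ, H⟩ := h (ε / (K + 1)) (by positivity)
  refine ⟨δ, hδ, fun E hE hs => ?_⟩
  have h1 := H E hE hs
  calc _ ≤ ∑ i ∈ Finset.range E.1, (K : ℝ) * dist (F (E.2 i).1) (F (E.2 i).2) := by
        refine Finset.sum_le_sum fun i hi => ?_
        exact hK.dist_le_mul _ (hmem _ (hE.1 i hi).1) _ (hmem _ (hE.1 i hi).2)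
    _ = K * ∑ i ∈ Finset.range E.1, dist (F (E.2 i).1) (F (E.2 i).2) :=
        (Finset.mul_sum _ _ _).symm
    _ ≤ K * (ε / (K + 1)) := by gcongr
    _ < (K + 1) * (ε / (K + 1)) := by gcongr; linarith
    _ = ε := by field

namespace HasACDeriv

variable {F G f g : ℝ → ℝ}

theorem continuousOn (h : HasACDeriv F f) : ContinuousOn F (Icc 0 Real.pi) :=
  uIcc_pi ▸ h.ac.continuousOn

theorem ae_deriv_uIoc (h : HasACDeriv F f) :
    ∀ᵐ x, x ∈ uIoc 0 Real.pi → deriv F x = f x := by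
  have h2 : ∀ᵐ x : ℝ, x ≠ Real.pi := by simp [ae_iff]
  filter_upwards [h.ae_deriv, h2] with x hx hx2 hx3
  rw [uIoc_of_le Real.pi_pos.le] at hx3
  exact (hx ⟨hx3.1, lt_of_le_of_ne hx3.2 hx2⟩).deriv

theorem intervalIntegrable (h : HasACDeriv F f) : IntervalIntegrable f volume 0 Real.pi :=
  h.ac.intervalIntegrable_deriv.congr_ae
    ((ae_restrict_iff' measurableSet_uIoc).mpr h.ae_deriv_uIoc)

theorem integral_eq (h : HasACDeriv F f) {x z : ℝ} (hx : x ∈ Icc 0 Real.pi)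
    (hz : z ∈ Icc 0 Real.pi) : ∫ t in x..z, f t = F z - F x := by
  have hsub : uIcc x z ⊆ uIcc 0 Real.pi := uIcc_pi ▸ uIcc_subset_Icc hx hz
  rw [← (h.ac.mono hsub).integral_deriv_eq_sub]
  refine integral_congr_ae ?_
  filter_upwards [h.ae_deriv_uIoc] with t ht ht2
  refine (ht ?_).symm
  rw [uIoc_of_le Real.pi_pos.le]
  rcases le_total x z with hxz | hxz
  · rw [uIoc_of_le hxz] at ht2
    exact ⟨lt_of_le_of_lt hx.1 ht2.1, ht2.2.trans hz.2⟩
  · rw [uIoc_of_ge hxz] at ht2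
    exact ⟨lt_of_le_of_lt hz.1 ht2.1, ht2.2.trans hx.2⟩

theorem eq_add_integral (h : HasACDeriv F f) {x : ℝ} (hx : x ∈ Icc 0 Real.pi) :
    F x = F 0 + ∫ t in (0 : ℝ)..x, f t := by
  rw [h.integral_eq (left_mem_Icc.mpr Real.pi_pos.le) hx]; ring

theorem of_eq_integral (hf : IntervalIntegrable f volume 0 Real.pi)
    (h : ∀ x ∈ Icc 0 Real.pi, F x = F 0 + ∫ t in (0 : ℝ)..x, f t) : HasACDeriv F f := by
  constructor
  · have h1 := (hf.absolutelyContinuousOnInterval_intervalIntegral (c := 0) (by simp))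
    have h2 : AbsolutelyContinuousOnInterval (fun _ : ℝ => F 0) 0 Real.pi :=
      (contDiff_const (n := 1)).contDiffOn.absolutelyContinuousOnInterval
    refine (h2.fun_add h1).congr fun x hx => ?_
    rw [uIcc_pi] at hx
    exact (h x hx).symm
  · filter_upwards [hf.ae_hasDerivAt_integral] with x hx hx2
    have h1 := (hx (uIcc_pi ▸ Ioo_subset_Icc_self hx2) 0 (by simp)).const_add (F 0)
    refine h1.congr_of_eventuallyEq ?_
    filter_upwards [Icc_mem_nhds hx2.1 hx2.2] with z hz using h z hz

theorem of_integral (c : ℝ) (hf : IntervalIntegrable f volume 0 Real.pi) :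
    HasACDeriv (fun x => c + ∫ t in (0 : ℝ)..x, f t) f :=
  of_eq_integral hf fun x _ => by simp

/-- The entry point for functions that are differentiable everywhere, such as a solution y with its
continuous derivative y'. -/
theorem of_hasDerivWithinAt
    (h : ∀ x ∈ Icc 0 Real.pi, HasDerivWithinAt F (f x) (Icc 0 Real.pi) x)
    (hf : ContinuousOn f (Icc 0 Real.pi)) : HasACDeriv F f := by
  have hi : IntervalIntegrable f volume 0 Real.pi := (uIcc_pi ▸ hf).intervalIntegrable
  refine of_eq_integral hi fun x hx => ?_
  have hsub : Icc 0 x ⊆ Icc 0 Real.pi := Icc_subset_Icc_right hx.2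
  rw [integral_eq_sub_of_hasDerivAt_of_le hx.1
    (fun t ht => ((h t (hsub ht)).continuousWithinAt).mono hsub)
    (fun t ht => (h t ⟨ht.1.le, ht.2.le.trans hx.2⟩).hasDerivAt
      (Icc_mem_nhds ht.1 (ht.2.trans_le hx.2)))
    (hi.mono_set (by rw [uIcc_pi, uIcc_of_le hx.1]; exact hsub))]
  ring

theorem congr_deriv (h : HasACDeriv F f) (e : EqOn f g (Icc 0 Real.pi)) : HasACDeriv F g where
  ac := h.ac
  ae_deriv := by
    filter_upwards [h.ae_deriv] with x hx hx2
    rw [← e (Ioo_subset_Icc_self hx2)]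
    exact hx hx2

theorem const (c : ℝ) : HasACDeriv (fun _ => c) (fun _ => 0) where
  ac := (contDiff_const (n := 1)).contDiffOn.absolutelyContinuousOnInterval
  ae_deriv := .of_forall fun x _ => hasDerivAt_const x c

theorem add (hF : HasACDeriv F f) (hG : HasACDeriv G g) :
    HasACDeriv (fun x => F x + G x) (fun x => f x + g x) where
  ac := hF.ac.fun_add hG.ac
  ae_deriv := by
    filter_upwards [hF.ae_deriv, hG.ae_deriv] with x h1 h2 hx using (h1 hx).add (h2 hx)

theorem sub (hF : HasACDeriv F f) (hG : HasACDeriv G g) :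
    HasACDeriv (fun x => F x - G x) (fun x => f x - g x) where
  ac := hF.ac.fun_sub hG.ac
  ae_deriv := by
    filter_upwards [hF.ae_deriv, hG.ae_deriv] with x h1 h2 hx using (h1 hx).sub (h2 hx)

theorem mul (hF : HasACDeriv F f) (hG : HasACDeriv G g) :
    HasACDeriv (fun x => F x * G x) (fun x => f x * G x + F x * g x) where
  ac := hF.ac.fun_mul hG.ac
  ae_deriv := by
    filter_upwards [hF.ae_deriv, hG.ae_deriv] with x h1 h2 hx using (h1 hx).mul (h2 hx)

theorem const_mul (c : ℝ) (hF : HasACDeriv F f) :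
    HasACDeriv (fun x => c * F x) (fun x => c * f x) :=
  ((const c).mul hF).congr_deriv fun x _ => by ring

theorem comp {φ φ' : ℝ → ℝ} (hφ : ∀ x, HasDerivAt φ (φ' x) x) (hc : Continuous φ')
    (hF : HasACDeriv F f) : HasACDeriv (fun x => φ (F x)) (fun x => φ' (F x) * f x) where
  ac := hF.ac.comp_contDiff (contDiff_one_iff_deriv.mpr
    ⟨fun x => (hφ x).differentiableAt, by
      have : deriv φ = φ' := funext fun x => (hφ x).deriv
      rwa [this]⟩)
  ae_deriv := by
    filter_upwards [hF.ae_deriv] with x h1 hx using (hφ (F x)).comp x (h1 hx)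

theorem exp (hF : HasACDeriv F f) :
    HasACDeriv (fun x => Real.exp (F x)) (fun x => Real.exp (F x) * f x) :=
  comp (fun x => Real.hasDerivAt_exp x) Real.continuous_exp hF

theorem sin (hF : HasACDeriv F f) :
    HasACDeriv (fun x => Real.sin (F x)) (fun x => Real.cos (F x) * f x) :=
  comp (fun x => Real.hasDerivAt_sin x) Real.continuous_cos hF

theorem cos (hF : HasACDeriv F f) :
    HasACDeriv (fun x => Real.cos (F x)) (fun x => -Real.sin (F x) * f x) :=
  comp (fun x => Real.hasDerivAt_cos x) Real.continuous_sin.neg hF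

theorem mono_of_nonneg (hF : HasACDeriv F f) (h : ∀ x ∈ Icc 0 Real.pi, 0 ≤ f x) {x z : ℝ}
    (hx : x ∈ Icc 0 Real.pi) (hz : z ∈ Icc 0 Real.pi) (hxz : x ≤ z) : F x ≤ F z := by
  rw [← sub_nonneg, ← hF.integral_eq hx hz]
  exact integral_nonneg hxz fun t ht => h t ⟨hx.1.trans ht.1, ht.2.trans hz.2⟩

theorem eq_of_zero (hF : HasACDeriv F f) (h : ∀ x ∈ Icc 0 Real.pi, f x = 0) {x : ℝ}
    (hx : x ∈ Icc 0 Real.pi) : F x = F 0 := by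
  refine le_antisymm ?_
    (hF.mono_of_nonneg (fun t ht => (h t ht).ge) (left_mem_Icc.mpr Real.pi_pos.le) hx hx.1)
  have := ((const 0).sub hF).mono_of_nonneg (fun t ht => by simp [h t ht])
    (left_mem_Icc.mpr Real.pi_pos.le) hx hx.1
  linarith

end HasACDeriv

end SturmLiouville

end

/-! ### The equation -y'' + q y = μ y: initial value problems, Lagrange's identity, Gronwall
estimates -/

noncomputable section

namespace SturmLiouville

open MeasureTheory Set Filter Topology intervalIntegral

theorem zero_mem_Icc_pi : (0 : ℝ) ∈ Icc 0 Real.pi := left_mem_Icc.mpr Real.pi_pos.le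

theorem pi_mem_Icc_pi : Real.pi ∈ Icc 0 Real.pi := right_mem_Icc.mpr Real.pi_pos.le

/-! ### Existence of solutions -/

section Existence

variable {p : ℝ → ℝ}

theorem continuous_IccExtend_pi (y : C(Icc 0 Real.pi, ℝ)) :
    Continuous (IccExtend Real.pi_pos.le y) := y.continuous.Icc_extend'

theorem integrable_mul_IccExtend (hp : Integrable p) (y : C(Icc 0 Real.pi, ℝ)) :
    Integrable fun t => p t * IccExtend Real.pi_pos.le y t := by
  refine hp.mul_bdd (c := ‖y‖) (continuous_IccExtend_pi y).aestronglyMeasurable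
    (.of_forall fun t => ?_)
  exact y.norm_coe_le_norm _

/-- The integral operator whose fixed points solve `y'' = p y`, `y(0) = a`, `y'(0) = b`. -/
def volterra (hp : Integrable p) (a b : ℝ) (y : C(Icc 0 Real.pi, ℝ)) : C(Icc 0 Real.pi, ℝ) where
  toFun x := a + ∫ s in (0 : ℝ)..x, (b + ∫ t in (0 : ℝ)..s, p t * IccExtend Real.pi_pos.le y t)
  continuous_toFun := by
    have h1 : Continuous fun s : ℝ => b + ∫ t in (0 : ℝ)..s, p t * IccExtend Real.pi_pos.le y t :=
      continuous_const.add (continuous_primitive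
        (fun _ _ => (integrable_mul_IccExtend hp y).intervalIntegrable) 0)
    exact continuous_const.add
      ((continuous_primitive (fun _ _ => h1.intervalIntegrable _ _) 0).comp continuous_subtype_val)

/-- With G(x) = ∫₀ˣ |p|, the inner integration turns Gⁿ |p| into Gⁿ⁺¹ / (n + 1), which produces the
factorial. The outer integration costs a factor of at most π. -/
theorem volterra_iterate_bound (hp : Integrable p) (a b : ℝ) (y z : C(Icc 0 Real.pi, ℝ)) (n : ℕ)
    (x : Icc (0 : ℝ) Real.pi) :
    |((volterra hp a b)^[n] y) x - ((volterra hp a b)^[n] z) x|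
      ≤ (Real.pi * ∫ t in (0 : ℝ)..x, |p t|) ^ n / n.factorial * dist y z := by
  induction n generalizing x with
  | zero =>
    simpa [Real.dist_eq] using ContinuousMap.dist_apply_le_dist (f := y) (g := z) x
  | succ n ih =>
    rw [Function.iterate_succ_apply', Function.iterate_succ_apply']
    set u := (volterra hp a b)^[n] y
    set w := (volterra hp a b)^[n] z
    set D := dist y z
    have hpi := Real.pi_pos
    have hG : HasACDeriv (fun x => ∫ t in (0 : ℝ)..x, |p t|) (fun x => |p x|) := by
      simpa using HasACDeriv.of_integral 0 (hp.abs.intervalIntegrable (a := 0) (b := Real.pi))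
    have hGn := hG.comp (φ := fun s => s ^ (n + 1)) (φ' := fun s => ((n + 1 : ℕ) : ℝ) * s ^ n)
      (fun s => by simpa using hasDerivAt_pow (n + 1) s) (by fun_prop)
    have hG0 : ∀ s, 0 ≤ s → 0 ≤ ∫ t in (0 : ℝ)..s, |p t| :=
      fun s hs => integral_nonneg hs fun t _ => abs_nonneg _
    have key : ∀ s ∈ Icc (0 : ℝ) x, |(∫ t in (0 : ℝ)..s, p t * IccExtend Real.pi_pos.le u t)
        - ∫ t in (0 : ℝ)..s, p t * IccExtend Real.pi_pos.le w t|
        ≤ Real.pi ^ n * (∫ t in (0 : ℝ)..x, |p t|) ^ (n + 1) / (n + 1).factorial * D := by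
      intro s hs
      have hsI : s ∈ Icc 0 Real.pi := ⟨hs.1, hs.2.trans x.2.2⟩
      rw [← intervalIntegral.integral_sub (integrable_mul_IccExtend hp u).intervalIntegrable
        (integrable_mul_IccExtend hp w).intervalIntegrable]
      have e1 := hGn.integral_eq zero_mem_Icc_pi hsI
      have hmul : IntervalIntegrable (fun t => (((n + 1 : ℕ) : ℝ) * (∫ r in (0 : ℝ)..t, |p r|) ^ n
          * |p t|)) volume 0 s :=
        hGn.intervalIntegrable.mono_set
          (by rw [uIcc_pi, uIcc_of_le hs.1]; exact Icc_subset_Icc_right hsI.2)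
      calc _ ≤ ∫ t in (0 : ℝ)..s, Real.pi ^ n / (n + 1).factorial * D *
            (((n + 1 : ℕ) : ℝ) * (∫ r in (0 : ℝ)..t, |p r|) ^ n * |p t|) := by
            rw [← Real.norm_eq_abs]
            refine norm_integral_le_of_norm_le hs.1 (.of_forall fun t ht => ?_)
              (hmul.const_mul _)
            have htI : t ∈ Icc 0 Real.pi := ⟨ht.1.le, ht.2.trans hsI.2⟩
            rw [IccExtend_of_mem _ _ htI, IccExtend_of_mem _ _ htI, ← mul_sub, norm_mul,
              Real.norm_eq_abs, Real.norm_eq_abs]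
            have h1 := ih ⟨t, htI⟩
            simp only at h1
            calc |p t| * |u ⟨t, htI⟩ - w ⟨t, htI⟩| ≤ |p t| *
                ((Real.pi * ∫ r in (0 : ℝ)..t, |p r|) ^ n / n.factorial * D) := by gcongr
              _ = _ := by
                rw [Nat.factorial_succ]; push_cast
                have : (n.factorial : ℝ) ≠ 0 := by positivity
                rw [mul_pow]
                field_simp
        _ = Real.pi ^ n / (n + 1).factorial * D * (∫ t in (0 : ℝ)..s, |p t|) ^ (n + 1) := by
            rw [intervalIntegral.integral_const_mul, e1]; simp
        _ ≤ Real.pi ^ n / (n + 1).factorial * D * (∫ t in (0 : ℝ)..x, |p t|) ^ (n + 1) := by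
            have h3 := hG.mono_of_nonneg (fun _ _ => abs_nonneg _) hsI x.2 hs.2
            have h4 := hG0 s hs.1
            gcongr
        _ = _ := by ring
    have cont : ∀ v : C(Icc 0 Real.pi, ℝ), Continuous fun s : ℝ =>
        b + ∫ t in (0 : ℝ)..s, p t * IccExtend Real.pi_pos.le v t := fun v =>
      continuous_const.add (continuous_primitive
        (fun _ _ => (integrable_mul_IccExtend hp v).intervalIntegrable) 0)
    have e2 : (volterra hp a b u) x - (volterra hp a b w) x = ∫ s in (0 : ℝ)..x,
        ((∫ t in (0 : ℝ)..s, p t * IccExtend Real.pi_pos.le u t)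
          - ∫ t in (0 : ℝ)..s, p t * IccExtend Real.pi_pos.le w t) := by
      simp only [volterra, ContinuousMap.coe_mk]
      rw [add_sub_add_left_eq_sub, ← intervalIntegral.integral_sub
        ((cont u).intervalIntegrable _ _) ((cont w).intervalIntegrable _ _)]
      simp
    rw [e2, ← Real.norm_eq_abs]
    refine (intervalIntegral.norm_integral_le_of_norm_le_const (C := Real.pi ^ n *
      (∫ t in (0 : ℝ)..x, |p t|) ^ (n + 1) / (n + 1).factorial * D) fun s hs => ?_).trans ?_
    · rw [uIoc_of_le x.2.1] at hs
      exact key s ⟨hs.1.le, hs.2⟩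
    · rw [sub_zero, abs_of_nonneg x.2.1]
      have h5 := hG0 x x.2.1
      calc _ ≤ Real.pi ^ n * (∫ t in (0 : ℝ)..x, |p t|) ^ (n + 1) / (n + 1).factorial * D
            * Real.pi := by
              gcongr
              exact x.2.2
        _ = _ := by rw [mul_pow]; ring

/-- Some iterate is a contraction since Cⁿ / n! tends to zero, and the fixed point of a contractive
iterate is fixed by the map itself. -/
theorem exists_volterra_fixedPoint (hp : Integrable p) (a b : ℝ) :
    ∃ y : C(Icc 0 Real.pi, ℝ), volterra hp a b y = y := by
  obtain ⟨n, hn⟩ := ((FloorSemiring.tendsto_pow_div_factorial_atTop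
    (Real.pi * ∫ t in (0 : ℝ)..Real.pi, |p t|)).eventually_lt_const (zero_lt_one)).exists
  have hpi := Real.pi_pos
  have hnn : 0 ≤ ∫ t in (0 : ℝ)..Real.pi, |p t| :=
    integral_nonneg hpi.le fun t _ => abs_nonneg _
  have hK : 0 ≤ (Real.pi * ∫ t in (0 : ℝ)..Real.pi, |p t|) ^ n / n.factorial := by positivity
  have hG : HasACDeriv (fun x => ∫ t in (0 : ℝ)..x, |p t|) (fun x => |p x|) := by
    simpa using HasACDeriv.of_integral 0 (hp.abs.intervalIntegrable (a := 0) (b := Real.pi))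
  have hc : ContractingWith ⟨_, hK⟩ ((volterra hp a b)^[n]) := by
    refine ⟨hn, LipschitzWith.of_dist_le_mul fun y z => ?_⟩
    refine (ContinuousMap.dist_le (mul_nonneg hK dist_nonneg)).mpr fun x => ?_
    rw [Real.dist_eq]
    refine (volterra_iterate_bound hp a b y z n x).trans ?_
    have h3 := hG.mono_of_nonneg (fun _ _ => abs_nonneg _) x.2 pi_mem_Icc_pi x.2.2
    have h4 : 0 ≤ ∫ t in (0 : ℝ)..x, |p t| := integral_nonneg x.2.1 fun t _ => abs_nonneg _
    change _ ≤ (Real.pi * ∫ t in (0 : ℝ)..Real.pi, |p t|) ^ n / n.factorial * dist y z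
    gcongr
  exact ⟨_, hc.isFixedPt_fixedPoint_iterate⟩

end Existence

variable {q : ℝ → ℝ}

theorem hasDerivWithinAt_of_eq_integral {y y' : ℝ → ℝ} (hy' : ContinuousOn y' (Icc 0 Real.pi))
    (h : ∀ x ∈ Icc 0 Real.pi, y x = y 0 + ∫ t in (0 : ℝ)..x, y' t) :
    ∀ x ∈ Icc 0 Real.pi, HasDerivWithinAt y (y' x) (Icc 0 Real.pi) x := by
  intro x hx
  -- Extending y' by constants beyond the endpoints makes it continuous on the line, so the
  -- fundamental theorem of calculus also covers 0 and π.
  have hc : Continuous (IccExtend Real.pi_pos.le ((Icc 0 Real.pi).domRestrict y')) :=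
    (continuousOn_iff_continuous_domRestrict.mp hy').Icc_extend'
  have h1 := (((hc.integral_hasStrictDerivAt 0 x).hasDerivAt).const_add (y 0)).hasDerivWithinAt
    (s := Icc 0 Real.pi)
  rw [IccExtend_of_mem _ _ hx] at h1
  have e : EqOn y (fun z => y 0 + ∫ t in (0 : ℝ)..z,
      IccExtend Real.pi_pos.le ((Icc 0 Real.pi).domRestrict y') t) (Icc 0 Real.pi) := by
    intro z hz
    simp only
    rw [h z hz]
    congr 1
    refine integral_congr fun t ht => ?_
    rw [uIcc_of_le hz.1] at ht
    rw [IccExtend_of_mem _ _ ⟨ht.1, ht.2.trans hz.2⟩]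
    rfl
  exact h1.congr e (e hx)

theorem IsSolution.of_hasACDeriv {μ : ℝ} {y y' : ℝ → ℝ} (h1 : HasACDeriv y y')
    (h2 : HasACDeriv y' fun t => (q t - μ) * y t) : IsSolution q μ y y' where
  hasDeriv := hasDerivWithinAt_of_eq_integral h2.continuousOn fun _ hx => h1.eq_add_integral hx
  deriv_eq x hx := by simpa using h2.eq_add_integral hx

theorem IsSolution.continuousOn {𝕜 : Type*} [RCLike 𝕜] {μ : 𝕜} {y y' : ℝ → 𝕜}
    (h : IsSolution q μ y y') : ContinuousOn y (Icc 0 Real.pi) :=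
  fun x hx => (h.hasDeriv x hx).continuousWithinAt

theorem intervalIntegrable_sub_const (hq : IntervalIntegrable q volume 0 Real.pi) (μ : ℝ) :
    IntervalIntegrable (fun t => q t - μ) volume 0 Real.pi :=
  hq.sub intervalIntegrable_const

theorem IsSolution.hasACDeriv_deriv (hq : IntervalIntegrable q volume 0 Real.pi) {μ : ℝ}
    {y y' : ℝ → ℝ} (h : IsSolution q μ y y') :
    HasACDeriv y' fun t => (q t - μ) * y t :=
  HasACDeriv.of_eq_integral
    ((intervalIntegrable_sub_const hq μ).mul_continuousOn (uIcc_pi ▸ h.continuousOn))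
    fun x hx => by simpa using h.deriv_eq x hx

theorem IsSolution.hasACDeriv (hq : IntervalIntegrable q volume 0 Real.pi) {μ : ℝ}
    {y y' : ℝ → ℝ} (h : IsSolution q μ y y') : HasACDeriv y y' :=
  HasACDeriv.of_hasDerivWithinAt h.hasDeriv (h.hasACDeriv_deriv hq).continuousOn

/-- Initial value problems at `0` are solvable. -/
theorem exists_isSolution (hq : IntervalIntegrable q volume 0 Real.pi) (μ a b : ℝ) :
    ∃ y y' : ℝ → ℝ, IsSolution q μ y y' ∧ y 0 = a ∧ y' 0 = b := by
  -- Cutting the coefficient off outside the interval makes it integrable on the whole line, as the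
  -- Volterra operator requires.
  set p : ℝ → ℝ := indicator (Ioc 0 Real.pi) fun t => q t - μ with hp_def
  have hp : Integrable p := (integrable_indicator_iff measurableSet_Ioc).mpr
    ((intervalIntegrable_iff_integrableOn_Ioc_of_le Real.pi_pos.le).mp
      (intervalIntegrable_sub_const hq μ))
  obtain ⟨u, hu⟩ := exists_volterra_fixedPoint hp a b
  set y : ℝ → ℝ := IccExtend Real.pi_pos.le u with hy
  set y' : ℝ → ℝ := fun s => b + ∫ t in (0 : ℝ)..s, p t * y t with hy'
  have hpy := integrable_mul_IccExtend hp u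
  have hcont : Continuous y' := continuous_const.add (continuous_primitive
        (fun _ _ => hpy.intervalIntegrable) 0)
  have hyeq : ∀ x ∈ Icc 0 Real.pi, y x = a + ∫ s in (0 : ℝ)..x, y' s := by
    intro x hx
    rw [hy, IccExtend_of_mem _ _ hx, ← hu]
    rfl
  have hy0 : y 0 = a := by simpa using hyeq 0 zero_mem_Icc_pi
  have h1 : HasACDeriv y y' := HasACDeriv.of_eq_integral (hcont.intervalIntegrable _ _)
    fun x hx => by rw [hyeq x hx, hy0]
  refine ⟨y, y', ⟨hasDerivWithinAt_of_eq_integral hcont.continuousOn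
    fun _ hx => h1.eq_add_integral hx, fun x hx => ?_⟩, hy0, by simp [hy']⟩
  have e : y' x = y' 0 + ∫ t in (0 : ℝ)..x, p t * y t := by simp [hy']
  rw [e]
  congr 1
  refine integral_congr_ae (.of_forall fun t ht => ?_)
  rw [uIoc_of_le hx.1] at ht
  simp [hp_def, indicator_of_mem (show t ∈ Ioc 0 Real.pi from ⟨ht.1, ht.2.trans hx.2⟩)]

/-! ### Wronskians and energy estimates -/

/-- Lagrange's identity. -/
theorem wronskian_sub_eq (hq : IntervalIntegrable q volume 0 Real.pi) {μ ν : ℝ}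
    {y y' z z' : ℝ → ℝ} (hy : IsSolution q μ y y') (hz : IsSolution q ν z z')
    {x : ℝ} (hx : x ∈ Icc 0 Real.pi) :
    (y x * z' x - y' x * z x) - (y 0 * z' 0 - y' 0 * z 0)
      = (μ - ν) * ∫ t in (0 : ℝ)..x, y t * z t := by
  have h := (((hy.hasACDeriv hq).mul (hz.hasACDeriv_deriv hq)).sub
    ((hy.hasACDeriv_deriv hq).mul (hz.hasACDeriv hq))).integral_eq zero_mem_Icc_pi hx
  rw [← h, ← intervalIntegral.integral_const_mul]
  refine integral_congr fun t _ => ?_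
  ring

/-- A solution that vanishes at one point together with its derivative vanishes identically. -/
theorem IsSolution.eq_zero (hq : IntervalIntegrable q volume 0 Real.pi) {μ : ℝ}
    {y y' : ℝ → ℝ} (h : IsSolution q μ y y') {x z : ℝ} (hx : x ∈ Icc 0 Real.pi)
    (hz : z ∈ Icc 0 Real.pi) (h0 : y x = 0) (h0' : y' x = 0) : y z = 0 ∧ y' z = 0 := by
  have hg : IntervalIntegrable (fun t => 1 + |q t - μ|) volume 0 Real.pi :=
    intervalIntegrable_const.add (intervalIntegrable_sub_const hq μ).abs
  have hG := HasACDeriv.of_integral 0 hg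
  -- Gronwall in both directions: E = y² + y'² satisfies |E'| ≤ (1 + |q - μ|) E. With G the integral
  -- of 1 + |q - μ|, the function E exp(-G) is nonincreasing and carries a zero forwards, while E
  -- exp(G) is nondecreasing and carries it backwards.
  have hE := ((h.hasACDeriv hq).mul (h.hasACDeriv hq)).add
    ((h.hasACDeriv_deriv hq).mul (h.hasACDeriv_deriv hq))
  have key : ∀ t, |2 * y t * y' t * (1 + (q t - μ))|
      ≤ (y t * y t + y' t * y' t) * (1 + |q t - μ|) := by
    intro t
    rw [abs_mul]
    have h1 : |2 * y t * y' t| ≤ y t * y t + y' t * y' t := by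
      rw [abs_le]; constructor <;> nlinarith [sq_nonneg (y t - y' t), sq_nonneg (y t + y' t)]
    have h2 : |1 + (q t - μ)| ≤ 1 + |q t - μ| := by
      simpa using abs_add_le 1 (q t - μ)
    exact mul_le_mul h1 h2 (abs_nonneg _) (add_nonneg (mul_self_nonneg _) (mul_self_nonneg _))
  have hEz : y z * y z + y' z * y' z ≤ 0 := by
    rcases le_total x z with hxz | hxz
    · have h1 := ((HasACDeriv.const 0).sub (hE.mul ((HasACDeriv.const 0).sub hG).exp)).mono_of_nonneg
        (fun t _ => by
          have := (abs_le.mp (key t)).2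
          have h2 := Real.exp_pos (0 - (0 + ∫ s in (0 : ℝ)..t, (1 + |q s - μ|)))
          nlinarith) hx hz hxz
      simp only [h0, h0'] at h1
      have h2 := Real.exp_pos (0 - (0 + ∫ s in (0 : ℝ)..z, (1 + |q s - μ|)))
      nlinarith
    · have h1 := (hE.mul hG.exp).mono_of_nonneg
        (fun t _ => by
          have := (abs_le.mp (key t)).1
          have h2 := Real.exp_pos (0 + ∫ s in (0 : ℝ)..t, (1 + |q s - μ|))
          nlinarith) hz hx hxz
      simp only [h0, h0'] at h1
      have h2 := Real.exp_pos (0 + ∫ s in (0 : ℝ)..z, (1 + |q s - μ|))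
      nlinarith
  constructor <;> nlinarith [sq_nonneg (y z), sq_nonneg (y' z)]

/-- Continuous dependence of solutions on the spectral parameter and the initial values. -/
theorem IsSolution.energy_sub_le (hq : IntervalIntegrable q volume 0 Real.pi) {μ ν : ℝ}
    {y y' z z' : ℝ → ℝ} (hy : IsSolution q μ y y') (hz : IsSolution q ν z z') {x : ℝ}
    (hx : x ∈ Icc 0 Real.pi) :
    (z x - y x) ^ 2 + (z' x - y' x) ^ 2 ≤ Real.exp (∫ t in (0 : ℝ)..Real.pi, (2 + |q t - ν|)) *
      ((z 0 - y 0) ^ 2 + (z' 0 - y' 0) ^ 2 + (ν - μ) ^ 2 * ∫ t in (0 : ℝ)..Real.pi, y t ^ 2) := by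
  have hg : IntervalIntegrable (fun t => 2 + |q t - ν|) volume 0 Real.pi :=
    intervalIntegrable_const.add (intervalIntegrable_sub_const hq ν).abs
  have hG := HasACDeriv.of_integral 0 hg
  have hGnn : ∀ t ∈ Icc 0 Real.pi, 0 ≤ ∫ s in (0 : ℝ)..t, (2 + |q s - ν|) := fun t ht =>
    integral_nonneg ht.1 fun s _ => by positivity
  have hy2 : IntervalIntegrable (fun t => y t ^ 2) volume 0 Real.pi :=
    (uIcc_pi ▸ hy.continuousOn.pow 2 : ContinuousOn _ (uIcc 0 Real.pi)).intervalIntegrable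
  have hI := (HasACDeriv.of_integral 0 hy2).const_mul ((ν - μ) ^ 2)
  have hD := (hz.hasACDeriv hq).sub (hy.hasACDeriv hq)
  have hD' := (hz.hasACDeriv_deriv hq).sub (hy.hasACDeriv_deriv hq)
  have hE := (hD.mul hD).add (hD'.mul hD')
  -- The energy E of the difference satisfies E' ≤ (2 + |q - ν|) E + (ν - μ)² y², so (ν - μ)² ∫ y² -
  -- E exp(-G) is nondecreasing. The constant 2 rather than 1 pays for splitting the product of D'
  -- with the inhomogeneity (μ - ν) y.
  have h1 := (hI.sub (hE.mul ((HasACDeriv.const 0).sub hG).exp)).mono_of_nonneg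
    (fun t ht => by
      have hexp := Real.exp_pos (0 - (0 + ∫ s in (0 : ℝ)..t, (2 + |q s - ν|)))
      have hexp1 : Real.exp (0 - (0 + ∫ s in (0 : ℝ)..t, (2 + |q s - ν|))) ≤ 1 :=
        Real.exp_le_one_iff.mpr (by linarith [hGnn t ht])
      set e := Real.exp (0 - (0 + ∫ s in (0 : ℝ)..t, (2 + |q s - ν|)))
      set D := z t - y t with hDdef
      set D' := z' t - y' t
      have e1 : (q t - ν) * z t - (q t - μ) * y t = (q t - ν) * D + (μ - ν) * y t := by
        rw [hDdef]; ring
      rw [e1]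
      have k1 : 2 * D * D' * (1 + (q t - ν)) ≤ (D * D + D' * D') * (1 + |q t - ν|) := by
        refine (le_abs_self _).trans ?_
        rw [abs_mul]
        have h1 : |2 * D * D'| ≤ D * D + D' * D' := by
          rw [abs_le]; constructor <;> nlinarith [sq_nonneg (D - D'), sq_nonneg (D + D')]
        have h2 : |1 + (q t - ν)| ≤ 1 + |q t - ν| := by
          simpa using abs_add_le 1 (q t - ν)
        exact mul_le_mul h1 h2 (abs_nonneg _) (add_nonneg (mul_self_nonneg _) (mul_self_nonneg _))
      have k2 : 2 * D' * ((μ - ν) * y t) ≤ (D * D + D' * D') + (ν - μ) ^ 2 * y t ^ 2 := by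
        nlinarith [sq_nonneg (D' - (μ - ν) * y t), sq_nonneg D]
      have k3 : e * ((ν - μ) ^ 2 * y t ^ 2) ≤ (ν - μ) ^ 2 * y t ^ 2 :=
        mul_le_of_le_one_left (by positivity) hexp1
      have k4 := mul_le_mul_of_nonneg_left (add_le_add k1 k2) hexp.le
      nlinarith) zero_mem_Icc_pi hx hx.1
  have hI' := (HasACDeriv.of_integral 0 hy2).mono_of_nonneg (fun t _ => sq_nonneg _) hx
    pi_mem_Icc_pi hx.2
  have hG' := hG.mono_of_nonneg (fun t _ => by positivity) hx pi_mem_Icc_pi hx.2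
  simp only [integral_same, add_zero, zero_add, mul_zero, sub_zero, zero_sub, Real.exp_zero,
    mul_one] at h1 hI' hG'
  set a := ∫ s in (0 : ℝ)..x, (2 + |q s - ν|)
  set R := (z 0 - y 0) ^ 2 + (z' 0 - y' 0) ^ 2 + (ν - μ) ^ 2 * ∫ t in (0 : ℝ)..Real.pi, y t ^ 2
    with hR
  have h2 : ((z x - y x) ^ 2 + (z' x - y' x) ^ 2) * Real.exp (-a) ≤ R := by
    have := mul_le_mul_of_nonneg_left hI' (sq_nonneg (ν - μ))
    rw [hR]
    nlinarith
  have hR0 : 0 ≤ R := le_trans (by positivity) h2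
  rw [Real.exp_neg, ← div_eq_mul_inv, div_le_iff₀ (Real.exp_pos _)] at h2
  rw [mul_comm]
  exact h2.trans (mul_le_mul_of_nonneg_left (Real.exp_le_exp.mpr hG') hR0)

end SturmLiouville

end

/-! ### The boundary coefficients as Herglotz functions, and the reality of the eigenvalues -/

noncomputable section

namespace SturmLiouville

open MeasureTheory Set Filter Topology intervalIntegral Polynomial

namespace RatHN

variable (f : RatHN)

theorem down_eval (μ : ℝ) : f.down.eval μ = f.lead * ∏ k, (f.p k - μ) := by
  simp [down, eval_prod]

theorem up_eval (μ : ℝ) : f.up.eval μ = (f.h₀ * μ + f.h) * f.down.eval μ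
    + ∑ k, f.lead * f.δ k * ∏ j ∈ Finset.univ.erase k, (f.p j - μ) := by
  simp [up, eval_prod, eval_finsetSum]

theorem up_eval_eq_mul (μ : ℝ) (hμ : ∀ k, μ ≠ f.p k) :
    f.up.eval μ = f.eval μ * f.down.eval μ := by
  obtain ⟨h1, h2⟩ := f.eval_eq_div μ hμ
  rw [h2, div_mul_cancel₀ _ h1]

theorem down_eval_pole (k : Fin f.d) : f.down.eval (f.p k) = 0 := by
  rw [down_eval, Finset.prod_eq_zero (Finset.mem_univ k) (sub_self _), mul_zero]

theorem up_eval_pole (k : Fin f.d) : f.up.eval (f.p k)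
    = f.lead * f.δ k * ∏ j ∈ Finset.univ.erase k, (f.p j - f.p k) := by
  rw [up_eval, down_eval_pole, mul_zero, zero_add]
  refine Finset.sum_eq_single k (fun i _ hi => ?_) (by simp)
  rw [Finset.prod_eq_zero (i := k) (by simp [hi.symm]) (sub_self _), mul_zero]

theorem up_eval_pole_ne_zero (k : Fin f.d) : f.up.eval (f.p k) ≠ 0 := by
  rw [up_eval_pole]
  refine mul_ne_zero (mul_ne_zero f.lead_pos.ne' (f.δ_pos k).ne') ?_
  refine Finset.prod_ne_zero_iff.mpr fun j hj => ?_
  exact sub_ne_zero.mpr fun h => (Finset.ne_of_mem_erase hj) (f.p_strictMono.injective h)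

/-- Off the poles the denominator does not vanish, and at a pole a single summand of the numerator
survives. Hence the initial values of φ and ψ are never both zero. -/
theorem down_ne_zero_or_up_ne_zero (μ : ℝ) : f.down.eval μ ≠ 0 ∨ f.up.eval μ ≠ 0 := by
  by_cases h : ∀ k, μ ≠ f.p k
  · exact .inl (f.eval_eq_div μ h).1
  · push Not at h
    obtain ⟨k, rfl⟩ := h
    exact .inr (f.up_eval_pole_ne_zero k)

theorem hasDerivAt_eval (μ : ℝ) (hμ : ∀ k, μ ≠ f.p k) :
    HasDerivAt f.eval (f.h₀ + ∑ k, f.δ k / (f.p k - μ) ^ 2) μ := by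
  have h1 : HasDerivAt (fun x => ∑ k, f.δ k / (f.p k - x)) (∑ k, f.δ k / (f.p k - μ) ^ 2) μ := by
    refine HasDerivAt.fun_sum fun k _ => ?_
    have h2 := ((hasDerivAt_id μ).const_sub (f.p k)).inv (sub_ne_zero.mpr (hμ k).symm)
    simp only [div_eq_mul_inv]
    exact (h2.const_mul (f.δ k)).congr_deriv (by simp [div_eq_mul_inv])
  exact ((((hasDerivAt_id μ).const_mul f.h₀).add_const f.h).fun_add h1).congr_deriv (by simp)

theorem isOpen_nonpole : IsOpen {μ : ℝ | ∀ k, μ ≠ f.p k} := by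
  have : {μ : ℝ | ∀ k, μ ≠ f.p k} = (range f.p)ᶜ := by ext; simp [eq_comm]
  rw [this]
  exact (finite_range f.p).isClosed.isOpen_compl

theorem dense_nonpole : Dense {μ : ℝ | ∀ k, μ ≠ f.p k} := by
  have : {μ : ℝ | ∀ k, μ ≠ f.p k} = (range f.p)ᶜ := by ext; simp [eq_comm]
  rw [this]
  exact (countable_range f.p).dense_compl ℝ

/-- Differentiate f_↑ = f f_↓, which holds in a neighbourhood of any point that is not a pole. -/
theorem wronskian_eval (μ : ℝ) (hμ : ∀ k, μ ≠ f.p k) :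
    (BC.fn f).wronskian.eval μ
      = (f.h₀ + ∑ k, f.δ k / (f.p k - μ) ^ 2) * f.down.eval μ ^ 2 := by
  have h1 := (f.hasDerivAt_eval μ hμ).mul (f.down.hasDerivAt μ)
  have h2 := h1.congr_of_eventuallyEq (f := f.eval * fun x => f.down.eval x)
    (f₁ := fun x => f.up.eval x) (by
      filter_upwards [f.isOpen_nonpole.mem_nhds hμ] with x hx using f.up_eval_eq_mul x hx)
  have h3 := h2.unique (f.up.hasDerivAt μ)
  simp only [BC.wronskian, BC.up, BC.down, eval_sub, eval_mul, ← h3, f.up_eval_eq_mul μ hμ]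
  ring

theorem aeval_up (μ : ℂ) (hμ : ∀ k, μ ≠ f.p k) :
    aeval μ f.down ≠ 0 ∧
    aeval μ f.up = (f.h₀ * μ + f.h + ∑ k, f.δ k / (f.p k - μ)) * aeval μ f.down := by
  have hd : aeval μ f.down = f.lead * ∏ k, (f.p k - μ) := by
    simp [down, map_prod]
  have hne : ∀ k, (f.p k - μ : ℂ) ≠ 0 := fun k => sub_ne_zero.mpr (hμ k).symm
  refine ⟨?_, ?_⟩
  · rw [hd]
    exact mul_ne_zero (by exact_mod_cast f.lead_pos.ne')
      (Finset.prod_ne_zero_iff.mpr fun k _ => hne k)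
  · rw [add_mul (f.h₀ * μ + f.h : ℂ), Finset.sum_mul]
    simp only [up, map_add, map_mul, map_sum, map_prod, map_sub, aeval_C, aeval_X]
    congr 1
    refine Finset.sum_congr rfl fun k _ => ?_
    rw [hd, ← Finset.mul_prod_erase Finset.univ _ (Finset.mem_univ k)]
    have := hne k
    simp
    field_simp

end RatHN

namespace BC

variable (f : BC)

theorem down_ne_zero_or_up_ne_zero (μ : ℝ) : f.down.eval μ ≠ 0 ∨ f.up.eval μ ≠ 0 := by
  cases f with
  | dirichlet => right; simp [up]
  | fn f => exact f.down_ne_zero_or_up_ne_zero μ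

/-- Off the poles it is f' f_↓² ≥ 0. The poles are covered by continuity, because the other points
are dense. -/
theorem wronskian_nonneg (μ : ℝ) : 0 ≤ f.wronskian.eval μ := by
  cases f with
  | dirichlet => simp [wronskian, down]
  | fn f =>
    have hcl : IsClosed {μ : ℝ | 0 ≤ (BC.fn f).wronskian.eval μ} :=
      isClosed_le continuous_const (Polynomial.continuous _)
    refine hcl.closure_subset_iff.mpr (fun x hx => ?_) (f.dense_nonpole μ)
    rw [mem_ofPred_eq, f.wronskian_eval x hx]
    have := f.h₀_nonneg
    have h1 : 0 ≤ ∑ k, f.δ k / (f.p k - x) ^ 2 :=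
      Finset.sum_nonneg fun k _ => div_nonneg (f.δ_pos k).le (sq_nonneg _)
    positivity

theorem hasDerivAt_up_mul_sub (μ : ℝ) :
    HasDerivAt (fun ν => f.up.eval ν * f.down.eval μ - f.up.eval μ * f.down.eval ν)
      (f.wronskian.eval μ) μ := by
  have h := ((f.up.hasDerivAt μ).mul_const (f.down.eval μ)).fun_sub
    ((f.down.hasDerivAt μ).const_mul (f.up.eval μ))
  exact h.congr_deriv (by simp [wronskian])

/-- The Herglotz property: `Im f(μ)` and `Im μ` have the same sign. -/
theorem im_nonneg {μ : ℂ} (hμ : μ.im ≠ 0) {a b : ℂ}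
    (h : aeval μ f.down * b = aeval μ f.up * a) : 0 ≤ μ.im * (b * (starRingEnd ℂ) a).im := by
  cases f with
  | dirichlet =>
    have : a = 0 := by simpa [down, up, eq_comm] using h
    simp [this]
  | fn f =>
    have hp : ∀ k, μ ≠ f.p k := fun k hk => hμ (by rw [hk]; exact Complex.ofReal_im _)
    obtain ⟨h1, h2⟩ := f.aeval_up μ hp
    simp only [down, up] at h
    rw [h2] at h
    have hb : b = (f.h₀ * μ + f.h + ∑ k, f.δ k / (f.p k - μ)) * a :=
      mul_left_cancel₀ h1 (by rw [h]; ring)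
    have e : (b * (starRingEnd ℂ) a).im
        = (f.h₀ * μ + f.h + ∑ k, f.δ k / (f.p k - μ) : ℂ).im * Complex.normSq a := by
      rw [hb, mul_assoc, Complex.mul_conj]
      simp
    have e2 : ∀ k, (f.δ k / (f.p k - μ) : ℂ).im
        = μ.im * (f.δ k / Complex.normSq (f.p k - μ)) := by
      intro k
      rw [Complex.div_im]
      simp
      ring
    rw [e]
    simp only [Complex.add_im, Complex.im_sum, e2, Complex.mul_im, Complex.ofReal_re,
      Complex.ofReal_im, zero_mul, add_zero]
    rw [← Finset.mul_sum]
    have := f.h₀_nonneg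
    have h3 : 0 ≤ ∑ k, f.δ k / Complex.normSq (f.p k - μ) :=
      Finset.sum_nonneg fun k _ => div_nonneg (f.δ_pos k).le (Complex.normSq_nonneg _)
    have h4 := Complex.normSq_nonneg a
    calc (0 : ℝ) ≤ μ.im ^ 2 * (f.h₀ + ∑ k, f.δ k / Complex.normSq (f.p k - μ))
          * Complex.normSq a := by positivity
      _ = _ := by ring

end BC

variable {q : ℝ → ℝ}

/-! ### Real eigenvalues -/

/-- Splits a complex solution into its real and imaginary parts, a coupled real system to which the
real calculus of `HasACDeriv` applies. -/
theorem IsSolution.hasACDeriv_re_im (hq : IntervalIntegrable q volume 0 Real.pi) {μ : ℂ}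
    {y y' : ℝ → ℂ} (h : IsSolution q μ y y') :
    (HasACDeriv (fun x => (y x).re) (fun x => (y' x).re) ∧
      HasACDeriv (fun x => (y' x).re)
        (fun x => (q x - μ.re) * (y x).re + μ.im * (y x).im)) ∧
    (HasACDeriv (fun x => (y x).im) (fun x => (y' x).im) ∧
      HasACDeriv (fun x => (y' x).im)
        (fun x => (q x - μ.re) * (y x).im - μ.im * (y x).re)) := by
  have hqc : IntervalIntegrable (fun t => (q t : ℂ)) volume 0 Real.pi :=
    ⟨hq.1.ofReal, hq.2.ofReal⟩
  have hint : IntervalIntegrable (fun t => ((q t : ℂ) - μ) * y t) volume 0 Real.pi :=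
    (hqc.sub intervalIntegrable_const).mul_continuousOn (uIcc_pi ▸ h.continuousOn)
  have hre : HasACDeriv (fun x => (y' x).re)
      (fun x => (q x - μ.re) * (y x).re + μ.im * (y x).im) := by
    have hi : IntervalIntegrable (fun x => (((q x : ℂ) - μ) * y x).re) volume 0 Real.pi :=
      ⟨hint.1.re, hint.2.re⟩
    refine (HasACDeriv.of_eq_integral hi fun x hx => ?_).congr_deriv fun x _ => ?_
    · have h1 := congrArg Complex.re (h.deriv_eq x hx)
      rw [Complex.add_re] at h1
      rw [h1]
      congr 1
      have hx' : IntervalIntegrable (fun t => ((q t : ℂ) - μ) * y t) volume 0 x :=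
        hint.mono_set (by rw [uIcc_pi, uIcc_of_le hx.1]; exact Icc_subset_Icc_right hx.2)
      exact (Complex.reCLM.intervalIntegral_comp_comm hx').symm
    · simp
  have him : HasACDeriv (fun x => (y' x).im)
      (fun x => (q x - μ.re) * (y x).im - μ.im * (y x).re) := by
    have hi : IntervalIntegrable (fun x => (((q x : ℂ) - μ) * y x).im) volume 0 Real.pi :=
      ⟨hint.1.im, hint.2.im⟩
    refine (HasACDeriv.of_eq_integral hi fun x hx => ?_).congr_deriv fun x _ => ?_
    · have h1 := congrArg Complex.im (h.deriv_eq x hx)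
      rw [Complex.add_im] at h1
      rw [h1]
      congr 1
      have hx' : IntervalIntegrable (fun t => ((q t : ℂ) - μ) * y t) volume 0 x :=
        hint.mono_set (by rw [uIcc_pi, uIcc_of_le hx.1]; exact Icc_subset_Icc_right hx.2)
      exact (Complex.imCLM.intervalIntegral_comp_comm hx').symm
    · simp [sub_eq_add_neg]
  refine ⟨⟨HasACDeriv.of_hasDerivWithinAt (fun x hx => ?_) hre.continuousOn, hre⟩,
    ⟨HasACDeriv.of_hasDerivWithinAt (fun x hx => ?_) him.continuousOn, him⟩⟩
  · exact (Complex.reCLM.hasFDerivAt.comp_hasDerivWithinAt x (h.hasDeriv x hx))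
  · exact (Complex.imCLM.hasFDerivAt.comp_hasDerivWithinAt x (h.hasDeriv x hx))

/-- Im(y' ȳ) has derivative -Im μ |y|². By the Herglotz property its boundary contribution, times Im
μ, is nonnegative, so (Im μ)² ∫ |y|² ≤ 0. -/
theorem IsEigenvalue.im_eq_zero (hq : IntervalIntegrable q volume 0 Real.pi) {f F : BC} {μ : ℂ}
    (h : IsEigenvalue q f F μ) : μ.im = 0 := by
  by_contra hμ
  obtain ⟨y, y', hy, ⟨x₀, hx₀, hne⟩, hb0, hbπ⟩ := h
  obtain ⟨⟨h1, h2⟩, h3, h4⟩ := hy.hasACDeriv_re_im hq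
  have hW := ((h4.mul h1).sub (h2.mul h3)).integral_eq zero_mem_Icc_pi pi_mem_Icc_pi
  have e : ∀ x : ℝ, (y' x).im * (y x).re - (y' x).re * (y x).im
      = (y' x * (starRingEnd ℂ) (y x)).im := by intro x; simp; ring
  rw [e, e] at hW
  have hF := F.im_nonneg hμ hbπ
  have hf := f.im_nonneg hμ (a := y 0) (b := -y' 0) (by rw [mul_neg, hb0, neg_neg])
  have hI : HasACDeriv (fun x => ∫ t in (0 : ℝ)..x, ((y t).re ^ 2 + (y t).im ^ 2))
      (fun x => (y x).re ^ 2 + (y x).im ^ 2) := by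
    have hc : ContinuousOn (fun x => (y x).re ^ 2 + (y x).im ^ 2) (uIcc 0 Real.pi) :=
      uIcc_pi ▸ (h1.continuousOn.pow 2).add (h3.continuousOn.pow 2)
    simpa using HasACDeriv.of_integral 0 hc.intervalIntegrable
  have hint : ∫ t in (0 : ℝ)..Real.pi, ((y t).re ^ 2 + (y t).im ^ 2) = 0 := by
    have e2 : (∫ t in (0 : ℝ)..Real.pi, (((q t - μ.re) * (y t).im - μ.im * (y t).re) * (y t).re
        + (y' t).im * (y' t).re - (((q t - μ.re) * (y t).re + μ.im * (y t).im) * (y t).im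
        + (y' t).re * (y' t).im)))
        = -μ.im * ∫ t in (0 : ℝ)..Real.pi, ((y t).re ^ 2 + (y t).im ^ 2) := by
      rw [← intervalIntegral.integral_const_mul]
      exact integral_congr fun t _ => by ring
    rw [e2] at hW
    have h0 : 0 ≤ ∫ t in (0 : ℝ)..Real.pi, ((y t).re ^ 2 + (y t).im ^ 2) :=
      integral_nonneg Real.pi_pos.le fun t _ => by positivity
    have h5 : 0 < μ.im ^ 2 := by positivity
    have h6 : (-y' 0 * (starRingEnd ℂ) (y 0)).im = -(y' 0 * (starRingEnd ℂ) (y 0)).im := by simp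
    rw [h6] at hf
    have h7 : μ.im ^ 2 * ∫ t in (0 : ℝ)..Real.pi, ((y t).re ^ 2 + (y t).im ^ 2) ≤ 0 := by
      have h8 : μ.im ^ 2 * ∫ t in (0 : ℝ)..Real.pi, ((y t).re ^ 2 + (y t).im ^ 2)
          = -(μ.im * (-μ.im * ∫ t in (0 : ℝ)..Real.pi, ((y t).re ^ 2 + (y t).im ^ 2))) := by ring
      rw [h8, hW]
      linarith
    exact le_antisymm (nonpos_of_mul_nonpos_right h7 h5) h0
  -- The running integral of |y|² vanishes identically, hence so does its derivative |y|², in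
  -- particular at x₀.
  have hconst : ∀ x ∈ Icc 0 Real.pi, ∫ t in (0 : ℝ)..x, ((y t).re ^ 2 + (y t).im ^ 2) = 0 := by
    intro x hx
    refine le_antisymm ?_ (integral_nonneg hx.1 fun t _ => by positivity)
    exact (hI.mono_of_nonneg (fun t _ => by positivity) hx pi_mem_Icc_pi hx.2).trans hint.le
  have hcn : ContinuousOn (fun x => (y x).re ^ 2 + (y x).im ^ 2) (Icc 0 Real.pi) :=
    (h1.continuousOn.pow 2).add (h3.continuousOn.pow 2)
  have hd := hasDerivWithinAt_of_eq_integral hcn (y := fun _ => 0)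
    (fun x hx => by rw [hconst x hx, add_zero]) x₀ hx₀
  have := (uniqueDiffOn_Icc Real.pi_pos x₀ hx₀).eq_deriv _ hd (hasDerivWithinAt_const _ _ _)
  refine hne (Complex.ext ?_ ?_) <;> simp <;> nlinarith [sq_nonneg (y x₀).re, sq_nonneg (y x₀).im]

theorem IsSolution.ofReal {μ : ℝ} {y y' : ℝ → ℝ} (h : IsSolution q μ y y') :
    IsSolution q (μ : ℂ) (fun x => (y x : ℂ)) (fun x => (y' x : ℂ)) where
  hasDeriv x hx := (h.hasDeriv x hx).ofReal_comp
  deriv_eq x hx := by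
    rw [h.deriv_eq x hx, Complex.ofReal_add, ← intervalIntegral.integral_ofReal]
    simp

/-- For a real μ the real and imaginary parts decouple and inherit the real boundary conditions.
Whichever of them is nonzero at x₀ is a real eigenfunction. -/
theorem IsSolution.exists_real (hq : IntervalIntegrable q volume 0 Real.pi) {f F : BC} {μ : ℝ}
    (h : IsEigenvalue q f F μ) : ∃ y y' : ℝ → ℝ, IsSolution q μ y y' ∧
      (∃ x ∈ Icc 0 Real.pi, y x ≠ 0) ∧ f.down.eval μ * y' 0 = -(f.up.eval μ * y 0) ∧
      F.down.eval μ * y' Real.pi = F.up.eval μ * y Real.pi := by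
  obtain ⟨y, y', hy, ⟨x₀, hx₀, hne⟩, hb0, hbπ⟩ := h
  obtain ⟨⟨h1, h2⟩, h3, h4⟩ := hy.hasACDeriv_re_im hq
  have ev : ∀ p : ℝ[X], aeval (μ : ℂ) p = ((p.eval μ : ℝ) : ℂ) := fun p => by
    rw [← Complex.coe_algebraMap, aeval_algebraMap_apply]; simp
  rw [ev, ev] at hb0 hbπ
  by_cases hr : (y x₀).re = 0
  · refine ⟨fun x => (y x).im, fun x => (y' x).im, IsSolution.of_hasACDeriv h3 (by simpa using h4),
      ⟨x₀, hx₀, fun hi => hne (Complex.ext hr hi)⟩, ?_, ?_⟩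
    · simpa using congrArg Complex.im hb0
    · simpa using congrArg Complex.im hbπ
  · refine ⟨fun x => (y x).re, fun x => (y' x).re, IsSolution.of_hasACDeriv h1 (by simpa using h2),
      ⟨x₀, hx₀, hr⟩, ?_, ?_⟩
    · simpa using congrArg Complex.re hb0
    · simpa using congrArg Complex.re hbπ

end SturmLiouville

end

noncomputable section

namespace SturmLiouville

open MeasureTheory Set Filter Topology intervalIntegral

/-! ### The Prüfer transformation -/

variable {q : ℝ → ℝ}

/-- The Prüfer angle, with scale `κ`, of a solution `y` of `-y'' + q y = μ y`: it starts at `η₀`, and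
`tan η = κ y / y'`. -/
def prueferAngle (q : ℝ → ℝ) (μ κ η₀ : ℝ) (y y' : ℝ → ℝ) (x : ℝ) : ℝ :=
  η₀ + ∫ t in (0 : ℝ)..x,
    (κ * (y' t / κ) ^ 2 - (q t - μ) / κ * y t ^ 2) / (y t ^ 2 + (y' t / κ) ^ 2)

/-- The logarithm of the Prüfer radius, normalized to vanish at `0`. -/
def prueferLog (q : ℝ → ℝ) (μ κ : ℝ) (y y' : ℝ → ℝ) (x : ℝ) : ℝ :=
  0 + ∫ t in (0 : ℝ)..x,
    ((κ + (q t - μ) / κ) * (y t * (y' t / κ))) / (y t ^ 2 + (y' t / κ) ^ 2)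

/-- The properties of the polar representation `y = r sin η`, `y' = κ r cos η`, `r = r₀ exp L`. -/
structure IsPruefer (q : ℝ → ℝ) (μ κ r₀ : ℝ) (y y' η L : ℝ → ℝ) : Prop where
  eq_sin : ∀ x ∈ Icc 0 Real.pi, y x = r₀ * Real.exp (L x) * Real.sin (η x)
  eq_cos : ∀ x ∈ Icc 0 Real.pi, y' x = κ * (r₀ * Real.exp (L x) * Real.cos (η x))
  angle : HasACDeriv η fun t => κ * Real.cos (η t) ^ 2 - (q t - μ) / κ * Real.sin (η t) ^ 2
  log : HasACDeriv L fun t => (κ + (q t - μ) / κ) * (Real.sin (η t) * Real.cos (η t))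
  log_zero : L 0 = 0

theorem IsSolution.energy_pos (hq : IntervalIntegrable q volume 0 Real.pi) {μ κ : ℝ} (hκ : 0 < κ)
    {y y' : ℝ → ℝ} (h : IsSolution q μ y y') (h0 : y 0 ≠ 0 ∨ y' 0 ≠ 0) :
    ∀ x ∈ Icc 0 Real.pi, 0 < y x ^ 2 + (y' x / κ) ^ 2 := by
  intro x hx
  by_contra hneg
  have h1 : y x = 0 := by nlinarith [sq_nonneg (y x), sq_nonneg (y' x / κ)]
  have h2 : y' x / κ = 0 := by nlinarith [sq_nonneg (y x), sq_nonneg (y' x / κ)]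
  have h3 : y' x = 0 := by simpa [hκ.ne'] using h2
  obtain ⟨h4, h5⟩ := h.eq_zero hq hx zero_mem_Icc_pi h1 h3
  exact h0.elim (· h4) (· h5)

theorem prueferAngle_integrand_eq (μ κ : ℝ) (y y' : ℝ → ℝ) (t : ℝ) :
    (κ * (y' t / κ) ^ 2 - (q t - μ) / κ * y t ^ 2) / (y t ^ 2 + (y' t / κ) ^ 2)
      = κ * ((y' t / κ) ^ 2 / (y t ^ 2 + (y' t / κ) ^ 2))
        - (q t - μ) * (κ⁻¹ * (y t ^ 2 / (y t ^ 2 + (y' t / κ) ^ 2))) := by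
  ring

/-- The angle and the logarithmic radius are defined by integrals, so no argument has to be lifted
continuously. The combinations exp(-L) (y cos η - κ⁻¹ y' sin η) and exp(-L) (y sin η + κ⁻¹ y' cos η)
have zero derivative, hence keep their initial values 0 and r₀. Solving this linear system for y and
y' gives the polar form. -/
theorem IsSolution.isPruefer (hq : IntervalIntegrable q volume 0 Real.pi) {μ κ r₀ η₀ : ℝ}
    (hκ : 0 < κ) (hr₀ : 0 < r₀) {y y' : ℝ → ℝ} (h : IsSolution q μ y y')
    (h0 : y 0 = r₀ * Real.sin η₀) (h0' : y' 0 = κ * (r₀ * Real.cos η₀)) :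
    IsPruefer q μ κ r₀ y y' (prueferAngle q μ κ η₀ y y') (prueferLog q μ κ y y') := by
  have hE := h.energy_pos hq hκ (by
    by_contra! hc
    rw [h0, h0'] at hc
    have h1 : Real.sin η₀ = 0 := by simpa [hr₀.ne'] using hc.1
    have h2 : Real.cos η₀ = 0 := by simpa [hr₀.ne', hκ.ne'] using hc.2
    have := Real.sin_sq_add_cos_sq η₀
    simp [h1, h2] at this)
  have hU := h.hasACDeriv hq
  have hV := (h.hasACDeriv_deriv hq).const_mul κ⁻¹
  have hVc : ContinuousOn (fun t => y' t / κ) (uIcc 0 Real.pi) :=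
    uIcc_pi ▸ (h.hasACDeriv_deriv hq).continuousOn.div_const κ
  have hUc : ContinuousOn y (uIcc 0 Real.pi) := uIcc_pi ▸ hU.continuousOn
  have hEc : ContinuousOn (fun t => y t ^ 2 + (y' t / κ) ^ 2) (uIcc 0 Real.pi) :=
    (hUc.pow 2).add (hVc.pow 2)
  have hE0 : ∀ t ∈ uIcc 0 Real.pi, y t ^ 2 + (y' t / κ) ^ 2 ≠ 0 :=
    fun t ht => (hE t (uIcc_pi ▸ ht)).ne'
  have hp := intervalIntegrable_sub_const hq μ
  have hη : HasACDeriv (prueferAngle q μ κ η₀ y y') fun t =>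
      (κ * (y' t / κ) ^ 2 - (q t - μ) / κ * y t ^ 2) / (y t ^ 2 + (y' t / κ) ^ 2) := by
    refine HasACDeriv.of_integral η₀ ?_
    simp only [prueferAngle_integrand_eq]
    exact (continuousOn_const.mul ((hVc.pow 2).div hEc hE0)).intervalIntegrable.sub
      (hp.mul_continuousOn (continuousOn_const.mul ((hUc.pow 2).div hEc hE0)))
  have hL : HasACDeriv (prueferLog q μ κ y y') fun t =>
      ((κ + (q t - μ) / κ) * (y t * (y' t / κ))) / (y t ^ 2 + (y' t / κ) ^ 2) := by
    refine HasACDeriv.of_integral 0 ?_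
    have e : ∀ t, ((κ + (q t - μ) / κ) * (y t * (y' t / κ))) / (y t ^ 2 + (y' t / κ) ^ 2)
        = (κ + (q t - μ) * κ⁻¹) * (y t * (y' t / κ) / (y t ^ 2 + (y' t / κ) ^ 2)) :=
      fun t => by ring
    simp only [e]
    exact (intervalIntegrable_const.add (hp.mul_const _)).mul_continuousOn
      ((hUc.mul hVc).div hEc hE0)
  have hE'' : ∀ t ∈ Icc 0 Real.pi, κ ^ 2 * y t ^ 2 + y' t ^ 2 ≠ 0 := by
    intro t ht
    have h1 : κ ^ 2 * y t ^ 2 + y' t ^ 2 = κ ^ 2 * (y t ^ 2 + (y' t / κ) ^ 2) := by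
      field_simp
    rw [h1]
    exact (mul_pos (pow_pos hκ 2) (hE t ht)).ne'
  set η := prueferAngle q μ κ η₀ y y' with hη_def
  set L := prueferLog q μ κ y y' with hL_def
  have hη0 : η 0 = η₀ := by simp [hη_def, prueferAngle]
  have hL0 : L 0 = 0 := by simp [hL_def, prueferLog]
  have hexp := ((HasACDeriv.const 0).sub hL).exp
  have hA := hexp.mul ((hU.mul hη.cos).sub (hV.mul hη.sin))
  have hB := hexp.mul ((hU.mul hη.sin).add (hV.mul hη.cos))
  have hAz : ∀ x ∈ Icc 0 Real.pi,
      Real.exp (0 - L x) * (y x * Real.cos (η x) - κ⁻¹ * y' x * Real.sin (η x)) = 0 := by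
    intro x hx
    have := hA.eq_of_zero (fun t ht => by
      have h1 := hE'' t ht
      have h2 : y t ^ 2 + (y' t / κ) ^ 2 = (κ ^ 2 * y t ^ 2 + y' t ^ 2) / κ ^ 2 := by
        field_simp
      simp only [h2]
      field_simp
      ring) hx
    rw [this, hη0, hL0, h0, h0']
    field_simp
    ring
  have hBz : ∀ x ∈ Icc 0 Real.pi,
      Real.exp (0 - L x) * (y x * Real.sin (η x) + κ⁻¹ * y' x * Real.cos (η x)) = r₀ := by
    intro x hx
    have := hB.eq_of_zero (fun t ht => by
      have h1 := hE'' t ht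
      have h2 : y t ^ 2 + (y' t / κ) ^ 2 = (κ ^ 2 * y t ^ 2 + y' t ^ 2) / κ ^ 2 := by
        field_simp
      simp only [h2]
      field_simp
      ring) hx
    rw [this, hη0, hL0, h0, h0']
    field_simp
    simp [Real.sin_sq_add_cos_sq]
  have hsin : ∀ x ∈ Icc 0 Real.pi, y x = r₀ * Real.exp (L x) * Real.sin (η x) := by
    intro x hx
    have h1 := hAz x hx
    have h2 := hBz x hx
    have h3 := Real.sin_sq_add_cos_sq (η x)
    have h4 : Real.exp (0 - L x) * Real.exp (L x) = 1 := by rw [← Real.exp_add]; simp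
    set e := Real.exp (0 - L x)
    set e' := Real.exp (L x)
    linear_combination (e' * Real.cos (η x)) * h1 + (e' * Real.sin (η x)) * h2
      - e * e' * y x * h3 - y x * h4
  have hcos : ∀ x ∈ Icc 0 Real.pi, y' x = κ * (r₀ * Real.exp (L x) * Real.cos (η x)) := by
    intro x hx
    have h1 := hAz x hx
    have h2 := hBz x hx
    have h3 := Real.sin_sq_add_cos_sq (η x)
    have h4 : Real.exp (0 - L x) * Real.exp (L x) = 1 := by rw [← Real.exp_add]; simp
    have h5 : κ * κ⁻¹ = 1 := mul_inv_cancel₀ hκ.ne'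
    set e := Real.exp (0 - L x)
    set e' := Real.exp (L x)
    linear_combination (-κ * e' * Real.sin (η x)) * h1 + (κ * e' * Real.cos (η x)) * h2
      - e * e' * κ * κ⁻¹ * y' x * h3 - κ * κ⁻¹ * y' x * h4 - y' x * h5
  have hE' : ∀ x ∈ Icc 0 Real.pi, y x ^ 2 + (y' x / κ) ^ 2 = (r₀ * Real.exp (L x)) ^ 2 := by
    intro x hx
    rw [hsin x hx, hcos x hx, mul_div_cancel_left₀ _ hκ.ne']
    linear_combination (r₀ * Real.exp (L x)) ^ 2 * Real.sin_sq_add_cos_sq (η x)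
  refine ⟨hsin, hcos, hη.congr_deriv fun x hx => ?_, hL.congr_deriv fun x hx => ?_, hL0⟩
  · have h6 := Real.exp_pos (L x)
    simp only
    rw [hE' x hx, hsin x hx, hcos x hx, mul_div_cancel_left₀ _ hκ.ne']
    field_simp
  · have h6 := Real.exp_pos (L x)
    simp only
    rw [hE' x hx, hsin x hx, hcos x hx, mul_div_cancel_left₀ _ hκ.ne']
    field_simp

theorem prueferAngle_zero (μ κ η₀ : ℝ) (y y' : ℝ → ℝ) : prueferAngle q μ κ η₀ y y' 0 = η₀ := by
  simp [prueferAngle]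

/-! ### Level crossings of a continuous function -/

/-- Θ exceeds c just after a. If it ever came back, the first point of return would have value c and
would be reached from above, against `hl`. -/
theorem lt_of_crossing {Θ : ℝ → ℝ} (hc : Continuous Θ) {c : ℝ}
    (hr : ∀ x, Θ x = c → ∀ᶠ z in 𝓝[>] x, c < Θ z) (hl : ∀ x, Θ x = c → ∀ᶠ z in 𝓝[<] x, Θ z < c)
    {a b : ℝ} (ha : Θ a = c) (hab : a < b) : c < Θ b := by
  by_contra! hb
  obtain ⟨a', ha', ha''⟩ : ∃ a' ∈ Ioc a b, c < Θ a' :=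
    ((hr a ha).and (Ioc_mem_nhdsGT hab)).exists.imp fun _ h => h.symm
  have hne : {x ∈ Icc a' b | Θ x ≤ c}.Nonempty := ⟨b, ⟨ha'.2, le_rfl⟩, hb⟩
  have hcomp : IsCompact {x ∈ Icc a' b | Θ x ≤ c} :=
    isCompact_Icc.inter_right (isClosed_le hc continuous_const)
  obtain ⟨s, ⟨hs1, hs2⟩, hs3⟩ := hcomp.exists_isLeast hne
  have has : a' < s := lt_of_le_of_ne hs1.1 fun h => by rw [← h] at hs2; linarith
  have hs4 : ∀ z ∈ Ico a' s, c < Θ z := fun z hz => by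
    by_contra! h
    exact absurd (hs3 ⟨⟨hz.1, hz.2.le.trans hs1.2⟩, h⟩) (not_le.mpr hz.2)
  have hs5 : Θ s = c := by
    refine le_antisymm hs2 (ge_of_tendsto (hc.continuousAt.tendsto.mono_left nhdsWithin_le_nhds)
      (?_ : ∀ᶠ z in 𝓝[<] s, c ≤ Θ z))
    filter_upwards [Ico_mem_nhdsLT has] with z hz using (hs4 z hz).le
  obtain ⟨z, hz2, hz1⟩ := ((hl s hs5).and (Ico_mem_nhdsLT has)).exists
  exact absurd (hs4 z hz1) hz2.not_gt

/-- Just before b the function is below c. If it were above c at a, it would take the value c in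
between and, by `lt_of_crossing`, could not drop below c afterwards. -/
theorem gt_of_crossing {Θ : ℝ → ℝ} (hc : Continuous Θ) {c : ℝ}
    (hr : ∀ x, Θ x = c → ∀ᶠ z in 𝓝[>] x, c < Θ z) (hl : ∀ x, Θ x = c → ∀ᶠ z in 𝓝[<] x, Θ z < c)
    {a b : ℝ} (hb : Θ b = c) (hab : a < b) : Θ a < c := by
  by_contra! ha
  rcases ha.eq_or_lt with ha | ha
  · exact (lt_of_crossing hc hr hl ha.symm hab).ne' hb
  · obtain ⟨b', hb', hb''⟩ : ∃ b' ∈ Ico a b, Θ b' < c :=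
      ((hl b hb).and (Ico_mem_nhdsLT hab)).exists.imp fun _ h => h.symm
    obtain ⟨s, hs, hs2⟩ := intermediate_value_Icc' hb'.1 hc.continuousOn ⟨hb''.le, ha.le⟩
    have hsb : s < b' := lt_of_le_of_ne hs.2 fun h => by rw [h] at hs2; linarith
    have := lt_of_crossing hc hr hl hs2 hsb
    linarith

/-- A continuous function that starts in `(-π, 0)`, tends to `∞`, and crosses all multiples of `π`
upwards takes each of the values `0, π, 2π, …` exactly once, and no other multiple of `π`. -/
theorem exists_crossings {Θ : ℝ → ℝ} (hc : Continuous Θ)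
    (hr : ∀ x, ∀ k : ℤ, Θ x = k * Real.pi → ∀ᶠ z in 𝓝[>] x, k * Real.pi < Θ z)
    (hl : ∀ x, ∀ k : ℤ, Θ x = k * Real.pi → ∀ᶠ z in 𝓝[<] x, Θ z < k * Real.pi)
    (hbot : ∀ᶠ x in atBot, Θ x ∈ Ioo (-Real.pi) 0) (htop : Tendsto Θ atTop atTop) :
    ∃ ev : ℕ → ℝ, StrictMono ev ∧ (∀ n, Θ (ev n) = n * Real.pi) ∧
      (∀ x, ∀ k : ℤ, Θ x = k * Real.pi → x ∈ range ev) ∧ Tendsto ev atTop atTop := by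
  have hpi := Real.pi_pos
  have hgt : ∀ k : ℤ, ∀ a b, Θ a = k * Real.pi → a < b → k * Real.pi < Θ b :=
    fun k a b => lt_of_crossing hc (fun x => hr x k) (fun x => hl x k)
  have hlt : ∀ k : ℤ, ∀ a b, Θ b = k * Real.pi → a < b → Θ a < k * Real.pi :=
    fun k a b => gt_of_crossing hc (fun x => hr x k) (fun x => hl x k)
  obtain ⟨a, ha⟩ := hbot.exists
  have hex : ∀ n : ℕ, ∃ x, Θ x = n * Real.pi := by
    intro n
    obtain ⟨b, hb⟩ := (htop.eventually_ge_atTop (n * Real.pi)).exists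
    exact mem_range_of_exists_le_of_exists_ge hc ⟨a, ha.2.le.trans (by positivity)⟩ ⟨b, hb⟩
  choose ev hev using hex
  have hmono : StrictMono ev := by
    intro n m hnm
    by_contra! hle
    have h1 : (n : ℝ) * Real.pi < m * Real.pi := by
      have : (n : ℝ) < m := by exact_mod_cast hnm
      gcongr
    rcases hle.eq_or_lt with h | h
    · have := hev m
      rw [h, hev n] at this
      linarith
    · have := hlt n _ _ (by exact_mod_cast hev n) h
      rw [hev m] at this
      push_cast at this
      linarith
  refine ⟨ev, hmono, hev, fun x k hk => ?_, ?_⟩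
  -- A negative level kπ ≤ -π would force values below -π far to the left, where Θ stays in (-π, 0).
  · have hk0 : 0 ≤ k := by
      by_contra! hneg
      obtain ⟨z, hz1, hz2⟩ := (hbot.and (eventually_lt_atBot x)).exists
      have h1 := hlt k z x hk hz2
      have h2 : (k : ℝ) ≤ -1 := by exact_mod_cast Int.le_sub_one_of_lt hneg
      nlinarith [hz1.1]
    lift k to ℕ using hk0
    refine ⟨k, ?_⟩
    rcases lt_trichotomy (ev k) x with h | h | h
    · have := hgt k _ _ (by exact_mod_cast hev k) h
      linarith
    · exact h
    · have := hlt k _ _ (by exact_mod_cast hev k) h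
      linarith
  · refine tendsto_atTop_atTop_of_monotone hmono.monotone fun M => ?_
    by_contra! hM
    -- Bounded crossing points would stay in a compact interval, where Θ is bounded, although it
    -- takes the values nπ at them.
    obtain ⟨C, hC⟩ := (isCompact_Icc (a := ev 0) (b := M)).exists_bound_of_continuousOn
      hc.continuousOn
    obtain ⟨n, hn⟩ := exists_nat_gt (C / Real.pi)
    have h1 := hC (ev n) ⟨hmono.monotone (Nat.zero_le n), (hM n).le⟩
    rw [hev n, Real.norm_eq_abs, abs_of_nonneg (by positivity)] at h1
    rw [div_lt_iff₀ hpi] at hn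
    linarith

end SturmLiouville

end

/-! ### The initial Prüfer angle and radius as functions of the spectral parameter -/

noncomputable section

namespace SturmLiouville

open MeasureTheory Set Filter Topology intervalIntegral Polynomial

/-- The scale of the Prüfer angle: `√|μ|`, but at least `1`. -/
def scale (μ : ℝ) : ℝ := max 1 √|μ|

theorem scale_pos (μ : ℝ) : 0 < scale μ := lt_max_of_lt_left one_pos

theorem continuous_scale : Continuous scale :=
  continuous_const.max (Real.continuous_sqrt.comp continuous_abs)

theorem scale_of_one_le {μ : ℝ} (h : 1 ≤ μ) : scale μ = √μ := by
  rw [scale, abs_of_pos (by linarith), max_eq_right (Real.one_le_sqrt.mpr h)]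

theorem scale_of_le_neg_one {μ : ℝ} (h : μ ≤ -1) : scale μ = √(-μ) := by
  rw [scale, abs_of_neg (by linarith), max_eq_right (Real.one_le_sqrt.mpr (by linarith))]

/-- Each factor with p k below μ is negative, so the power of -1 corrects the sign of the product.
-/
theorem neg_one_pow_card_mul_prod {ι : Type*} (s : Finset ι) (p : ι → ℝ) (μ : ℝ) :
    (-1) ^ (s.filter fun k => p k < μ).card * ∏ k ∈ s, (p k - μ) = ∏ k ∈ s, |p k - μ| := by
  rw [← Finset.prod_const, Finset.prod_filter, ← Finset.prod_mul_distrib]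
  refine Finset.prod_congr rfl fun k _ => ?_
  split_ifs with h
  · rw [abs_of_neg (by linarith)]; ring
  · rw [abs_of_nonneg (by linarith)]; ring

namespace RatHN

variable (f : RatHN)

/-- The number of poles below `μ`. -/
def poleCount (μ : ℝ) : ℕ := (Finset.univ.filter fun k => f.p k < μ).card

/-- The initial values of `φ` as a complex number, in Prüfer coordinates. -/
def direction (μ : ℝ) : ℂ := ⟨-f.up.eval μ / scale μ, f.down.eval μ⟩

theorem continuous_direction : Continuous f.direction := by
  have h : f.direction = fun μ => ((-f.up.eval μ / scale μ : ℝ) : ℂ)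
      + (f.down.eval μ : ℝ) * Complex.I := by
    funext μ
    apply Complex.ext <;> simp [direction]
  rw [h]
  have h1 : Continuous fun μ => -f.up.eval μ / scale μ :=
    f.up.continuous.neg.div continuous_scale fun μ => (scale_pos μ).ne'
  exact (Complex.continuous_ofReal.comp h1).add
    ((Complex.continuous_ofReal.comp f.down.continuous).mul continuous_const)

/-- A continuous choice of the argument of the direction. -/
def angle (μ : ℝ) : ℝ :=
  Real.pi * f.poleCount μ + Complex.arg ((-1) ^ f.poleCount μ * f.direction μ)

/-- The sign (-1)^N, with N the number of poles below μ, keeps the direction in the closed upper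
half-plane; it meets the real axis exactly at the poles. This confines the argument in `angle` to
[0, π]. -/
theorem signed_direction_im (μ : ℝ) : ((-1) ^ f.poleCount μ * f.direction μ).im
    = f.lead * ∏ k, |f.p k - μ| := by
  have h : ((-1 : ℂ) ^ f.poleCount μ * f.direction μ).im
      = (-1) ^ f.poleCount μ * (f.direction μ).im := by
    rw [← Complex.im_ofReal_mul]; simp
  rw [h, ← neg_one_pow_card_mul_prod]
  simp only [direction, down_eval, poleCount]
  ring

theorem signed_direction_re_of_pole (k : Fin f.d) :
    ((-1) ^ f.poleCount (f.p k) * f.direction (f.p k)).re < 0 := by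
  have h : ((-1 : ℂ) ^ f.poleCount (f.p k) * f.direction (f.p k)).re
      = (-1) ^ f.poleCount (f.p k) * (f.direction (f.p k)).re := by
    rw [← Complex.re_ofReal_mul]; simp
  have hc : f.poleCount (f.p k)
      = ((Finset.univ.erase k).filter fun j => f.p j < f.p k).card := by
    rw [poleCount, Finset.filter_erase, Finset.erase_eq_of_notMem (by simp)]
  rw [h, hc]
  simp only [direction, up_eval_pole]
  have e := neg_one_pow_card_mul_prod (Finset.univ.erase k) f.p (f.p k)
  have hpos : 0 < ∏ j ∈ Finset.univ.erase k, |f.p j - f.p k| :=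
    Finset.prod_pos fun j hj => abs_pos.mpr <| sub_ne_zero.mpr fun h =>
      (Finset.ne_of_mem_erase hj) (f.p_strictMono.injective h)
  have h2 : 0 < f.lead * f.δ k / scale (f.p k) :=
    div_pos (mul_pos f.lead_pos (f.δ_pos k)) (scale_pos _)
  calc _ = -(f.lead * f.δ k / scale (f.p k)) * ((-1)
        ^ ((Finset.univ.erase k).filter fun j => f.p j < f.p k).card
        * ∏ j ∈ Finset.univ.erase k, (f.p j - f.p k)) := by ring
    _ < 0 := by
      rw [e]
      exact mul_neg_of_neg_of_pos (neg_neg_of_pos h2) hpos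

theorem signed_direction_im_nonneg (μ : ℝ) :
    0 ≤ ((-1) ^ f.poleCount μ * f.direction μ).im := by
  rw [signed_direction_im]
  exact mul_nonneg f.lead_pos.le (Finset.prod_nonneg fun _ _ => abs_nonneg _)

theorem signed_direction_im_pos (μ : ℝ) (h : ∀ k, μ ≠ f.p k) :
    0 < ((-1) ^ f.poleCount μ * f.direction μ).im := by
  rw [signed_direction_im]
  exact mul_pos f.lead_pos (Finset.prod_pos fun k _ => abs_pos.mpr (sub_ne_zero.mpr (h k).symm))

theorem angle_nonneg (μ : ℝ) : 0 ≤ f.angle μ :=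
  add_nonneg (mul_nonneg Real.pi_pos.le (Nat.cast_nonneg _))
    (Complex.arg_nonneg_iff.mpr (f.signed_direction_im_nonneg μ))

theorem poleCount_eventually_left (μ : ℝ) : ∀ᶠ ν in 𝓝[≤] μ, f.poleCount ν = f.poleCount μ := by
  have h : ∀ᶠ ν in 𝓝[≤] μ, ∀ k, f.p k < ν ↔ f.p k < μ := by
    rw [eventually_all]
    intro k
    by_cases hk : f.p k < μ
    · filter_upwards [nhdsWithin_le_nhds (lt_mem_nhds hk)] with ν hν using by simp [hν, hk]
    · filter_upwards [self_mem_nhdsWithin] with ν hν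
      simp only [hk, iff_false, not_lt]
      exact (mem_Iic.mp hν).trans (not_lt.mp hk)
  filter_upwards [h] with ν hν
  simp only [poleCount, hν]

theorem poleCount_eventually_right (μ : ℝ) :
    ∀ᶠ ν in 𝓝[>] μ, f.poleCount ν = (Finset.univ.filter fun k => f.p k ≤ μ).card := by
  have h : ∀ᶠ ν in 𝓝[>] μ, ∀ k, f.p k < ν ↔ f.p k ≤ μ := by
    rw [eventually_all]
    intro k
    by_cases hk : f.p k ≤ μ
    · filter_upwards [self_mem_nhdsWithin] with ν hν
      simp only [hk, iff_true]
      exact lt_of_le_of_lt hk hν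
    · filter_upwards [nhdsWithin_le_nhds (gt_mem_nhds (not_le.mp hk))] with ν hν
      simp only [hk, iff_false, not_lt]
      exact le_of_lt hν
  filter_upwards [h] with ν hν
  simp only [poleCount, hν]

/-- Only the poles matter. There the signed direction arrives from the left on the negative real
axis, with argument π. To the right the count is one larger and the direction is flipped to the
positive axis, with argument 0. The jump π of the first term of `angle` compensates the drop of the
second. -/
theorem continuous_angle : Continuous f.angle := by
  rw [continuous_iff_continuousAt]
  intro μ
  rw [continuousAt_iff_continuous_left_right]
  have hw : ∀ N : ℕ, Continuous fun ν => (-1 : ℂ) ^ N * f.direction ν :=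
    fun N => continuous_const.mul f.continuous_direction
  constructor
  -- On the negative axis `Complex.arg` is continuous only from the closed upper half-plane, which
  -- is where the direction stays to the left of μ.
  · have harg : ContinuousWithinAt Complex.arg {z : ℂ | 0 ≤ z.im}
        ((-1) ^ f.poleCount μ * f.direction μ) := by
      by_cases h : ∀ k, μ ≠ f.p k
      · exact (Complex.continuousAt_arg
          (.inr (f.signed_direction_im_pos μ h).ne')).continuousWithinAt
      · push Not at h
        obtain ⟨k, hk⟩ := h
        refine Complex.continuousWithinAt_arg_of_re_neg_of_im_zero ?_ ?_
        · rw [hk]; exact f.signed_direction_re_of_pole k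
        · rw [signed_direction_im, Finset.prod_eq_zero (Finset.mem_univ k) (by simp [hk]), mul_zero]
    have h1 : ContinuousWithinAt (fun ν => Real.pi * f.poleCount μ
        + Complex.arg ((-1) ^ f.poleCount μ * f.direction ν))
        (Iic μ ∩ {ν | f.poleCount ν = f.poleCount μ}) μ := by
      refine continuousWithinAt_const.add (harg.comp
        (f := fun ν => (-1) ^ f.poleCount μ * f.direction ν) (hw _).continuousWithinAt ?_)
      rintro ν ⟨-, hν⟩
      simp only [mem_ofPred_eq] at hν ⊢
      rw [← hν]
      exact f.signed_direction_im_nonneg ν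
    have h2 : ContinuousWithinAt f.angle (Iic μ ∩ {ν | f.poleCount ν = f.poleCount μ}) μ := by
      refine h1.congr (fun ν hν => ?_) rfl
      have : f.poleCount ν = f.poleCount μ := hν.2
      simp only [angle, this]
    exact (continuousWithinAt_inter' (f.poleCount_eventually_left μ)).mp h2
  · rw [← continuousWithinAt_Ioi_iff_Ici]
    -- The count just to the right of μ, which includes a possible pole at μ itself.
    set M := (Finset.univ.filter fun k => f.p k ≤ μ).card with hM
    have key : (ContinuousAt Complex.arg ((-1) ^ M * f.direction μ)) ∧
        f.angle μ = Real.pi * M + Complex.arg ((-1) ^ M * f.direction μ) := by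
      by_cases h : ∀ k, μ ≠ f.p k
      · have : M = f.poleCount μ := by
          rw [hM, poleCount]
          congr 1
          ext k
          simp [le_iff_lt_or_eq, (h k).symm]
        rw [this]
        exact ⟨Complex.continuousAt_arg (.inr (f.signed_direction_im_pos μ h).ne'), rfl⟩
      · push Not at h
        obtain ⟨k, hk⟩ := h
        have hMN : M = f.poleCount μ + 1 := by
          rw [hM, poleCount, ← Finset.card_insert_of_notMem (a := k) (by simp [hk])]
          congr 1
          ext j
          simp only [Finset.mem_filter, Finset.mem_univ, true_and, Finset.mem_insert, hk,
            le_iff_lt_or_eq, f.p_strictMono.injective.eq_iff]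
          tauto
        have hre := f.signed_direction_re_of_pole k
        rw [← hk] at hre
        have him : ((-1) ^ f.poleCount μ * f.direction μ).im = 0 := by
          rw [signed_direction_im, Finset.prod_eq_zero (Finset.mem_univ k) (by simp [hk]), mul_zero]
        have e : (-1) ^ M * f.direction μ = -((-1) ^ f.poleCount μ * f.direction μ) := by
          rw [hMN]; ring
        have h1 : Complex.arg ((-1) ^ f.poleCount μ * f.direction μ) = Real.pi :=
          Complex.arg_eq_pi_iff.mpr ⟨hre, him⟩
        have h2 : Complex.arg (-((-1) ^ f.poleCount μ * f.direction μ)) = 0 :=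
          Complex.arg_eq_zero_iff.mpr ⟨by simp only [Complex.neg_re]; linarith, by simp [him]⟩
        refine ⟨?_, ?_⟩
        · rw [e]
          exact Complex.continuousAt_arg (.inl (by simp only [Complex.neg_re]; linarith))
        · rw [angle, e, h1, h2, hMN]
          push_cast
          ring
    have h1 : ContinuousAt (fun ν => Real.pi * M + Complex.arg ((-1) ^ M * f.direction ν)) μ :=
      continuousAt_const.add (key.1.comp (f := fun ν => (-1) ^ M * f.direction ν)
        (hw M).continuousAt)
    refine h1.continuousWithinAt.congr_of_eventuallyEq ?_ key.2
    filter_upwards [f.poleCount_eventually_right μ] with ν hν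
    simp only [angle, hν, hM]

end RatHN

namespace BC

variable (f : BC)

/-- The Prüfer angle of `φ(·, μ)` at `0`, a continuous function of `μ`. -/
def angle : BC → ℝ → ℝ
  | dirichlet => 0
  | fn f => f.angle

/-- The Prüfer radius of `φ(·, μ)` at `0`. -/
def radius (μ : ℝ) : ℝ := √(f.down.eval μ ^ 2 + (f.up.eval μ / scale μ) ^ 2)

theorem continuous_angle : Continuous f.angle := by
  cases f with
  | dirichlet => exact continuous_const
  | fn f => exact f.continuous_angle

theorem angle_nonneg (μ : ℝ) : 0 ≤ f.angle μ := by
  cases f with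
  | dirichlet => exact le_rfl
  | fn f => exact f.angle_nonneg μ

theorem radius_pos (μ : ℝ) : 0 < f.radius μ := by
  refine Real.sqrt_pos.mpr ?_
  have := (scale_pos μ).ne'
  rcases f.down_ne_zero_or_up_ne_zero μ with h | h <;> positivity

/-- The sign (-1)^N in the signed direction cancels against the shift of the angle by Nπ. -/
theorem down_up_eq_polar (μ : ℝ) : f.down.eval μ = f.radius μ * Real.sin (f.angle μ) ∧
    -f.up.eval μ = scale μ * (f.radius μ * Real.cos (f.angle μ)) := by
  have hs := scale_pos μ
  cases f with
  | dirichlet =>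
    have h : (dirichlet.radius μ) = (scale μ)⁻¹ := by
      rw [radius]
      simp only [down, up, eval_zero, eval_neg, eval_one]
      rw [show (0 : ℝ) ^ 2 + (-1 / scale μ) ^ 2 = ((scale μ)⁻¹) ^ 2 by ring,
        Real.sqrt_sq (by positivity)]
    rw [h]
    simp [down, up, angle, hs.ne']
  | fn f =>
    have hr : (fn f).radius μ = ‖f.direction μ‖ := by
      rw [radius, Complex.norm_eq_sqrt_sq_add_sq]
      simp only [down, up, RatHN.direction]
      congr 1
      ring
    set w := (-1) ^ f.poleCount μ * f.direction μ with hw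
    have hn : ‖w‖ = ‖f.direction μ‖ := by simp [hw]
    have hwr : w.re = (-1) ^ f.poleCount μ * (f.direction μ).re := by
      rw [← Complex.re_ofReal_mul]; simp [hw]
    have hwi : w.im = (-1) ^ f.poleCount μ * (f.direction μ).im := by
      rw [← Complex.im_ofReal_mul]; simp [hw]
    have h1 := Complex.norm_mul_cos_arg w
    have h2 := Complex.norm_mul_sin_arg w
    have hsq : ((-1 : ℝ) ^ f.poleCount μ) * (-1) ^ f.poleCount μ = 1 := by
      rw [← mul_pow]; simp
    have hcos : Real.cos (f.angle μ) = (-1) ^ f.poleCount μ * Real.cos w.arg := by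
      rw [RatHN.angle, add_comm, mul_comm Real.pi, Real.cos_add_nat_mul_pi]
    have hsin : Real.sin (f.angle μ) = (-1) ^ f.poleCount μ * Real.sin w.arg := by
      rw [RatHN.angle, add_comm, mul_comm Real.pi, Real.sin_add_nat_mul_pi]
    rw [hn, hwr] at h1
    rw [hn, hwi] at h2
    simp only [angle, down, up]
    rw [hr, hcos, hsin]
    constructor
    · have : f.down.eval μ = (f.direction μ).im := rfl
      rw [this]
      linear_combination (-(-1 : ℝ) ^ f.poleCount μ) * h2 - (f.direction μ).im * hsq
    · have : -f.up.eval μ = scale μ * (f.direction μ).re := by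
        simp only [RatHN.direction]; field_simp
      rw [this]
      linear_combination (-scale μ * (-1 : ℝ) ^ f.poleCount μ) * h1
        - scale μ * (f.direction μ).re * hsq

end BC

end SturmLiouville

end

noncomputable section

namespace SturmLiouville

open MeasureTheory Set Filter Topology intervalIntegral Polynomial Asymptotics

/-! ### The boundary coefficients for large `|μ|` -/

/-- The derivative of arctan t - t has absolute value t² / (1 + t²) ≤ |t|. The quadratic bound is
enough: it is applied to arguments of order 1 / √μ, where it gives O(1/μ). -/
theorem abs_arctan_sub_self_le (x : ℝ) : |Real.arctan x - x| ≤ x ^ 2 := by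
  have h := (convex_Icc (-|x|) |x|).norm_image_sub_le_of_norm_hasDerivWithin_le (C := |x|)
    (f := fun t => Real.arctan t - t) (f' := fun t => 1 / (1 + t ^ 2) - 1) (x := 0) (y := x)
    (fun t _ => ((Real.hasDerivAt_arctan t).sub (hasDerivAt_id t)).hasDerivWithinAt)
    (fun t ht => by
      have h1 : 1 / (1 + t ^ 2) - 1 = -(t ^ 2 / (1 + t ^ 2)) := by field_simp; ring
      rw [h1, norm_neg, Real.norm_of_nonneg (by positivity)]
      have h2 : |t| ≤ |x| := abs_le.mpr ht
      refine le_trans ?_ h2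
      rw [div_le_iff₀ (by positivity), ← sq_abs]
      nlinarith [abs_nonneg t, sq_nonneg (|t| - 1)])
    ⟨by simp, by simp⟩ ⟨neg_abs_le x, le_abs_self x⟩
  simpa [← sq] using h

theorem arg_add_I (x : ℝ) : Complex.arg ⟨x, 1⟩ = Real.pi / 2 - Real.arctan x := by
  have h1 := Real.neg_pi_div_two_lt_arctan x
  have h2 := Real.arctan_lt_pi_div_two x
  have hpi := Real.pi_pos
  have hs : 0 < √(1 + x ^ 2) := Real.sqrt_pos.mpr (by positivity)
  have e : (⟨x, 1⟩ : ℂ) = ((√(1 + x ^ 2) : ℝ) : ℂ) *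
      (Complex.cos ((Real.pi / 2 - Real.arctan x : ℝ) : ℂ)
        + Complex.sin ((Real.pi / 2 - Real.arctan x : ℝ) : ℂ) * Complex.I) := by
    rw [← Complex.ofReal_cos, ← Complex.ofReal_sin, Real.cos_pi_div_two_sub,
      Real.sin_pi_div_two_sub, Real.sin_arctan, Real.cos_arctan]
    apply Complex.ext
    · simp; field_simp
    · simp; field_simp
  rw [e, Complex.arg_mul_cos_add_sin_mul_I hs ⟨by linarith, by linarith⟩]

theorem isBigO_mul_sub_one {α : Type*} {l : Filter α} {u v g : α → ℝ}
    (hu : (fun x => u x - 1) =O[l] g) (hv : (fun x => v x - 1) =O[l] g)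
    (hg : g =O[l] fun _ => (1 : ℝ)) : (fun x => u x * v x - 1) =O[l] g := by
  have h1 : (fun x => (u x - 1) * (v x - 1)) =O[l] g := by
    simpa using hu.mul (hv.trans hg)
  refine ((h1.add hu).add hv).congr_left fun x => ?_
  ring

theorem inv_isBigO_one : (fun μ : ℝ => μ⁻¹) =O[atTop] fun _ => (1 : ℝ) :=
  tendsto_inv_atTop_zero.isBigO_one ℝ

namespace RatHN

variable (f : RatHN)

theorem eventually_nonpole : ∀ᶠ μ : ℝ in atTop, ∀ k, f.p k < μ :=
  eventually_all.mpr fun k => eventually_gt_atTop (f.p k)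

theorem inv_pole_sub_isBigO (p : ℝ) :
    (fun μ : ℝ => (p - μ)⁻¹) =O[atTop] fun μ => μ⁻¹ := by
  refine IsBigO.inv_rev ?_ ?_
  · refine IsBigO.of_bound 2 ?_
    filter_upwards [eventually_ge_atTop (2 * |p|), eventually_ge_atTop 0] with μ h1 h2
    rw [Real.norm_eq_abs, Real.norm_eq_abs, abs_of_nonneg h2, abs_sub_comm]
    have h3 := le_abs_self p
    have := le_abs_self (μ - p)
    linarith
  · filter_upwards [eventually_gt_atTop 0] with μ h1 h2
    exact absurd h2 h1.ne'

theorem eval_sub_isBigO :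
    (fun μ => f.eval μ - (f.h₀ * μ + f.h)) =O[atTop] fun μ => μ⁻¹ := by
  have h : (fun μ => ∑ k, f.δ k * (f.p k - μ)⁻¹) =O[atTop] fun μ : ℝ => μ⁻¹ :=
    IsBigO.fun_sum fun k _ => (inv_pole_sub_isBigO (f.p k)).const_mul_left _
  refine h.congr_left fun μ => ?_
  simp [eval, div_eq_mul_inv]

theorem deriv_isBigO :
    (fun μ => ∑ k, f.δ k / (f.p k - μ) ^ 2) =O[atTop] fun μ : ℝ => μ⁻¹ := by
  refine IsBigO.fun_sum fun k _ => ?_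
  have h1 := ((inv_pole_sub_isBigO (f.p k)).mul
    ((inv_pole_sub_isBigO (f.p k)).trans inv_isBigO_one)).const_mul_left (f.δ k)
  simp only [mul_one] at h1
  refine h1.congr_left fun μ => ?_
  rw [div_eq_mul_inv, sq, mul_inv]

theorem prod_isBigO :
    (fun μ : ℝ => ∏ k, ((f.p k - μ) / μ) ^ 2 - 1) =O[atTop] fun μ : ℝ => μ⁻¹ := by
  induction (Finset.univ : Finset (Fin f.d)) using Finset.induction_on with
  | empty => simpa using isBigO_zero _ _
  | insert k s hk ih =>
    simp only [Finset.prod_insert hk]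
    have h1 : (fun μ : ℝ => (f.p k - μ) / μ + 1) =O[atTop] fun μ : ℝ => μ⁻¹ := by
      refine ((isBigO_refl (fun μ : ℝ => μ⁻¹) atTop).const_mul_left (f.p k)).congr' ?_ .rfl
      filter_upwards [eventually_gt_atTop 0] with μ h
      field_simp
      ring
    have h2 : (fun μ : ℝ => -((f.p k - μ) / μ) - 1) =O[atTop] fun μ : ℝ => μ⁻¹ :=
      h1.neg_left.congr_left fun μ => by ring
    have h3 := isBigO_mul_sub_one h2 h2 inv_isBigO_one
    refine isBigO_mul_sub_one (h3.congr_left fun μ => by ring) ih inv_isBigO_one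

theorem eval_isBigO_of_h₀_eq_zero (h : f.h₀ = 0) : f.eval =O[atTop] fun _ => (1 : ℝ) := by
  have h1 := f.eval_sub_isBigO.trans inv_isBigO_one
  have h2 := h1.add (isBigO_const_const f.h one_ne_zero atTop)
  refine h2.congr_left fun μ => ?_
  rw [h]; ring

theorem eval_div_sub_one_isBigO (h : 0 < f.h₀) :
    (fun μ => f.eval μ / (f.h₀ * μ) - 1) =O[atTop] fun μ => μ⁻¹ := by
  have h1 := f.eval_sub_isBigO.trans inv_isBigO_one
  have h2 := h1.add (isBigO_const_const f.h one_ne_zero atTop)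
  have h3 := (h2.mul (isBigO_refl (fun μ : ℝ => μ⁻¹) atTop)).const_mul_left f.h₀⁻¹
  refine (h3.congr_right fun μ => one_mul _).congr' ?_ .rfl
  filter_upwards [eventually_gt_atTop 0] with μ hμ
  field_simp
  ring

theorem tendsto_eval_div (h : 0 < f.h₀) :
    Tendsto (fun μ => f.eval μ / (f.h₀ * μ)) atTop (𝓝 1) := by
  have := ((f.eval_div_sub_one_isBigO h).trans_tendsto tendsto_inv_atTop_zero).add_const 1
  simpa using this

theorem eventually_eval_ge (h : 0 < f.h₀) : ∀ᶠ μ in atTop, f.h₀ / 2 * μ ≤ f.eval μ := by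
  filter_upwards [(f.tendsto_eval_div h).eventually_const_le (show (1 / 2 : ℝ) < 1 by norm_num),
    eventually_gt_atTop 0] with μ h1 h2
  rw [le_div_iff₀ (by positivity)] at h1
  linarith

theorem eval_inv_isBigO (h : 0 < f.h₀) : (fun μ => (f.eval μ)⁻¹) =O[atTop] fun μ => μ⁻¹ := by
  refine IsBigO.inv_rev ?_ ?_
  · refine IsBigO.of_bound (2 / f.h₀) ?_
    filter_upwards [f.eventually_eval_ge h, eventually_gt_atTop 0] with μ h1 h2
    rw [Real.norm_of_nonneg h2.le, Real.norm_of_nonneg (le_trans (by positivity) h1)]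
    rw [div_mul_eq_mul_div, le_div_iff₀ h]
    linarith
  · filter_upwards [eventually_gt_atTop 0] with μ h1 h2
    exact absurd h2 h1.ne'

/-- Beyond the last pole the signed direction is a positive multiple of -f(μ) / √μ + i. -/
theorem angle_eq_arctan {μ : ℝ} (h1 : 1 ≤ μ) (hp : ∀ k, f.p k < μ) :
    f.angle μ = Real.pi * f.d + (Real.pi / 2 + Real.arctan (f.eval μ / √μ)) := by
  have hN : f.poleCount μ = f.d := by
    simp [poleCount, Finset.filter_true_of_mem fun k _ => hp k]
  have him := f.signed_direction_im_pos μ fun k => (hp k).ne'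
  have hs := scale_pos μ
  have e : (-1) ^ f.poleCount μ * f.direction μ
      = ((((-1) ^ f.poleCount μ * f.direction μ).im : ℝ) : ℂ) * ⟨-(f.eval μ / √μ), 1⟩ := by
    have hwr : ((-1) ^ f.poleCount μ * f.direction μ).re
        = (-1) ^ f.poleCount μ * (f.direction μ).re := by
      rw [← Complex.re_ofReal_mul]; simp
    have hwi : ((-1) ^ f.poleCount μ * f.direction μ).im
        = (-1) ^ f.poleCount μ * (f.direction μ).im := by
      rw [← Complex.im_ofReal_mul]; simp
    apply Complex.ext
    · rw [Complex.re_ofReal_mul, hwr, hwi]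
      simp only [direction]
      rw [f.up_eval_eq_mul μ fun k => (hp k).ne', scale_of_one_le h1]
      ring
    · rw [Complex.im_ofReal_mul, mul_one]
  rw [angle, e, Complex.arg_real_mul _ him, arg_add_I, Real.arctan_neg, hN]
  ring

theorem coeff_down : f.down.coeff f.d = f.lead * (-1) ^ f.d ∧ f.down.natDegree ≤ f.d := by
  have hprod : (∏ k, (C (f.p k) - X) : ℝ[X]) = C ((-1) ^ f.d) * ∏ k, (X - C (f.p k)) := by
    have : ∀ k, (C (f.p k) - X : ℝ[X]) = C (-1) * (X - C (f.p k)) := fun k => by simp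
    simp_rw [this, Finset.prod_mul_distrib]
    simp
  have hm : (∏ k, (X - C (f.p k)) : ℝ[X]).Monic := monic_prod_of_monic _ _ fun k _ => monic_X_sub_C _
  have hd : (∏ k, (X - C (f.p k)) : ℝ[X]).natDegree = f.d := by
    rw [natDegree_prod_of_monic _ _ fun k _ => monic_X_sub_C _]; simp
  have hc := hm.coeff_natDegree
  rw [hd] at hc
  constructor
  · rw [down, hprod, coeff_C_mul, coeff_C_mul, hc, mul_one]
  · rw [down, hprod]
    exact (natDegree_C_mul_le _ _).trans ((natDegree_C_mul_le _ _).trans hd.le)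

theorem coeff_up_of_h₀_eq_zero (h : f.h₀ = 0) :
    f.up.coeff f.d = f.h * f.down.coeff f.d := by
  rw [up, h, C_0, zero_mul, zero_add, coeff_add, coeff_C_mul, add_eq_left, finsetSum_coeff]
  refine Finset.sum_eq_zero fun k _ => ?_
  rw [coeff_C_mul, coeff_eq_zero_of_natDegree_lt, mul_zero]
  refine lt_of_le_of_lt (natDegree_prod_le _ _) ?_
  calc _ ≤ ∑ j ∈ Finset.univ.erase k, 1 := by
        refine Finset.sum_le_sum fun j _ => ?_
        refine (natDegree_sub_le _ _).trans ?_
        simp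
    _ < f.d := by
        have := k.2
        simp [Finset.card_erase_of_mem]
        omega

end RatHN

namespace BC

/-- The index 2d is even, so the odd polynomial μ f_↓(μ²) does not contribute. The top coefficient
of f_↑ is h (-1)^d, and the signs cancel. -/
theorem omega₁_fn_of_h₀_eq_zero (f : RatHN) (h : f.h₀ = 0) : (fn f).omega₁ = -f.h := by
  have hi : (fn f).ind = ((2 * f.d : ℕ) : ℤ) := by simp [ind, RatHN.ind, h]
  have h1 : ((2 * f.d : ℕ) : ℤ) / 2 = f.d := by omega
  have h2 : (((2 * f.d : ℕ) : ℤ) + 1) / 2 = f.d := by omega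
  rw [omega₁, hi, if_pos (by positivity), Int.toNat_natCast, omegaPoly, hi, h1, h2]
  simp only [up, down, ← expand_eq_comp_X_pow, coeff_sub, mul_assoc, coeff_C_mul]
  rw [mul_comm 2 f.d, coeff_expand_mul (by norm_num), f.coeff_up_of_h₀_eq_zero h, f.coeff_down.1]
  have h3 : (X * expand ℝ 2 f.down).coeff (f.d * 2) = 0 := by
    rcases Nat.eq_zero_or_pos f.d with h0 | h0
    · simp [h0]
    · obtain ⟨m, hm⟩ : ∃ m, f.d * 2 = m + 1 := ⟨f.d * 2 - 1, by omega⟩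
      rw [hm, coeff_X_mul, coeff_expand (by norm_num), if_neg (by omega)]
  have hl : f.lead = 1 := by simp [RatHN.lead, h]
  have hsq : ((-1 : ℝ) ^ f.d) * (-1) ^ f.d = 1 := by rw [← mul_pow]; simp
  rw [h3, hl, zpow_natCast]
  linear_combination (-f.h) * hsq

/-- The index 2d + 1 is odd, so only μ f_↓(μ²) contributes, through the leading constant 1 / h₀ of
f_↓. -/
theorem omega₁_fn_of_h₀_pos (f : RatHN) (h : 0 < f.h₀) : (fn f).omega₁ = 1 / f.h₀ := by
  have hi : (fn f).ind = ((2 * f.d + 1 : ℕ) : ℤ) := by simp [ind, RatHN.ind, h]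
  have h1 : ((2 * f.d + 1 : ℕ) : ℤ) / 2 = f.d := by omega
  rw [omega₁, hi, if_pos (by positivity), Int.toNat_natCast, omegaPoly, hi, h1]
  simp only [up, down, ← expand_eq_comp_X_pow, coeff_sub, mul_assoc, coeff_C_mul]
  rw [coeff_X_mul, mul_comm 2 f.d, coeff_expand_mul (by norm_num), f.coeff_down.1,
    coeff_expand (by norm_num) f.up, if_neg (by omega)]
  have hl : f.lead = 1 / f.h₀ := by simp [RatHN.lead, h]
  have hsq : ((-1 : ℝ) ^ f.d) * (-1) ^ f.d = 1 := by rw [← mul_pow]; simp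
  rw [hl, zpow_natCast]
  linear_combination (1 / f.h₀) * hsq

/-- The two-term expansion of the boundary angle, and the origin of ω₁ in the eigenvalue formula. If
h₀ = 0, then f tends to h and arctan(f / √μ) is h / √μ up to O(1/μ). If h₀ > 0, then arctan(f / √μ)
= π/2 - arctan(√μ / f), and √μ / f is 1 / (h₀ √μ) up to O(1/μ). -/
theorem angle_sub_isBigO (f : BC) :
    (fun μ => f.angle μ - (Real.pi * (f.ind + 1) / 2 - f.omega₁ / √μ))
      =O[atTop] fun μ => μ⁻¹ := by
  cases f with
  | dirichlet =>
    have : (fun μ : ℝ => dirichlet.angle μ - (Real.pi * ((dirichlet.ind : ℤ) + 1) / 2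
        - dirichlet.omega₁ / √μ)) = fun _ => 0 := by
      funext μ; simp [angle, ind, omega₁]
    rw [this]
    exact isBigO_zero _ _
  | fn f =>
    have hsq : ∀ᶠ μ : ℝ in atTop, √μ * √μ = μ ∧ 1 ≤ √μ := by
      filter_upwards [eventually_ge_atTop 1] with μ h
      exact ⟨Real.mul_self_sqrt (by linarith), Real.one_le_sqrt.mpr h⟩
    rcases f.h₀_nonneg.eq_or_lt with h | h
    · have hb := f.eval_isBigO_of_h₀_eq_zero h.symm
      have h1 : (fun μ => Real.arctan (f.eval μ / √μ) - f.eval μ / √μ) =O[atTop]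
          fun μ : ℝ => μ⁻¹ := by
        have h2 := (hb.mul hb).mul (isBigO_refl (fun μ : ℝ => μ⁻¹) atTop)
        simp only [one_mul] at h2
        refine IsBigO.trans (IsBigO.of_bound 1 ?_) h2
        filter_upwards [hsq] with μ hμ
        rw [one_mul, Real.norm_eq_abs, Real.norm_eq_abs]
        refine (abs_arctan_sub_self_le _).trans ((le_abs_self _).trans_eq (congrArg _ ?_))
        rw [div_pow, sq √μ, hμ.1, div_eq_mul_inv, sq]
      have h3 : (fun μ => (f.eval μ - (f.h₀ * μ + f.h)) * (√μ)⁻¹) =O[atTop]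
          fun μ : ℝ => μ⁻¹ := by
        have h4 : (fun μ : ℝ => (√μ)⁻¹) =O[atTop] fun _ => (1 : ℝ) :=
          (tendsto_inv_atTop_zero.comp Real.tendsto_sqrt_atTop).isBigO_one ℝ
        simpa using f.eval_sub_isBigO.mul h4
      refine (h1.add h3).congr' ?_ .rfl
      filter_upwards [f.eventually_nonpole, eventually_ge_atTop 1] with μ h5 h6
      have hi : (fn f).ind = 2 * f.d := by simp [ind, RatHN.ind, ← h]
      simp only [angle]
      rw [f.angle_eq_arctan h6 h5, omega₁_fn_of_h₀_eq_zero f h.symm, hi, ← h]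
      push_cast
      ring
    · have hb := f.eval_inv_isBigO h
      have h1 : (fun μ => Real.arctan (√μ / f.eval μ) - √μ / f.eval μ) =O[atTop]
          fun μ : ℝ => μ⁻¹ := by
        have h2 := (hb.mul hb).mul (isBigO_refl (fun μ : ℝ => μ) atTop)
        refine IsBigO.trans (IsBigO.of_bound 1 ?_)
          (h2.congr' (f₂ := fun μ => (f.eval μ)⁻¹ * (f.eval μ)⁻¹ * μ) (g₂ := fun μ => μ⁻¹) .rfl ?_)
        · filter_upwards [hsq] with μ hμ
          rw [one_mul, Real.norm_eq_abs, Real.norm_eq_abs]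
          refine (abs_arctan_sub_self_le _).trans ((le_abs_self _).trans_eq (congrArg _ ?_))
          rw [div_pow, sq √μ, hμ.1]
          ring
        · filter_upwards [eventually_gt_atTop 0] with μ hμ
          field_simp
      have h3 : (fun μ => (f.eval μ - (f.h₀ * μ + f.h) + f.h) * (f.eval μ)⁻¹ * (√μ)⁻¹ * f.h₀⁻¹)
          =O[atTop] fun μ : ℝ => μ⁻¹ := by
        have h4 : (fun μ : ℝ => (√μ)⁻¹) =O[atTop] fun _ => (1 : ℝ) :=
          (tendsto_inv_atTop_zero.comp Real.tendsto_sqrt_atTop).isBigO_one ℝ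
        have h5 := (f.eval_sub_isBigO.trans inv_isBigO_one).add
          (isBigO_const_const f.h one_ne_zero atTop)
        simpa using ((h5.mul hb).mul h4).mul (isBigO_const_const f.h₀⁻¹ one_ne_zero atTop)
      refine (h3.sub h1).congr' ?_ .rfl
      filter_upwards [f.eventually_nonpole, eventually_ge_atTop 1, hsq, f.eventually_eval_ge h]
        with μ h5 h6 h7 h8
      have hi : (fn f).ind = 2 * f.d + 1 := by simp [ind, RatHN.ind, h]
      have hpos : 0 < f.eval μ := lt_of_lt_of_le (by positivity) h8
      have hsp : 0 < √μ := by linarith [h7.2]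
      have h9 : Real.arctan (f.eval μ / √μ) = Real.pi / 2 - Real.arctan (√μ / f.eval μ) := by
        rw [← Real.arctan_inv_of_pos (by positivity), inv_div]
      simp only [angle]
      rw [f.angle_eq_arctan h6 h5, omega₁_fn_of_h₀_pos f h, hi, h9]
      push_cast
      have h10 : (f.eval μ - (f.h₀ * μ + f.h) + f.h) * (f.eval μ)⁻¹ * (√μ)⁻¹ * f.h₀⁻¹
          = 1 / f.h₀ / √μ - √μ / f.eval μ := by
        field_simp
        rw [sq, h7.1]
        ring
      rw [h10]
      ring

theorem radius_sq (f : BC) {μ : ℝ} (h1 : 1 ≤ μ) :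
    f.radius μ ^ 2 = f.down.eval μ ^ 2 + f.up.eval μ ^ 2 / μ := by
  rw [radius, Real.sq_sqrt (by positivity), scale_of_one_le h1, div_pow,
    Real.sq_sqrt (by linarith)]

theorem radius_sq_fn (f : RatHN) {μ : ℝ} (h1 : 1 ≤ μ) (hp : ∀ k, f.p k < μ) :
    (fn f).radius μ ^ 2 = f.down.eval μ ^ 2 * (1 + f.eval μ ^ 2 / μ) := by
  rw [radius_sq _ h1]
  simp only [down, up]
  rw [f.up_eval_eq_mul μ fun k => (hp k).ne']
  ring

/-- For h₀ = 0 the term f_↓² dominates, and for h₀ > 0 the term f_↑² / μ does. The normalization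
`lead` is what makes the leading constant 1 in both cases. -/
theorem radius_sq_isBigO (f : BC) :
    (fun μ => f.radius μ ^ 2 / μ ^ f.ind - 1) =O[atTop] fun μ => μ⁻¹ := by
  cases f with
  | dirichlet =>
    refine (isBigO_zero _ _).congr' (f₁ := fun _ => (0 : ℝ)) ?_ .rfl
    filter_upwards [eventually_ge_atTop 1] with μ h1
    have : μ ≠ 0 := by linarith
    rw [radius_sq _ h1]
    simp [ind, up, down, this]
  | fn f =>
    have hdown : ∀ μ : ℝ, μ ≠ 0 → f.down.eval μ ^ 2
        = f.lead ^ 2 * (∏ k, ((f.p k - μ) / μ) ^ 2) * μ ^ (2 * f.d) := by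
      intro μ hμ
      rw [f.down_eval, Finset.prod_pow, Finset.prod_div_distrib]
      simp
      field_simp
      ring
    rcases f.h₀_nonneg.eq_or_lt with h | h
    · have hb := f.eval_isBigO_of_h₀_eq_zero h.symm
      have h2 : (fun μ => (1 + f.eval μ ^ 2 / μ) - 1) =O[atTop] fun μ : ℝ => μ⁻¹ := by
        have h2 := (hb.mul hb).mul (isBigO_refl (fun μ : ℝ => μ⁻¹) atTop)
        simp only [one_mul] at h2
        exact h2.congr_left fun μ => by ring
      refine (isBigO_mul_sub_one f.prod_isBigO h2 inv_isBigO_one).congr' ?_ .rfl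
      filter_upwards [f.eventually_nonpole, eventually_ge_atTop 1] with μ h5 h6
      have h0 : μ ≠ 0 := by linarith
      have hi : (fn f).ind = ((2 * f.d : ℕ) : ℤ) := by simp [ind, RatHN.ind, ← h]
      have hl : f.lead = 1 := by simp [RatHN.lead, ← h]
      rw [radius_sq_fn f h6 h5, hdown μ h0, hi, zpow_natCast, hl]
      field_simp
    · have hb := f.eval_div_sub_one_isBigO h
      have h2 : (fun μ => ((f.h₀ ^ 2)⁻¹ * μ⁻¹ + (f.eval μ / (f.h₀ * μ))
          * (f.eval μ / (f.h₀ * μ))) - 1) =O[atTop] fun μ : ℝ => μ⁻¹ := by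
        have h3 := (isBigO_mul_sub_one hb hb inv_isBigO_one).add
          ((isBigO_refl (fun μ : ℝ => μ⁻¹) atTop).const_mul_left (f.h₀ ^ 2)⁻¹)
        exact h3.congr_left fun μ => by ring
      refine (isBigO_mul_sub_one f.prod_isBigO h2 inv_isBigO_one).congr' ?_ .rfl
      filter_upwards [f.eventually_nonpole, eventually_ge_atTop 1] with μ h5 h6
      have h0 : μ ≠ 0 := by linarith
      have hi : (fn f).ind = ((2 * f.d + 1 : ℕ) : ℤ) := by simp [ind, RatHN.ind, h]
      have hl : f.lead = 1 / f.h₀ := by simp [RatHN.lead, h]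
      rw [radius_sq_fn f h6 h5, hdown μ h0, hi, zpow_natCast, hl]
      field_simp
      ring

/-- The quotient is f' / (1 + f² / μ). Either h₀ = 0 and f' = O(1/μ), or f' is bounded and the
denominator grows linearly. So the boundary terms of the norming constants are of lower order. -/
theorem wronskian_div_radius_sq_isBigO (f : BC) :
    (fun μ => f.wronskian.eval μ / f.radius μ ^ 2) =O[atTop] fun μ => μ⁻¹ := by
  cases f with
  | dirichlet =>
    have : (fun μ => dirichlet.wronskian.eval μ / dirichlet.radius μ ^ 2) = fun _ => 0 := by
      funext μ; simp [wronskian, up, down]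
    rw [this]
    exact isBigO_zero _ _
  | fn f =>
    have key : (fun μ => (f.h₀ + ∑ k, f.δ k / (f.p k - μ) ^ 2) * (1 + f.eval μ ^ 2 / μ)⁻¹)
        =O[atTop] fun μ : ℝ => μ⁻¹ := by
      rcases f.h₀_nonneg.eq_or_lt with h | h
      · have h1 : (fun μ => (1 + f.eval μ ^ 2 / μ)⁻¹) =O[atTop] fun _ : ℝ => (1 : ℝ) := by
          refine IsBigO.of_bound 1 ?_
          filter_upwards [eventually_gt_atTop 0] with μ hμ
          have h2 : 0 ≤ f.eval μ ^ 2 / μ := by positivity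
          rw [Real.norm_of_nonneg (by positivity)]
          simpa using inv_le_one_of_one_le₀ (by linarith)
        have h3 := f.deriv_isBigO.mul h1
        simp only [mul_one] at h3
        refine h3.congr_left fun μ => ?_
        rw [← h, zero_add]
      · have h1 := (isBigO_const_const f.h₀ one_ne_zero atTop).add
          (f.deriv_isBigO.trans inv_isBigO_one)
        have h2 : (fun μ => (1 + f.eval μ ^ 2 / μ)⁻¹) =O[atTop] fun μ : ℝ => μ⁻¹ := by
          refine IsBigO.of_bound (4 / f.h₀ ^ 2) ?_
          filter_upwards [eventually_gt_atTop 0, f.eventually_eval_ge h] with μ hμ h3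
          have h4 : 0 ≤ f.eval μ ^ 2 / μ := by positivity
          rw [Real.norm_of_nonneg (by positivity), Real.norm_of_nonneg (by positivity)]
          have h5 : f.h₀ ^ 2 / 4 * μ ≤ 1 + f.eval μ ^ 2 / μ := by
            have h6 : (f.h₀ / 2 * μ) ^ 2 ≤ f.eval μ ^ 2 := by gcongr
            have h7 : f.h₀ ^ 2 / 4 * μ ≤ f.eval μ ^ 2 / μ := by
              rw [le_div_iff₀ hμ]; nlinarith
            linarith
          calc (1 + f.eval μ ^ 2 / μ)⁻¹ ≤ (f.h₀ ^ 2 / 4 * μ)⁻¹ := by gcongr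
            _ = _ := by field_simp
        simpa using h1.mul h2
    refine key.congr' ?_ .rfl
    filter_upwards [f.eventually_nonpole, eventually_ge_atTop 1] with μ h5 h6
    have hd := (f.eval_eq_div μ fun k => (h5 k).ne').1
    have h0 : 0 < μ := by linarith
    have h7 : 1 + f.eval μ ^ 2 / μ ≠ 0 := by positivity
    rw [f.wronskian_eval μ fun k => (h5 k).ne', radius_sq_fn f h6 h5]
    field_simp

/-- Far to the left of the poles f ≤ |h| + ∑ δ k, because h₀ μ ≤ 0 and every p k - μ ≥ 1. From scale
· cos = -f · sin the cosine of the angle is at least -C / scale, so the angle exceeds π/2 by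
arbitrarily little. The margin π/32 is the one budgeted for in `prueferAngle_mem_of_neg`. -/
theorem eventually_angle_le (f : BC) :
    ∀ᶠ μ in atBot, f.angle μ ≤ Real.pi / 2 + Real.pi / 32 := by
  have hpi := Real.pi_pos
  cases f with
  | dirichlet => exact .of_forall fun μ => by simp only [angle, Pi.zero_apply]; positivity
  | fn f =>
    set C := |f.h| + ∑ k, f.δ k with hC
    have hC0 : 0 ≤ C := add_nonneg (abs_nonneg _) (Finset.sum_nonneg fun k _ => (f.δ_pos k).le)
    have hsin : 0 < Real.sin (Real.pi / 32) :=
      Real.sin_pos_of_pos_of_lt_pi (by positivity) (by linarith)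
    have hp : ∀ᶠ μ : ℝ in atBot, ∀ k, μ ≤ f.p k - 1 :=
      eventually_all.mpr fun k => eventually_le_atBot _
    have hscale : Tendsto scale atBot atTop := by
      refine tendsto_atTop_mono (fun μ => le_max_right 1 √|μ|) ?_
      exact Real.tendsto_sqrt_atTop.comp tendsto_abs_atBot_atTop
    filter_upwards [hp, eventually_le_atBot 0,
      hscale.eventually_ge_atTop (C / Real.sin (Real.pi / 32))] with μ h1 h2 h3
    have hs := scale_pos μ
    have hne : ∀ k, μ ≠ f.p k := fun k => by linarith [h1 k]
    have hf : f.eval μ ≤ C := by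
      rw [RatHN.eval, hC]
      have h4 : f.h₀ * μ ≤ 0 := mul_nonpos_of_nonneg_of_nonpos f.h₀_nonneg h2
      have h5 := le_abs_self f.h
      have h6 : ∑ k, f.δ k / (f.p k - μ) ≤ ∑ k, f.δ k := by
        refine Finset.sum_le_sum fun k _ => ?_
        exact div_le_self (f.δ_pos k).le (by linarith [h1 k])
      linarith
    have hN : f.poleCount μ = 0 := by
      rw [RatHN.poleCount, Finset.card_eq_zero, Finset.filter_eq_empty_iff]
      intro k _
      linarith [h1 k]
    obtain ⟨e1, e2⟩ := (fn f).down_up_eq_polar μ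
    have hr := (fn f).radius_pos μ
    set a := (fn f).angle μ with ha
    have ha0 : 0 ≤ a := (fn f).angle_nonneg μ
    have haπ : a ≤ Real.pi := by
      rw [ha]
      simp only [angle, RatHN.angle, hN]
      simpa using Complex.arg_le_pi _
    simp only [down, up] at e1 e2
    rw [f.up_eval_eq_mul μ hne, e1] at e2
    have e3 : -(f.eval μ * Real.sin a) = scale μ * Real.cos a := by
      have := hr.ne'
      refine mul_left_cancel₀ this ?_
      linear_combination e2
    by_contra! hlt
    have h7 : Real.cos a < -Real.sin (Real.pi / 32) := by
      rw [← Real.cos_add_pi_div_two]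
      refine Real.cos_lt_cos_of_nonneg_of_le_pi (by positivity) haπ (by linarith)
    have h8 : 0 ≤ Real.sin a := Real.sin_nonneg_of_nonneg_of_le_pi ha0 haπ
    have h9 := Real.sin_le_one a
    rw [div_le_iff₀ hsin] at h3
    nlinarith [mul_le_mul_of_nonneg_right hf h8]

end BC

end SturmLiouville

end

/-! ### Continuity of φ and of its Prüfer angle in the spectral parameter -/

noncomputable section

namespace SturmLiouville

open MeasureTheory Set Filter Topology intervalIntegral Polynomial

variable {q : ℝ → ℝ}

theorem IsPhi.isPruefer (hq : IntervalIntegrable q volume 0 Real.pi) {f : BC} {μ : ℝ}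
    {φ φ' : ℝ → ℝ} (h : IsPhi q f μ φ φ') :
    IsPruefer q μ (scale μ) (f.radius μ) φ φ'
      (prueferAngle q μ (scale μ) (f.angle μ) φ φ') (prueferLog q μ (scale μ) φ φ') := by
  obtain ⟨h1, h2⟩ := f.down_up_eq_polar μ
  exact h.1.isPruefer hq (scale_pos μ) (f.radius_pos μ) (h.2.1.trans h1) (h.2.2.trans h2)

theorem exists_isPhi (hq : IntervalIntegrable q volume 0 Real.pi) (f : BC) (μ : ℝ) :
    ∃ p : (ℝ → ℝ) × (ℝ → ℝ), IsPhi q f μ p.1 p.2 := by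
  obtain ⟨y, y', h1, h2, h3⟩ := exists_isSolution hq μ (f.down.eval μ) (-f.up.eval μ)
  exact ⟨(y, y'), h1, h2, h3⟩

/-- The solution `φ(·, μ)`. -/
def phi (hq : IntervalIntegrable q volume 0 Real.pi) (f : BC) (μ : ℝ) : ℝ → ℝ :=
  (exists_isPhi hq f μ).choose.1

/-- The derivative of `φ(·, μ)`. -/
def phi' (hq : IntervalIntegrable q volume 0 Real.pi) (f : BC) (μ : ℝ) : ℝ → ℝ :=
  (exists_isPhi hq f μ).choose.2

theorem isPhi_phi (hq : IntervalIntegrable q volume 0 Real.pi) (f : BC) (μ : ℝ) :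
    IsPhi q f μ (phi hq f μ) (phi' hq f μ) := (exists_isPhi hq f μ).choose_spec

/-- The Prüfer angle of `φ(·, μ)`. -/
def phiAngle (hq : IntervalIntegrable q volume 0 Real.pi) (f : BC) (μ : ℝ) : ℝ → ℝ :=
  prueferAngle q μ (scale μ) (f.angle μ) (phi hq f μ) (phi' hq f μ)

/-- The angle whose multiples of `π` mark the eigenvalues. -/
def charAngle (hq : IntervalIntegrable q volume 0 Real.pi) (f F : BC) (μ : ℝ) : ℝ :=
  phiAngle hq f μ Real.pi - Real.pi + F.angle μ

/-- The bound `IsSolution.energy_sub_le`, with an exponential constant that is uniform for |ν - μ| <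
1; its remaining factor is continuous in ν and vanishes at μ. -/
theorem phi_tendstoUniformlyOn (hq : IntervalIntegrable q volume 0 Real.pi) (f : BC) (μ : ℝ) :
    TendstoUniformlyOn (phi hq f) (phi hq f μ) (𝓝 μ) (Icc 0 Real.pi) ∧
    TendstoUniformlyOn (phi' hq f) (phi' hq f μ) (𝓝 μ) (Icc 0 Real.pi) := by
  have hφ := isPhi_phi hq f
  set C := ∫ t in (0 : ℝ)..Real.pi, (2 + (|q t| + (|μ| + 1))) with hC
  set J := ∫ t in (0 : ℝ)..Real.pi, phi hq f μ t ^ 2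
  set R : ℝ → ℝ := fun ν => Real.exp C * ((f.down.eval ν - f.down.eval μ) ^ 2
    + (-f.up.eval ν - -f.up.eval μ) ^ 2 + (ν - μ) ^ 2 * J) with hR
  have hR0 : Tendsto R (𝓝 μ) (𝓝 0) := by
    have hc : Continuous R := by
      have := f.down.continuous
      have := f.up.continuous
      fun_prop
    have := hc.tendsto μ
    simpa [hR] using this
  have hb : ∀ᶠ ν in 𝓝 μ, ∀ x ∈ Icc 0 Real.pi, (phi hq f ν x - phi hq f μ x) ^ 2
      + (phi' hq f ν x - phi' hq f μ x) ^ 2 ≤ R ν := by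
    filter_upwards [Metric.ball_mem_nhds μ one_pos] with ν hν x hx
    have h1 := (hφ μ).1.energy_sub_le hq (hφ ν).1 hx
    rw [(hφ μ).2.1, (hφ μ).2.2, (hφ ν).2.1, (hφ ν).2.2] at h1
    refine h1.trans ?_
    have hJ : 0 ≤ J := integral_nonneg Real.pi_pos.le fun t _ => sq_nonneg _
    have hle : ∫ t in (0 : ℝ)..Real.pi, (2 + |q t - ν|) ≤ C := by
      refine integral_mono_on Real.pi_pos.le
        (intervalIntegrable_const.add (intervalIntegrable_sub_const hq ν).abs)
        (intervalIntegrable_const.add (hq.abs.add intervalIntegrable_const)) fun t _ => ?_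
      have h2 : |ν - μ| < 1 := by simpa [Real.dist_eq] using hν
      have h3 : |ν| ≤ |μ| + 1 := by
        have := abs_sub_abs_le_abs_sub ν μ
        linarith
      have h4 := abs_sub (q t) ν
      linarith
    simp only [hR]
    gcongr
  have key : ∀ ε > 0, ∀ᶠ ν in 𝓝 μ, ∀ x ∈ Icc 0 Real.pi,
      |phi hq f ν x - phi hq f μ x| < ε ∧ |phi' hq f ν x - phi' hq f μ x| < ε := by
    intro ε hε
    filter_upwards [hb, hR0.eventually_lt_const (show (0 : ℝ) < ε ^ 2 by positivity)]
      with ν h1 h2 x hx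
    have h3 := h1 x hx
    constructor <;> refine abs_lt_of_sq_lt_sq ?_ hε.le
    · nlinarith [sq_nonneg (phi' hq f ν x - phi' hq f μ x)]
    · nlinarith [sq_nonneg (phi hq f ν x - phi hq f μ x)]
  constructor <;> rw [Metric.tendstoUniformlyOn_iff] <;> intro ε hε <;>
    filter_upwards [key ε hε] with ν hν x hx <;> rw [dist_comm, Real.dist_eq]
  · exact (hν x hx).1
  · exact (hν x hx).2

theorem phi_tendsto (hq : IntervalIntegrable q volume 0 Real.pi) (f : BC) (μ : ℝ) {x : ℝ}
    (hx : x ∈ Icc 0 Real.pi) : ContinuousAt (fun ν => phi hq f ν x) μ ∧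
      ContinuousAt (fun ν => phi' hq f ν x) μ :=
  ⟨(phi_tendstoUniformlyOn hq f μ).1.tendsto_at hx, (phi_tendstoUniformlyOn hq f μ).2.tendsto_at hx⟩

theorem continuousAt_integral_phi_mul (hq : IntervalIntegrable q volume 0 Real.pi) (f : BC)
    (μ : ℝ) : ContinuousAt (fun ν => ∫ t in (0 : ℝ)..Real.pi, phi hq f ν t * phi hq f μ t) μ := by
  have hc := fun ν => (isPhi_phi hq f ν).1.continuousOn
  obtain ⟨M, hM⟩ := isCompact_Icc.exists_bound_of_continuousOn (hc μ)
  refine continuousAt_of_dominated_interval (bound := fun _ => (M + 1) * M) ?_ ?_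
    intervalIntegrable_const ?_
  · refine .of_forall fun ν => ?_
    have : ContinuousOn (fun t => phi hq f ν t * phi hq f μ t) (uIcc 0 Real.pi) :=
      uIcc_pi ▸ (hc ν).mul (hc μ)
    exact this.intervalIntegrable.def'.aestronglyMeasurable
  · filter_upwards [Metric.tendstoUniformlyOn_iff.mp (phi_tendstoUniformlyOn hq f μ).1 1 one_pos]
      with ν hν
    refine .of_forall fun t ht => ?_
    rw [uIoc_of_le Real.pi_pos.le] at ht
    have ht' : t ∈ Icc 0 Real.pi := ⟨ht.1.le, ht.2⟩
    have h1 := hν t ht'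
    rw [dist_comm, dist_eq_norm] at h1
    have h2 := norm_sub_norm_le (phi hq f ν t) (phi hq f μ t)
    have h3 := hM t ht'
    rw [norm_mul]
    have h4 := norm_nonneg (phi hq f μ t)
    gcongr
    · linarith
    · linarith
  · refine .of_forall fun t ht => ?_
    rw [uIoc_of_le Real.pi_pos.le] at ht
    exact (phi_tendsto hq f μ ⟨ht.1.le, ht.2⟩).1.mul continuousAt_const

theorem IsPruefer.integrand_eq {μ κ r₀ : ℝ} (hκ : 0 < κ) (hr₀ : 0 < r₀) {y y' η L : ℝ → ℝ}
    (h : IsPruefer q μ κ r₀ y y' η L) {x : ℝ} (hx : x ∈ Icc 0 Real.pi) :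
    (κ * (y' x / κ) ^ 2 - (q x - μ) / κ * y x ^ 2) / (y x ^ 2 + (y' x / κ) ^ 2)
      = κ * Real.cos (η x) ^ 2 - (q x - μ) / κ * Real.sin (η x) ^ 2 := by
  have hpos := Real.exp_pos (L x)
  have hE : y x ^ 2 + (y' x / κ) ^ 2 = (r₀ * Real.exp (L x)) ^ 2 := by
    rw [h.eq_sin x hx, h.eq_cos x hx, mul_div_cancel_left₀ _ hκ.ne']
    linear_combination (r₀ * Real.exp (L x)) ^ 2 * Real.sin_sq_add_cos_sq (η x)
  rw [hE, h.eq_sin x hx, h.eq_cos x hx, mul_div_cancel_left₀ _ hκ.ne']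
  field_simp

/-- Dominated convergence in the integral that defines the angle: the integrand is continuous in μ
pointwise because the energy in the denominator never vanishes. -/
theorem continuous_phiAngle (hq : IntervalIntegrable q volume 0 Real.pi) (f : BC) :
    Continuous fun μ => phiAngle hq f μ Real.pi := by
  rw [continuous_iff_continuousAt]
  intro μ
  refine f.continuous_angle.continuousAt.add ?_
  obtain ⟨K, hK⟩ := (isCompact_Icc (a := μ - 1) (b := μ + 1)).exists_bound_of_continuousOn
    continuous_scale.continuousOn
  have hI : ∀ᶠ ν in 𝓝 μ, ν ∈ Icc (μ - 1) (μ + 1) := Icc_mem_nhds (by linarith) (by linarith)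
  -- In polar form the integrand is κ cos² η - (q - ν) κ⁻¹ sin² η, where κ ≤ K, κ ≥ 1 and |ν| ≤ |μ|
  -- + 1.
  refine continuousAt_of_dominated_interval
    (bound := fun t => K + (|q t| + (|μ| + 1))) ?_ ?_
    (intervalIntegrable_const.add (hq.abs.add intervalIntegrable_const)) ?_
  · refine .of_forall fun ν => ?_
    have hP := (isPhi_phi hq f ν).isPruefer hq
    refine (hP.angle.intervalIntegrable.def'.aestronglyMeasurable).congr ?_
    refine (ae_restrict_iff' measurableSet_uIoc).mpr (.of_forall fun t ht => ?_)
    rw [uIoc_of_le Real.pi_pos.le] at ht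
    exact (hP.integrand_eq (scale_pos ν) (f.radius_pos ν) ⟨ht.1.le, ht.2⟩).symm
  · filter_upwards [hI] with ν hν
    refine .of_forall fun t ht => ?_
    rw [uIoc_of_le Real.pi_pos.le] at ht
    rw [((isPhi_phi hq f ν).isPruefer hq).integrand_eq (scale_pos ν) (f.radius_pos ν)
      ⟨ht.1.le, ht.2⟩]
    have h1 := hK ν hν
    have h2 : 1 ≤ scale ν := le_max_left _ _
    have h3 : |ν| ≤ |μ| + 1 := by
      have := abs_sub_abs_le_abs_sub ν μ
      have h4 : |ν - μ| ≤ 1 := abs_le.mpr ⟨by linarith [hν.1], by linarith [hν.2]⟩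
      linarith
    set a := prueferAngle q ν (scale ν) (f.angle ν) (phi hq f ν) (phi' hq f ν) t
    refine (norm_sub_le _ _).trans (add_le_add ?_ ?_)
    · rw [norm_mul]
      refine (mul_le_of_le_one_right (norm_nonneg _) ?_).trans h1
      rw [Real.norm_of_nonneg (sq_nonneg _)]
      exact Real.cos_sq_le_one a
    · rw [norm_mul]
      refine (mul_le_of_le_one_right (norm_nonneg _) ?_).trans ?_
      · rw [Real.norm_of_nonneg (sq_nonneg _)]
        exact Real.sin_sq_le_one a
      · rw [norm_div, Real.norm_of_nonneg (scale_pos ν).le, Real.norm_eq_abs]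
        refine (div_le_self (abs_nonneg _) h2).trans ((abs_sub _ _).trans ?_)
        gcongr
  · refine .of_forall fun t ht => ?_
    rw [uIoc_of_le Real.pi_pos.le] at ht
    have ht' : t ∈ Icc 0 Real.pi := ⟨ht.1.le, ht.2⟩
    obtain ⟨h1, h2⟩ := phi_tendsto hq f μ ht'
    have hs : ContinuousAt scale μ := continuous_scale.continuousAt
    have hs0 := (scale_pos μ).ne'
    have hE := ((isPhi_phi hq f μ).1.energy_pos hq (scale_pos μ) (by
      rw [(isPhi_phi hq f μ).2.1, (isPhi_phi hq f μ).2.2, neg_ne_zero]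
      exact f.down_ne_zero_or_up_ne_zero μ) t ht').ne'
    have h3 := (h2.div hs hs0).pow 2
    have h4 := h1.pow 2
    exact ((hs.mul h3).sub (((continuousAt_const.sub continuousAt_id).div hs hs0).mul h4)).div
      (h4.add h3) hE

theorem continuous_charAngle (hq : IntervalIntegrable q volume 0 Real.pi) (f F : BC) :
    Continuous (charAngle hq f F) :=
  ((continuous_phiAngle hq f).sub continuous_const).add F.continuous_angle

end SturmLiouville

end

noncomputable section

namespace SturmLiouville

open MeasureTheory Set Filter Topology intervalIntegral Polynomial

variable {q : ℝ → ℝ}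

/-! ### Eigenvalues as levels of the characteristic angle -/

/-- The characteristic function, in terms of the values of `φ` at `π` and of the second
coefficient. -/
theorem characteristic_eq (hq : IntervalIntegrable q volume 0 Real.pi) {f F : BC} {μ : ℝ}
    {φ φ' : ℝ → ℝ} (h : IsPhi q f μ φ φ') {η : ℝ}
    (hη : η = prueferAngle q μ (scale μ) (f.angle μ) φ φ' Real.pi - Real.pi + F.angle μ) :
    φ Real.pi * F.up.eval μ - φ' Real.pi * F.down.eval μ
      = scale μ * (f.radius μ * Real.exp (prueferLog q μ (scale μ) φ φ' Real.pi)) * F.radius μ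
        * Real.sin η := by
  have hP := h.isPruefer hq
  obtain ⟨h1, h2⟩ := F.down_up_eq_polar μ
  have h3 : F.up.eval μ = -(scale μ * (F.radius μ * Real.cos (F.angle μ))) := by linarith
  rw [h1, h3, hP.eq_sin _ pi_mem_Icc_pi, hP.eq_cos _ pi_mem_Icc_pi, hη, sub_add_eq_add_sub,
    Real.sin_sub_pi, Real.sin_add]
  ring

theorem sin_charAngle_eq_zero_iff (hq : IntervalIntegrable q volume 0 Real.pi) (f F : BC) (μ : ℝ) :
    Real.sin (charAngle hq f F μ) = 0 ↔
      phi hq f μ Real.pi * F.up.eval μ = phi' hq f μ Real.pi * F.down.eval μ := by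
  have h := characteristic_eq hq (F := F) (isPhi_phi hq f μ) (η := charAngle hq f F μ) rfl
  have hpos : 0 < scale μ * (f.radius μ * Real.exp (prueferLog q μ (scale μ) (phi hq f μ)
      (phi' hq f μ) Real.pi)) * F.radius μ :=
    mul_pos (mul_pos (scale_pos μ) (mul_pos (f.radius_pos μ) (Real.exp_pos _))) (F.radius_pos μ)
  rw [← sub_eq_zero (a := phi hq f μ Real.pi * _), h, mul_eq_zero, or_iff_right hpos.ne']

theorem IsPhi.ne_zero {f : BC} {μ : ℝ} {φ φ' : ℝ → ℝ} (h : IsPhi q f μ φ φ') :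
    φ 0 ≠ 0 ∨ φ' 0 ≠ 0 := by
  rw [h.2.1, h.2.2, neg_ne_zero]
  exact f.down_ne_zero_or_up_ne_zero μ

/-- An eigenfunction and φ satisfy the same condition at 0, so their Wronskian vanishes there and
hence at π, and φ inherits the condition at π. Conversely φ itself is an eigenfunction. -/
theorem isEigenvalue_iff (hq : IntervalIntegrable q volume 0 Real.pi) (f F : BC) (μ : ℝ) :
    IsEigenvalue q f F μ ↔ ∃ k : ℤ, charAngle hq f F μ = k * Real.pi := by
  have hφ := isPhi_phi hq f μ
  have hsin : (∃ k : ℤ, charAngle hq f F μ = k * Real.pi) ↔ Real.sin (charAngle hq f F μ) = 0 := by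
    rw [Real.sin_eq_zero_iff]
    simp only [eq_comm]
  rw [hsin, sin_charAngle_eq_zero_iff]
  constructor
  · intro h
    obtain ⟨y, y', hy, ⟨x, hx, hne⟩, hb0, hbπ⟩ := IsSolution.exists_real hq h
    have hW := wronskian_sub_eq hq hy hφ.1 pi_mem_Icc_pi
    rw [hφ.2.1, hφ.2.2, sub_self, zero_mul] at hW
    have hW2 : y Real.pi * phi' hq f μ Real.pi = y' Real.pi * phi hq f μ Real.pi := by
      linear_combination hW - hb0
    by_cases hyπ : y Real.pi = 0
    · have hy'π : y' Real.pi ≠ 0 := fun h' => hne (hy.eq_zero hq pi_mem_Icc_pi hx hyπ h').1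
      rw [hyπ, zero_mul, eq_comm, mul_eq_zero, or_iff_right hy'π] at hW2
      rw [hyπ, mul_zero, mul_eq_zero, or_iff_left hy'π] at hbπ
      rw [hW2, hbπ]; ring
    · refine mul_left_cancel₀ hyπ ?_
      linear_combination (-phi hq f μ Real.pi) * hbπ - F.down.eval μ * hW2
  · intro h
    refine ⟨fun x => (phi hq f μ x : ℂ), fun x => (phi' hq f μ x : ℂ), hφ.1.ofReal, ?_, ?_, ?_⟩
    · by_contra! hz
      have hz' : ∀ x ∈ Icc 0 Real.pi, phi hq f μ x = 0 := fun x hx => by exact_mod_cast hz x hx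
      have hd := (hφ.1.hasDeriv 0 zero_mem_Icc_pi).congr (f₁ := fun _ => 0)
        (fun x hx => (hz' x hx).symm) (hz' 0 zero_mem_Icc_pi).symm
      have h0 := (uniqueDiffOn_Icc Real.pi_pos 0 zero_mem_Icc_pi).eq_deriv _ hd
        (hasDerivWithinAt_const _ _ _)
      exact hφ.ne_zero.elim (· (hz' 0 zero_mem_Icc_pi)) (· h0)
    all_goals
      have ev : ∀ p : ℝ[X], aeval (μ : ℂ) p = ((p.eval μ : ℝ) : ℂ) := fun p => by
        rw [← Complex.coe_algebraMap, aeval_algebraMap_apply]; simp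
      simp only [ev]
    · rw [hφ.2.1, hφ.2.2]; push_cast; ring
    · exact_mod_cast (by linear_combination -h :
        F.down.eval μ * phi' hq f μ Real.pi = F.up.eval μ * phi hq f μ Real.pi)

/-- At an eigenvalue the solutions `φ` and `ψ` are proportional at `π`. -/
theorem exists_factor (hq : IntervalIntegrable q volume 0 Real.pi) {f F : BC} {μ : ℝ} {k : ℤ}
    {φ φ' : ℝ → ℝ} (h : IsPhi q f μ φ φ')
    (hk : prueferAngle q μ (scale μ) (f.angle μ) φ φ' Real.pi - Real.pi + F.angle μ
      = k * Real.pi) :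
    φ Real.pi = f.radius μ * Real.exp (prueferLog q μ (scale μ) φ φ' Real.pi) *
        Real.cos (k * Real.pi) / F.radius μ * F.down.eval μ ∧
      φ' Real.pi = f.radius μ * Real.exp (prueferLog q μ (scale μ) φ φ' Real.pi) *
        Real.cos (k * Real.pi) / F.radius μ * F.up.eval μ := by
  have hP := h.isPruefer hq
  obtain ⟨h1, h2⟩ := F.down_up_eq_polar μ
  have h3 : F.up.eval μ = -(scale μ * (F.radius μ * Real.cos (F.angle μ))) := by linarith
  have h4 : prueferAngle q μ (scale μ) (f.angle μ) φ φ' Real.pi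
      = k * Real.pi + (Real.pi - F.angle μ) := by linarith
  have hR := (F.radius_pos μ).ne'
  rw [hP.eq_sin _ pi_mem_Icc_pi, hP.eq_cos _ pi_mem_Icc_pi, h1, h3, h4, Real.sin_add, Real.cos_add,
    Real.sin_int_mul_pi, Real.sin_pi_sub, Real.cos_pi_sub]
  constructor <;> field_simp <;> ring

/-- Where p vanishes, continuity of u suffices for the product rule. Thus the characteristic
function can be differentiated at an eigenvalue without differentiating φ in μ. -/
theorem hasDerivAt_mul_of_eq_zero {u p : ℝ → ℝ} {p' a : ℝ} (hu : ContinuousAt u a)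
    (hp : HasDerivAt p p' a) (h0 : p a = 0) : HasDerivAt (fun x => u x * p x) (u a * p') a := by
  rw [hasDerivAt_iff_tendsto_slope] at hp ⊢
  refine ((hu.tendsto.mono_left nhdsWithin_le_nhds).mul hp).congr fun x => ?_
  simp only [slope, h0, vsub_eq_sub, mul_zero, sub_zero, smul_eq_mul]
  ring

theorem eventually_sign_of_hasDerivAt {p : ℝ → ℝ} {p' a : ℝ} (hp : HasDerivAt p p' a)
    (h0 : p a = 0) (hpos : 0 < p') : (∀ᶠ x in 𝓝[>] a, 0 < p x) ∧ ∀ᶠ x in 𝓝[<] a, p x < 0 := by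
  rw [hasDerivAt_iff_tendsto_slope] at hp
  have h1 := hp.eventually_const_lt hpos
  constructor
  · have h2 := h1.filter_mono (nhdsWithin_mono a (fun x hx => ne_of_gt hx : Ioi a ⊆ {a}ᶜ))
    filter_upwards [h2, self_mem_nhdsWithin] with x hx hxa
    rw [slope, vsub_eq_sub, h0, sub_zero, smul_eq_mul] at hx
    exact pos_of_mul_pos_right hx (inv_nonneg.mpr (sub_nonneg.mpr (le_of_lt hxa)))
  · have h2 := h1.filter_mono (nhdsWithin_mono a (fun x hx => ne_of_lt hx : Iio a ⊆ {a}ᶜ))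
    filter_upwards [h2, self_mem_nhdsWithin] with x hx hxa
    rw [slope, vsub_eq_sub, h0, sub_zero, smul_eq_mul] at hx
    have h3 : (x - a)⁻¹ < 0 := inv_lt_zero.mpr (sub_neg.mpr hxa)
    by_contra! hneg
    nlinarith

/-- The derivative of the characteristic function at an eigenvalue. -/
theorem hasDerivAt_characteristic (hq : IntervalIntegrable q volume 0 Real.pi) (f F : BC) {μ t : ℝ}
    (hu : phi hq f μ Real.pi = t * F.down.eval μ) (hv : phi' hq f μ Real.pi = t * F.up.eval μ) :
    HasDerivAt (fun ν => t * (phi hq f ν Real.pi * F.up.eval ν - phi' hq f ν Real.pi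
        * F.down.eval ν))
      (f.wronskian.eval μ + (∫ x in (0 : ℝ)..Real.pi, phi hq f μ x ^ 2)
        + t ^ 2 * F.wronskian.eval μ) μ := by
  have hφ := isPhi_phi hq f
  obtain ⟨hcu, hcv⟩ := phi_tendsto hq f μ pi_mem_Icc_pi
  have h1 := f.hasDerivAt_up_mul_sub μ
  have h2 := hasDerivAt_mul_of_eq_zero (continuousAt_integral_phi_mul hq f μ)
    ((hasDerivAt_id μ).sub_const μ) (sub_self _)
  have h3 := (hasDerivAt_mul_of_eq_zero hcu ((F.up.hasDerivAt μ).sub_const (F.up.eval μ))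
    (sub_self _)).const_mul t
  have h4 := (hasDerivAt_mul_of_eq_zero hcv ((F.down.hasDerivAt μ).sub_const (F.down.eval μ))
    (sub_self _)).const_mul t
  -- Lagrange's identity for φ(·, ν) and φ(·, μ) rewrites the function as f_↑(ν) f_↓(μ) - f_↑(μ)
  -- f_↓(ν), plus (ν - μ) ∫ φ_ν φ_μ, plus t times φ_ν(π) (F_↑(ν) - F_↑(μ)) - φ_ν'(π) (F_↓(ν) -
  -- F_↓(μ)). The first summand is a polynomial, and every later product has a factor vanishing at ν
  -- = μ.
  refine (((h1.add h2).add (h3.sub h4)).congr_of_eventuallyEq (.of_forall fun ν => ?_)).congr_deriv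
    ?_
  · have hW := wronskian_sub_eq hq (hφ ν).1 (hφ μ).1 pi_mem_Icc_pi
    rw [(hφ ν).2.1, (hφ ν).2.2, (hφ μ).2.1, (hφ μ).2.2, hu, hv] at hW
    simp only [Pi.add_apply, Pi.sub_apply, id_eq]
    linear_combination hW
  · simp only [BC.wronskian, eval_sub, eval_mul, hu, hv, ← sq]
    ring

/-- A multiple of the characteristic function has a positive derivative at μ, namely the norming
constant, and it is a positive factor times the sine of `charAngle` - kπ. Within π of the level, the
sign of the sine is the sign of the difference. -/
theorem charAngle_crossing (hq : IntervalIntegrable q volume 0 Real.pi) (f F : BC) (μ : ℝ) (k : ℤ)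
    (hk : charAngle hq f F μ = k * Real.pi) :
    (∀ᶠ ν in 𝓝[>] μ, k * Real.pi < charAngle hq f F ν) ∧
      ∀ᶠ ν in 𝓝[<] μ, charAngle hq f F ν < k * Real.pi := by
  have hφ := isPhi_phi hq f
  obtain ⟨hu, hv⟩ := exists_factor hq (hφ μ) hk
  set c := Real.cos (k * Real.pi) with hc
  have hsink : Real.sin (k * Real.pi) = 0 := Real.sin_int_mul_pi k
  have hc2 : c * c = 1 := by
    have := Real.sin_sq_add_cos_sq (k * Real.pi)
    rw [hsink] at this
    rw [hc]; linarith
  set s := f.radius μ * Real.exp (prueferLog q μ (scale μ) (phi hq f μ) (phi' hq f μ) Real.pi)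
    / F.radius μ with hs
  have hspos : 0 < s := div_pos (mul_pos (f.radius_pos μ) (Real.exp_pos _)) (F.radius_pos μ)
  have ht : f.radius μ * Real.exp (prueferLog q μ (scale μ) (phi hq f μ) (phi' hq f μ) Real.pi)
      * c / F.radius μ = s * c := by rw [hs]; ring
  rw [ht] at hu hv
  have hD := hasDerivAt_characteristic hq f F hu hv
  have hpos : 0 < f.wronskian.eval μ + (∫ x in (0 : ℝ)..Real.pi, phi hq f μ x ^ 2)
        + (s * c) ^ 2 * F.wronskian.eval μ := by
    have h1 := f.wronskian_nonneg μ
    have h2 := mul_nonneg (sq_nonneg (s * c)) (F.wronskian_nonneg μ)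
    have h3 : 0 < ∫ x in (0 : ℝ)..Real.pi, phi hq f μ x ^ 2 := by
      have hcont := (hφ μ).1.continuousOn
      have hne : ∃ x ∈ Icc 0 Real.pi, phi hq f μ x ≠ 0 := by
        by_contra! hz
        have hd := ((hφ μ).1.hasDeriv 0 zero_mem_Icc_pi).congr (f₁ := fun _ => 0)
          (fun x hx => (hz x hx).symm) (hz 0 zero_mem_Icc_pi).symm
        have h0 := (uniqueDiffOn_Icc Real.pi_pos 0 zero_mem_Icc_pi).eq_deriv _ hd
          (hasDerivWithinAt_const _ _ _)
        exact (hφ μ).ne_zero.elim (· (hz 0 zero_mem_Icc_pi)) (· h0)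
      obtain ⟨x, hx, hx0⟩ := hne
      exact intervalIntegral.integral_pos Real.pi_pos (hcont.pow 2) (fun _ _ => sq_nonneg _)
        ⟨x, hx, by positivity⟩
    linarith
  have h0 : s * c * (phi hq f μ Real.pi * F.up.eval μ - phi' hq f μ Real.pi * F.down.eval μ)
      = 0 := by rw [hu, hv]; ring
  obtain ⟨hr, hl⟩ := eventually_sign_of_hasDerivAt hD h0 hpos
  have hsign : ∀ ν, ∃ r > 0, s * c * (phi hq f ν Real.pi * F.up.eval ν
      - phi' hq f ν Real.pi * F.down.eval ν) = r * Real.sin (charAngle hq f F ν - k * Real.pi) := by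
    intro ν
    refine ⟨s * (scale ν * (f.radius ν * Real.exp (prueferLog q ν (scale ν) (phi hq f ν)
      (phi' hq f ν) Real.pi)) * F.radius ν), ?_, ?_⟩
    · exact mul_pos hspos (mul_pos (mul_pos (scale_pos ν) (mul_pos (f.radius_pos ν)
        (Real.exp_pos _))) (F.radius_pos ν))
    · rw [characteristic_eq hq (hφ ν) (η := charAngle hq f F ν) rfl, Real.sin_sub, hsink, ← hc]
      ring
  have hnear : ∀ᶠ ν in 𝓝 μ, |charAngle hq f F ν - k * Real.pi| < Real.pi := by
    have := (continuous_charAngle hq f F).continuousAt (x := μ)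
    filter_upwards [Metric.continuousAt_iff'.mp this Real.pi Real.pi_pos] with ν hν
    rwa [Real.dist_eq, hk] at hν
  constructor
  · filter_upwards [hr, nhdsWithin_le_nhds hnear] with ν h1 h2
    obtain ⟨r, hr0, hr1⟩ := hsign ν
    rw [hr1] at h1
    have h3 := pos_of_mul_pos_right h1 hr0.le
    by_contra! h4
    have h5 := Real.sin_nonpos_of_nonpos_of_neg_pi_le (sub_nonpos.mpr h4) (abs_lt.mp h2).1.le
    linarith
  · filter_upwards [hl, nhdsWithin_le_nhds hnear] with ν h1 h2
    obtain ⟨r, hr0, hr1⟩ := hsign ν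
    rw [hr1] at h1
    have h3 : Real.sin (charAngle hq f F ν - k * Real.pi) < 0 := by
      by_contra! hn
      have := mul_nonneg hr0.le hn
      linarith
    by_contra! h4
    have h5 := Real.sin_nonneg_of_nonneg_of_le_pi (sub_nonneg.mpr h4) (abs_lt.mp h2).2.le
    linarith

/-! ### Behaviour of the characteristic angle at infinity -/

theorem abs_integral_mul_le (hq : IntervalIntegrable q volume 0 Real.pi) {g : ℝ → ℝ}
    (hg : ∀ x, |g x| ≤ 1) {x : ℝ} (hx : x ∈ Icc 0 Real.pi) :
    |∫ t in (0 : ℝ)..x, q t * g t| ≤ ∫ t in (0 : ℝ)..Real.pi, |q t| := by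
  have h0 : IntervalIntegrable (fun t => |q t|) volume 0 x :=
    hq.abs.mono_set (by rw [uIcc_pi, uIcc_of_le hx.1]; exact Icc_subset_Icc_right hx.2)
  have h1 : |∫ t in (0 : ℝ)..x, q t * g t| ≤ ∫ t in (0 : ℝ)..x, |q t| := by
    rw [← Real.norm_eq_abs]
    refine norm_integral_le_of_norm_le hx.1 (.of_forall fun t _ => ?_) h0
    rw [norm_mul]
    exact mul_le_of_le_one_right (norm_nonneg _) (hg t)
  refine h1.trans ?_
  have := (HasACDeriv.of_integral 0 hq.abs).mono_of_nonneg (fun _ _ => abs_nonneg _) hx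
    pi_mem_Icc_pi hx.2
  simpa using this

theorem sin_le_sin_of_mem {a b : ℝ} (hb : 0 ≤ b) (hb' : b ≤ Real.pi / 2) (h1 : b ≤ a)
    (h2 : a ≤ Real.pi - b) : Real.sin b ≤ Real.sin a := by
  rcases le_total a (Real.pi / 2) with h | h
  · exact Real.sin_le_sin_of_le_of_le_pi_div_two (by linarith) h h1
  · rw [← Real.sin_pi_sub a]
    exact Real.sin_le_sin_of_le_of_le_pi_div_two (by linarith) (by linarith) (by linarith)

theorem mul_sin_sq_intervalIntegrable (hq : IntervalIntegrable q volume 0 Real.pi) {g : ℝ → ℝ}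
    (hg : ContinuousOn g (Icc 0 Real.pi)) :
    IntervalIntegrable (fun t => q t * g t) volume 0 Real.pi :=
  hq.mul_continuousOn (uIcc_pi ▸ hg)

/-- For `μ = -κ²` the Prüfer angle is attracted by `π / 4`. -/
theorem prueferAngle_mem_of_neg (hq : IntervalIntegrable q volume 0 Real.pi) {κ r₀ : ℝ}
    (hκ1 : 1 ≤ κ) (hκ2 : (∫ t in (0 : ℝ)..Real.pi, |q t|) / κ ≤ Real.pi / 32)
    (hκ3 : 7 / 32 < κ * Real.sin (Real.pi / 16))
    {y y' η L : ℝ → ℝ} (h : IsPruefer q (-κ ^ 2) κ r₀ y y' η L) (h0 : 0 ≤ η 0)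
    (h1 : η 0 ≤ Real.pi / 2 + Real.pi / 32) :
    0 < η Real.pi ∧ η Real.pi ≤ 11 * Real.pi / 32 := by
  have hpi := Real.pi_pos
  have hκ : 0 < κ := by linarith
  have hηc := h.angle.continuousOn
  have hsc : ContinuousOn (fun t => Real.sin (η t) ^ 2) (Icc 0 Real.pi) :=
    (Real.continuous_sin.comp_continuousOn hηc).pow 2
  have hw := (HasACDeriv.of_integral 0 (mul_sin_sq_intervalIntegrable hq hsc)).const_mul κ⁻¹
  -- Adding w absorbs the merely integrable q: ζ = η + w is continuously differentiable with ζ' = κ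
  -- cos 2η, and it differs from η by at most π/32.
  set w : ℝ → ℝ := fun x => κ⁻¹ * (0 + ∫ t in (0 : ℝ)..x, q t * Real.sin (η t) ^ 2) with hw_def
  have hwb : ∀ x ∈ Icc 0 Real.pi, |w x| ≤ Real.pi / 32 := by
    intro x hx
    have h2 := abs_integral_mul_le hq (g := fun t => Real.sin (η t) ^ 2) (fun t => by
      rw [abs_of_nonneg (sq_nonneg _)]; exact Real.sin_sq_le_one _) hx
    rw [hw_def]
    simp only [zero_add]
    rw [abs_mul, abs_of_pos (inv_pos.mpr hκ), inv_mul_eq_div]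
    exact le_trans (by gcongr) hκ2
  have hcos : ContinuousOn (fun x => κ * Real.cos (2 * η x)) (Icc 0 Real.pi) :=
    continuousOn_const.mul (Real.continuous_cos.comp_continuousOn (continuousOn_const.mul hηc))
  have hζ := (h.angle.add hw).congr_deriv (g := fun x => κ * Real.cos (2 * η x)) fun x _ => by
    simp only
    rw [Real.cos_two_mul, Real.sin_sq]
    field_simp
    ring
  set ζ : ℝ → ℝ := fun x => η x + w x with hζ_def
  have hζd := hasDerivWithinAt_of_eq_integral hcos (y := ζ) fun x hx => hζ.eq_add_integral hx
  have hζd' : ∀ x ∈ Ico 0 Real.pi, HasDerivWithinAt ζ (κ * Real.cos (2 * η x)) (Ici x) x := by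
    intro x hx
    refine (hζd x ⟨hx.1, hx.2.le⟩).mono_of_mem_nhdsWithin ?_
    exact mem_of_superset (Icc_mem_nhdsGE hx.2) (Icc_subset_Icc_left hx.1)
  have hw0 : w 0 = 0 := by simp [hw_def]
  -- A barrier falling from 17π/32 to 10π/32. On it 2η - π/2 lies between π/16 and 5π/8, so ζ' ≤ -κ
  -- sin(π/16) < -7/32, and ζ cannot cross.
  have hup : ∀ x ∈ Icc 0 Real.pi, ζ x ≤ 17 * Real.pi / 32 - 7 / 32 * x := by
    refine image_le_of_deriv_right_lt_deriv_boundary hζ.continuousOn hζd'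
      (B' := fun _ => -(7 / 32)) ?_ ?_ ?_
    · simp only [hζ_def, hw0]; linarith
    · intro x
      exact (((hasDerivAt_id x).const_mul (7 / 32 : ℝ)).const_sub _).congr_deriv (by simp)
    · intro x hx hxe
      have h3 := abs_le.mp (hwb x ⟨hx.1, hx.2.le⟩)
      have h4 : η x = 17 * Real.pi / 32 - 7 / 32 * x - w x := by
        rw [← hxe]; simp [hζ_def]
      have h5 : Real.cos (2 * η x) = -Real.sin (2 * η x - Real.pi / 2) := by
        rw [Real.sin_sub_pi_div_two, neg_neg]
      have h6 : Real.sin (Real.pi / 16) ≤ Real.sin (2 * η x - Real.pi / 2) :=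
        sin_le_sin_of_mem (by positivity) (by linarith) (by linarith [hx.2]) (by linarith [hx.1])
      rw [h5]
      nlinarith
  -- A barrier rising from -π/32 to 2π/32. On it |2η| ≤ π/3, so ζ' ≥ κ/2 > 3/32. At π this leaves η
  -- ≥ π/32.
  have hlow : ∀ x ∈ Icc 0 Real.pi, -ζ x ≤ Real.pi / 32 - 3 / 32 * x := by
    refine image_le_of_deriv_right_lt_deriv_boundary hζ.continuousOn.neg
      (fun x hx => (hζd' x hx).neg) (B' := fun _ => -(3 / 32)) ?_ ?_ ?_
    · simp only [hζ_def, Pi.neg_apply, hw0]; linarith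
    · intro x
      exact (((hasDerivAt_id x).const_mul (3 / 32 : ℝ)).const_sub _).congr_deriv (by simp)
    · intro x hx hxe
      have h3 := abs_le.mp (hwb x ⟨hx.1, hx.2.le⟩)
      have h4 : η x = -(Real.pi / 32 - 3 / 32 * x) - w x := by
        rw [← hxe]; simp [hζ_def]
      have h6 : 1 / 2 ≤ Real.cos (2 * η x) := by
        rw [← Real.cos_pi_div_three, ← Real.cos_abs (2 * η x)]
        refine Real.cos_le_cos_of_nonneg_of_le_pi (abs_nonneg _) (by linarith) (abs_le.mpr ⟨?_, ?_⟩)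
        · linarith [hx.1]
        · linarith [hx.2]
      nlinarith
  have h3 := abs_le.mp (hwb Real.pi pi_mem_Icc_pi)
  have h4 := hup Real.pi pi_mem_Icc_pi
  have h5 := hlow Real.pi pi_mem_Icc_pi
  simp only [hζ_def] at h4 h5
  constructor <;> linarith [h3.1, h3.2]

/-- The angle at π lies in (0, 11π/32] and the second boundary angle in [0, 17π/32]. Their sum is
positive and below π. -/
theorem eventually_charAngle_mem (hq : IntervalIntegrable q volume 0 Real.pi) (f F : BC) :
    ∀ᶠ μ in atBot, charAngle hq f F μ ∈ Ioo (-Real.pi) 0 := by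
  have hpi := Real.pi_pos
  have hscale : Tendsto scale atBot atTop := by
    refine tendsto_atTop_mono (fun μ => le_max_right 1 √|μ|) ?_
    exact Real.tendsto_sqrt_atTop.comp tendsto_abs_atBot_atTop
  have hsin : 0 < Real.sin (Real.pi / 16) :=
    Real.sin_pos_of_pos_of_lt_pi (by positivity) (by linarith)
  filter_upwards [f.eventually_angle_le, F.eventually_angle_le, eventually_le_atBot (-1),
    hscale.eventually_ge_atTop ((∫ t in (0 : ℝ)..Real.pi, |q t|) / (Real.pi / 32)),
    hscale.eventually_gt_atTop (7 / 32 / Real.sin (Real.pi / 16))] with μ h1 h2 h3 h4 h5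
  have hs := scale_pos μ
  have hP := (isPhi_phi hq f μ).isPruefer hq
  have hμ : -scale μ ^ 2 = μ := by
    rw [scale_of_le_neg_one h3, Real.sq_sqrt (by linarith), neg_neg]
  obtain ⟨h6, h7⟩ := prueferAngle_mem_of_neg hq (κ := scale μ) (le_max_left _ _)
    (by
      rw [div_le_iff₀ hs]
      rwa [div_le_iff₀ (by positivity), mul_comm] at h4)
    (by rwa [div_lt_iff₀ hsin] at h5) (by rw [hμ]; exact hP)
    (by rw [prueferAngle_zero]; exact f.angle_nonneg μ) (by rw [prueferAngle_zero]; exact h1)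
  have h8 := F.angle_nonneg μ
  change prueferAngle q μ (scale μ) (f.angle μ) (phi hq f μ) (phi' hq f μ) Real.pi - Real.pi
    + F.angle μ ∈ _
  constructor <;> linarith

/-- For `μ = κ²` the Prüfer angle is `κ x` up to `O(1 / κ)`. -/
theorem IsPruefer.angle_eq (hq : IntervalIntegrable q volume 0 Real.pi) {κ r₀ : ℝ} (hκ : 0 < κ)
    {y y' η L : ℝ → ℝ} (h : IsPruefer q (κ ^ 2) κ r₀ y y' η L) {x : ℝ} (hx : x ∈ Icc 0 Real.pi) :
    η x = η 0 + κ * x - κ⁻¹ * ∫ t in (0 : ℝ)..x, q t * Real.sin (η t) ^ 2 := by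
  have hsc : ContinuousOn (fun t => Real.sin (η t) ^ 2) (Icc 0 Real.pi) :=
    (Real.continuous_sin.comp_continuousOn h.angle.continuousOn).pow 2
  have hw := (HasACDeriv.of_integral 0 (mul_sin_sq_intervalIntegrable hq hsc)).const_mul κ⁻¹
  have hx' : HasACDeriv (fun x => κ * x) (fun _ => κ) :=
    HasACDeriv.of_hasDerivWithinAt
      (fun x _ => by simpa using ((hasDerivAt_id x).const_mul κ).hasDerivWithinAt)
      continuousOn_const
  -- For μ = κ² the terms κ cos² η and κ sin² η add up to κ, and only q sin² η remains.
  have h1 := ((h.angle.add hw).sub hx').eq_of_zero (fun t _ => by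
    rw [Real.sin_sq]
    field_simp
    ring) hx
  simp only [integral_same, zero_add, mul_zero, add_zero, sub_zero] at h1
  linarith

theorem tendsto_charAngle (hq : IntervalIntegrable q volume 0 Real.pi) (f F : BC) :
    Tendsto (charAngle hq f F) atTop atTop := by
  have hpi := Real.pi_pos
  have h1 : Tendsto (fun μ : ℝ => √μ * Real.pi - (∫ t in (0 : ℝ)..Real.pi, |q t|) - Real.pi)
      atTop atTop := by
    simp only [sub_eq_add_neg]
    exact tendsto_atTop_add_const_right _ _ (tendsto_atTop_add_const_right _ _
      (Real.tendsto_sqrt_atTop.atTop_mul_const hpi))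
  refine tendsto_atTop_mono' _ ?_ h1
  filter_upwards [eventually_ge_atTop 1] with μ hμ
  have hs : scale μ = √μ := scale_of_one_le hμ
  have hs1 : 1 ≤ √μ := Real.one_le_sqrt.mpr hμ
  have hP := (isPhi_phi hq f μ).isPruefer hq
  have hP' : IsPruefer q (scale μ ^ 2) (scale μ) (f.radius μ) (phi hq f μ) (phi' hq f μ)
      (phiAngle hq f μ) (prueferLog q μ (scale μ) (phi hq f μ) (phi' hq f μ)) := by
    rw [hs, Real.sq_sqrt (by linarith), ← hs]
    exact hP
  have h2 := hP'.angle_eq hq (scale_pos μ) pi_mem_Icc_pi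
  have h3 := abs_integral_mul_le hq (g := fun t => Real.sin (phiAngle hq f μ t) ^ 2) (fun t => by
      rw [abs_of_nonneg (sq_nonneg _)]; exact Real.sin_sq_le_one _) pi_mem_Icc_pi
  have h4 : phiAngle hq f μ 0 = f.angle μ := prueferAngle_zero _ _ _ _ _
  have h5 := f.angle_nonneg μ
  have h6 := F.angle_nonneg μ
  have h7 : (scale μ)⁻¹ * ∫ t in (0 : ℝ)..Real.pi, q t * Real.sin (phiAngle hq f μ t) ^ 2
      ≤ ∫ t in (0 : ℝ)..Real.pi, |q t| := by
    refine (le_abs_self _).trans ?_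
    rw [abs_mul]
    refine (mul_le_of_le_one_left (abs_nonneg _) ?_).trans h3
    rw [abs_of_pos (inv_pos.mpr (scale_pos μ)), hs]
    exact inv_le_one_of_one_le₀ hs1
  rw [charAngle, h2, h4, hs] at *
  linarith

end SturmLiouville

end

noncomputable section

namespace SturmLiouville

open MeasureTheory Set Filter Topology intervalIntegral Polynomial Asymptotics

variable {q : ℝ → ℝ}

/-! ### Existence of the spectral data -/

theorem IsSolution.const_mul {μ : ℝ} {y y' : ℝ → ℝ} (h : IsSolution q μ y y') (c : ℝ) :
    IsSolution q μ (fun x => c * y x) (fun x => c * y' x) where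
  hasDeriv x hx := (h.hasDeriv x hx).const_mul c
  deriv_eq x hx := by
    rw [h.deriv_eq x hx, mul_add, ← intervalIntegral.integral_const_mul]
    congr 1
    exact integral_congr fun t _ => by ring

theorem IsPhi.eqOn (hq : IntervalIntegrable q volume 0 Real.pi) {f : BC} {μ : ℝ}
    {φ φ' χ χ' : ℝ → ℝ} (h : IsPhi q f μ φ φ') (h2 : IsPhi q f μ χ χ') {x : ℝ}
    (hx : x ∈ Icc 0 Real.pi) : φ x = χ x ∧ φ' x = χ' x := by
  have h3 := h2.1.energy_sub_le hq h.1 hx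
  rw [h.2.1, h.2.2, h2.2.1, h2.2.2] at h3
  simp only [sub_self, ne_eq, OfNat.ofNat_ne_zero, not_false_eq_true, zero_pow, add_zero, zero_mul,
    mul_zero] at h3
  have h4 : φ x - χ x = 0 := by nlinarith [sq_nonneg (φ x - χ x), sq_nonneg (φ' x - χ' x)]
  have h5 : φ' x - χ' x = 0 := by nlinarith [sq_nonneg (φ x - χ x), sq_nonneg (φ' x - χ' x)]
  exact ⟨sub_eq_zero.mp h4, sub_eq_zero.mp h5⟩

/-- The logarithmic Prüfer radius of `φ(·, μ)`. -/
def phiLog (hq : IntervalIntegrable q volume 0 Real.pi) (f : BC) (μ : ℝ) : ℝ → ℝ :=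
  prueferLog q μ (scale μ) (phi hq f μ) (phi' hq f μ)

theorem isPruefer_phi (hq : IntervalIntegrable q volume 0 Real.pi) (f : BC) (μ : ℝ) :
    IsPruefer q μ (scale μ) (f.radius μ) (phi hq f μ) (phi' hq f μ) (phiAngle hq f μ)
      (phiLog hq f μ) := (isPhi_phi hq f μ).isPruefer hq

/-- The ratio `φ / ψ` at an eigenvalue. -/
theorem exists_ratio (hq : IntervalIntegrable q volume 0 Real.pi) {f F : BC} {μ : ℝ} {k : ℤ}
    (hk : charAngle hq f F μ = k * Real.pi) :
    ∃ t : ℝ, t ≠ 0 ∧ t ^ 2 = f.radius μ ^ 2 * Real.exp (2 * phiLog hq f μ Real.pi)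
        / F.radius μ ^ 2 ∧
      phi hq f μ Real.pi = t * F.down.eval μ ∧ phi' hq f μ Real.pi = t * F.up.eval μ := by
  obtain ⟨hu, hv⟩ := exists_factor hq (isPhi_phi hq f μ) hk
  have hsq : Real.cos (k * Real.pi) ^ 2 = 1 := by
    have := Real.sin_sq_add_cos_sq (k * Real.pi)
    rwa [Real.sin_int_mul_pi, zero_pow two_ne_zero, zero_add] at this
  have e : (f.radius μ * Real.exp (prueferLog q μ (scale μ) (phi hq f μ) (phi' hq f μ) Real.pi) *
        Real.cos (k * Real.pi) / F.radius μ) ^ 2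
      = f.radius μ ^ 2 * Real.exp (2 * phiLog hq f μ Real.pi) / F.radius μ ^ 2 := by
    rw [div_pow, mul_pow, mul_pow, hsq, mul_one, ← Real.exp_nat_mul]
    rfl
  refine ⟨_, fun h0 => ?_, e, hu, hv⟩
  rw [h0] at e
  have h1 := f.radius_pos μ
  have h2 := F.radius_pos μ
  have : 0 < f.radius μ ^ 2 * Real.exp (2 * phiLog hq f μ Real.pi) / F.radius μ ^ 2 := by positivity
  rw [← e] at this
  simp at this

theorem exists_isNormingConstant (hq : IntervalIntegrable q volume 0 Real.pi) {f F : BC} {μ : ℝ}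
    {k : ℤ} (hk : charAngle hq f F μ = k * Real.pi) : ∃ g, IsNormingConstant q f F μ g := by
  obtain ⟨t, ht, -, hu, hv⟩ := exists_ratio hq hk
  have hφ := isPhi_phi hq f μ
  refine ⟨_, phi hq f μ, phi' hq f μ, fun x => t⁻¹ * phi hq f μ x, fun x => t⁻¹ * phi' hq f μ x,
    t⁻¹, hφ, ⟨hφ.1.const_mul _, ?_, ?_⟩, inv_ne_zero ht, fun _ _ => rfl, rfl⟩
  · change t⁻¹ * phi hq f μ Real.pi = _
    rw [hu, inv_mul_cancel_left₀ ht]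
  · change t⁻¹ * phi' hq f μ Real.pi = _
    rw [hv, inv_mul_cancel_left₀ ht]

/-- Makes the norming constant explicit: φ is unique on [0, π], and comparison of ψ = βφ with φ(π) =
t F_↓, φ'(π) = t F_↑ gives βt = 1, as F_↓ and F_↑ do not both vanish. -/
theorem IsNormingConstant.eq (hq : IntervalIntegrable q volume 0 Real.pi) {f F : BC} {μ g : ℝ}
    {k : ℤ} (h : IsNormingConstant q f F μ g) (hk : charAngle hq f F μ = k * Real.pi) :
    g = (∫ x in (0 : ℝ)..Real.pi, phi hq f μ x ^ 2) + f.wronskian.eval μ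
      + f.radius μ ^ 2 * Real.exp (2 * phiLog hq f μ Real.pi) / F.radius μ ^ 2
        * F.wronskian.eval μ := by
  obtain ⟨φ, φ', ψ, ψ', β, hφ, hψ, hβ, heq, rfl⟩ := h
  obtain ⟨t, ht, ht2, hu, hv⟩ := exists_ratio hq hk
  have huniq := fun x hx => hφ.eqOn hq (isPhi_phi hq f μ) (x := x) hx
  have hint : ∫ x in (0 : ℝ)..Real.pi, φ x ^ 2 = ∫ x in (0 : ℝ)..Real.pi, phi hq f μ x ^ 2 := by
    refine integral_congr fun x hx => ?_
    rw [uIcc_pi] at hx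
    simp only [(huniq x hx).1]
  have hd : ψ' Real.pi = β * φ' Real.pi :=
    (uniqueDiffOn_Icc Real.pi_pos _ pi_mem_Icc_pi).eq_deriv _ (hψ.1.hasDeriv _ pi_mem_Icc_pi)
      (((hφ.1.const_mul β).hasDeriv _ pi_mem_Icc_pi).congr heq (heq _ pi_mem_Icc_pi))
  have h1 := heq _ pi_mem_Icc_pi
  rw [hψ.2.1, (huniq _ pi_mem_Icc_pi).1, hu] at h1
  rw [hψ.2.2, (huniq _ pi_mem_Icc_pi).2, hv] at hd
  have hβt : β * t = 1 := by
    rcases F.down_ne_zero_or_up_ne_zero μ with h | h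
    · exact mul_right_cancel₀ h (by linarith)
    · exact mul_right_cancel₀ h (by linarith)
  have : 1 / β ^ 2 = t ^ 2 := by
    rw [div_eq_iff (by positivity), ← mul_pow, mul_comm t, hβt, one_pow]
  rw [hint, this, ht2]

theorem exists_eigenvalues (hq : IntervalIntegrable q volume 0 Real.pi) (f F : BC) :
    ∃ ev : ℕ → ℝ, StrictMono ev ∧ (∀ n : ℕ, charAngle hq f F (ev n) = n * Real.pi) ∧
      {μ : ℂ | IsEigenvalue q f F μ} = range (fun n => (ev n : ℂ)) ∧ Tendsto ev atTop atTop := by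
  obtain ⟨ev, h1, h2, h3, h4⟩ := exists_crossings (continuous_charAngle hq f F)
    (fun x k h => (charAngle_crossing hq f F x k h).1)
    (fun x k h => (charAngle_crossing hq f F x k h).2)
    (eventually_charAngle_mem hq f F) (tendsto_charAngle hq f F)
  refine ⟨ev, h1, h2, ?_, h4⟩
  ext μ
  constructor
  · intro hμ
    have him := IsEigenvalue.im_eq_zero hq hμ
    have hμ' : μ = (μ.re : ℂ) := Complex.ext rfl (by simp [him])
    rw [hμ', mem_ofPred_eq, isEigenvalue_iff hq] at hμ
    obtain ⟨k, hk⟩ := hμ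
    obtain ⟨n, hn⟩ := h3 _ k hk
    refine ⟨n, ?_⟩
    simp only
    rw [hn, ← hμ']
  · rintro ⟨n, rfl⟩
    exact (isEigenvalue_iff hq f F _).mpr ⟨n, by exact_mod_cast h2 n⟩

theorem exists_isSpectralData (hq : IntervalIntegrable q volume 0 Real.pi) (f F : BC) :
    ∃ ev nc : ℕ → ℝ, IsSpectralData q f F ev nc := by
  obtain ⟨ev, h1, h2, h3, -⟩ := exists_eigenvalues hq f F
  choose nc hnc using fun n : ℕ => exists_isNormingConstant hq (k := (n : ℤ))
    (by exact_mod_cast h2 n)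
  exact ⟨ev, nc, h1, h3, hnc⟩

/-- A strictly increasing sequence is determined by its range, so every admissible enumeration is
the one produced by the crossings. This fixes the index n exactly. -/
theorem IsSpectralData.charAngle_eq (hq : IntervalIntegrable q volume 0 Real.pi) {f F : BC}
    {ev nc : ℕ → ℝ} (h : IsSpectralData q f F ev nc) :
    (∀ n : ℕ, charAngle hq f F (ev n) = n * Real.pi) ∧ Tendsto ev atTop atTop := by
  obtain ⟨ev', h1, h2, h3, h4⟩ := exists_eigenvalues hq f F
  have : ev = ev' := by
    rw [← StrictMono.range_inj h.strictMono h1]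
    have h5 := h.eigenvalues.symm.trans h3
    rw [range_comp' (fun x : ℝ => (x : ℂ)) ev, range_comp' (fun x : ℝ => (x : ℂ)) ev'] at h5
    exact Complex.ofReal_injective.image_injective h5
  rw [this]
  exact ⟨h2, h4⟩

/-! ### Remainder sequences -/

/-- `x` tends to zero, and is square summable if `P` holds. -/
def IsRemainder (P : Prop) (x : ℕ → ℝ) : Prop := Tendsto x atTop (𝓝 0) ∧ (P → Memℓp x 2)

theorem memℓp_two_iff {x : ℕ → ℝ} : Memℓp x 2 ↔ Summable fun n => x n ^ 2 := by
  rw [memℓp_gen_iff (by simp)]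
  simp

namespace IsRemainder

variable {P : Prop} {x y : ℕ → ℝ}

theorem add (hx : IsRemainder P x) (hy : IsRemainder P y) : IsRemainder P fun n => x n + y n :=
  ⟨by simpa using hx.1.add hy.1, fun h => (hx.2 h).add (hy.2 h)⟩

theorem const_mul (hx : IsRemainder P x) (c : ℝ) : IsRemainder P fun n => c * x n :=
  ⟨by simpa using hx.1.const_mul c, fun h => (hx.2 h).const_smul c⟩

theorem of_isBigO (h : x =O[atTop] fun n : ℕ => (n : ℝ)⁻¹) : IsRemainder P x := by
  refine ⟨h.trans_tendsto tendsto_inv_atTop_nhds_zero_nat, fun _ => memℓp_two_iff.mpr ?_⟩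
  have h2 : Summable fun n : ℕ => ((n : ℝ)⁻¹) ^ 2 := by
    simp
  exact summable_of_isBigO_nat h2 (h.pow 2)

theorem of_sub_isBigO (hx : IsRemainder P x)
    (h : (fun n => y n - x n) =O[atTop] fun n : ℕ => (n : ℝ)⁻¹) : IsRemainder P y := by
  have := hx.add (of_isBigO (P := P) h)
  simpa using this

end IsRemainder

/-- Fourier coefficients of an integrable function tend to zero, and are square summable if the
function is square integrable. -/
theorem isRemainder_fourier (hq : IntervalIntegrable q volume 0 Real.pi) (I : ℤ) (a : ℝ) :
    IsRemainder (MemLp q 2 (volume.restrict (Ioc 0 Real.pi)))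
      fun n => ∫ t in (0 : ℝ)..Real.pi, q t * Real.cos (a + (2 * n - I) * t) := by
  have hpi := Real.pi_pos
  set g : ℝ → ℂ := indicator (Ioc 0 Real.pi) fun t => (q t : ℂ) with hg
  set c : ℤ → ℂ := fun k => ∫ t in (0 : ℝ)..Real.pi, Complex.exp (-(k * t * Complex.I)) * q t
    with hc
  have hqc : IntervalIntegrable (fun t => (q t : ℂ)) volume 0 Real.pi :=
    ⟨hq.1.ofReal, hq.2.ofReal⟩
  have hci : ∀ k : ℤ, IntervalIntegrable (fun t : ℝ => Complex.exp (-(k * t * Complex.I)) * q t)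
      volume 0 Real.pi := fun k =>
    hqc.continuousOn_mul (by fun_prop)
  -- The real integral is the real part of a complex Fourier coefficient times a unimodular factor,
  -- so the phase a plays no role.
  have hbound : ∀ n : ℕ, ‖∫ t in (0 : ℝ)..Real.pi, q t * Real.cos (a + (2 * n - I) * t)‖
      ≤ ‖c (2 * n - I)‖ := by
    intro n
    have e : (∫ t in (0 : ℝ)..Real.pi, q t * Real.cos (a + (2 * n - I) * t))
        = (Complex.exp (-(a * Complex.I)) * c (2 * n - I)).re := by
      rw [hc]
      simp only
      rw [← intervalIntegral.integral_const_mul]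
      have := Complex.reCLM.intervalIntegral_comp_comm ((hci (2 * n - I)).const_mul
        (Complex.exp (-(a * Complex.I))))
      rw [← Complex.reCLM_apply, ← this]
      refine integral_congr fun t _ => ?_
      simp only [Complex.reCLM_apply]
      rw [← mul_assoc, ← Complex.exp_add, Complex.re_mul_ofReal]
      have : -(a * Complex.I) + -(((2 * n - I : ℤ) : ℂ) * t * Complex.I)
          = ((-(a + (2 * n - I) * t) : ℝ) : ℂ) * Complex.I := by push_cast; ring
      rw [this, Complex.exp_ofReal_mul_I_re, Real.cos_neg, mul_comm]
    rw [e]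
    refine (Complex.abs_re_le_norm _).trans ?_
    rw [norm_mul, show -((a : ℂ) * Complex.I) = ((-a : ℝ) : ℂ) * Complex.I by push_cast; ring,
      Complex.norm_exp_ofReal_mul_I, one_mul]
  constructor
  · refine squeeze_zero_norm hbound ?_
    -- Riemann-Lebesgue; the character is exp(2πi ·), whence the frequency is divided by 2π.
    have h1 := (Real.tendsto_integral_exp_smul_cocompact g).norm
    have h2 : Tendsto (fun n : ℕ => ((2 * n - I : ℤ) : ℝ) / (2 * Real.pi)) atTop (cocompact ℝ) := by
      refine Tendsto.mono_right ?_ atTop_le_cocompact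
      refine Tendsto.atTop_div_const (by positivity) ?_
      push_cast
      simp only [sub_eq_add_neg]
      exact tendsto_atTop_add_const_right _ _
        (tendsto_natCast_atTop_atTop.const_mul_atTop two_pos)
    have h3 := h1.comp h2
    rw [norm_zero] at h3
    refine h3.congr fun n => ?_
    simp only [Function.comp]
    congr 1
    rw [hc, hg]
    simp only
    rw [integral_of_le hpi.le, ← MeasureTheory.integral_indicator measurableSet_Ioc]
    congr 1
    funext v
    by_cases hv : v ∈ Ioc 0 Real.pi
    · rw [indicator_of_mem hv, indicator_of_mem hv, Circle.smul_def, Real.fourierChar_apply,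
        smul_eq_mul]
      congr 2
      push_cast
      field_simp
    · rw [indicator_of_notMem hv, indicator_of_notMem hv, smul_zero]
  · intro hL2
    rw [memℓp_two_iff]
    have h2pi : (0 : ℝ) < 2 * Real.pi := by positivity
    -- Parseval is applied on (0, 2π) to q extended by zero, because the frequencies 2n - I are
    -- integers but may be odd.
    have hsub : Ioc 0 Real.pi ⊆ Ioc 0 (2 * Real.pi) := Ioc_subset_Ioc_right (by linarith)
    have hgL2 : MemLp g 2 (volume.restrict (Ioc 0 (2 * Real.pi))) := by
      rw [hg, memLp_indicator_iff_restrict measurableSet_Ioc,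
        Measure.restrict_restrict measurableSet_Ioc, inter_eq_left.mpr hsub]
      exact hL2.ofReal
    have hs := (hasSum_sq_fourierCoeffOn h2pi hgL2).summable
    have hcoeff : ∀ k : ℤ, c k = 2 * Real.pi * fourierCoeffOn h2pi g k := by
      intro k
      rw [fourierCoeffOn_eq_integral, integral_of_le h2pi.le]
      have e : (fun x : ℝ => fourier (-k) (x : AddCircle (2 * Real.pi - 0)) • g x)
          = indicator (Ioc 0 Real.pi) fun t => Complex.exp (-(k * t * Complex.I)) * q t := by
        funext x
        by_cases hx : x ∈ Ioc 0 Real.pi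
        · rw [hg, indicator_of_mem hx, indicator_of_mem hx, fourier_coe_apply, smul_eq_mul]
          congr 2
          push_cast
          have : (Real.pi : ℂ) ≠ 0 := by exact_mod_cast hpi.ne'
          field_simp
          simp
          ring
        · rw [hg, indicator_of_notMem hx, indicator_of_notMem hx, smul_zero]
      rw [e, setIntegral_indicator measurableSet_Ioc, inter_eq_right.mpr hsub, hc]
      simp only
      rw [integral_of_le hpi.le, Complex.real_smul]
      have : (Real.pi : ℂ) ≠ 0 := by exact_mod_cast hpi.ne'
      generalize (∫ t in Ioc 0 Real.pi, Complex.exp (-(k * t * Complex.I)) * q t) = J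
      push_cast
      field_simp
      simp
      ring
    have hinj : Function.Injective fun n : ℕ => (2 * n - I : ℤ) := fun m n h => by
      simp only at h; omega
    have hs2 := (hs.comp_injective hinj).mul_left ((2 * Real.pi) ^ 2)
    refine Summable.of_nonneg_of_le (fun n => sq_nonneg _) (fun n => ?_) hs2
    rw [← sq_abs, ← Real.norm_eq_abs]
    have h1 := pow_le_pow_left₀ (norm_nonneg _) (hbound n) 2
    refine h1.trans_eq ?_
    rw [hcoeff, norm_mul, mul_pow]
    congr 2
    rw [norm_mul]
    simp [abs_of_pos hpi]

end SturmLiouville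

end

noncomputable section

namespace SturmLiouville

open MeasureTheory Set Filter Topology intervalIntegral

variable {q : ℝ → ℝ}

/-! ### The square integral of a solution -/

theorem abs_integral_mul_le_of_le (hq : IntervalIntegrable q volume 0 Real.pi) {g : ℝ → ℝ} {C : ℝ}
    (hg : ∀ x ∈ Icc 0 Real.pi, |g x| ≤ C) :
    |∫ t in (0 : ℝ)..Real.pi, q t * g t| ≤ C * ∫ t in (0 : ℝ)..Real.pi, |q t| := by
  rw [← Real.norm_eq_abs, ← intervalIntegral.integral_const_mul]
  refine norm_integral_le_of_norm_le Real.pi_pos.le (.of_forall fun t ht => ?_) (hq.abs.const_mul C)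
  rw [norm_mul, mul_comm]
  exact mul_le_mul_of_nonneg_right (hg t (Ioc_subset_Icc_self ht)) (norm_nonneg _)

namespace IsPruefer

variable {κ r₀ : ℝ} {y y' η L : ℝ → ℝ}

theorem angle_of_sq (hκ : 0 < κ) (h : IsPruefer q (κ ^ 2) κ r₀ y y' η L) :
    HasACDeriv η fun t => κ - q t * (κ⁻¹ * Real.sin (η t) ^ 2) :=
  h.angle.congr_deriv fun t _ => by
    simp only [Real.cos_sq']
    field_simp
    ring

/-- For μ = κ² the terms with κ cancel in L', so only q κ⁻¹ drives the radius, which is therefore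
nearly constant for large κ. -/
theorem exp_log_of_sq (hκ : 0 < κ) (h : IsPruefer q (κ ^ 2) κ r₀ y y' η L) :
    HasACDeriv (fun x => Real.exp (2 * L x))
      fun t => q t * (κ⁻¹ * (Real.exp (2 * L t) * Real.sin (2 * η t))) :=
  (h.log.const_mul 2).exp.congr_deriv fun t _ => by
    simp only [Real.sin_two_mul]
    field_simp
    ring

theorem abs_two_mul_log_le (hq : IntervalIntegrable q volume 0 Real.pi) (hκ : 0 < κ)
    (h : IsPruefer q (κ ^ 2) κ r₀ y y' η L) {x : ℝ} (hx : x ∈ Icc 0 Real.pi) :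
    |2 * L x| ≤ κ⁻¹ * ∫ t in (0 : ℝ)..Real.pi, |q t| := by
  have h1 : HasACDeriv (fun x => 2 * L x) fun t => κ⁻¹ * (q t * Real.sin (2 * η t)) :=
    (h.log.const_mul 2).congr_deriv fun t _ => by
      simp only [Real.sin_two_mul]
      field_simp
      ring
  have h2 := h1.eq_add_integral hx
  rw [h.log_zero, mul_zero, zero_add, intervalIntegral.integral_const_mul] at h2
  rw [h2, abs_mul, abs_of_pos (inv_pos.mpr hκ)]
  exact mul_le_mul_of_nonneg_left (abs_integral_mul_le hq (fun x => Real.abs_sin_le_one _) hx)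
    (inv_pos.mpr hκ).le

theorem abs_exp_log_sub_one_le (hq : IntervalIntegrable q volume 0 Real.pi) (hκ : 0 < κ)
    (h : IsPruefer q (κ ^ 2) κ r₀ y y' η L) (hκQ : κ⁻¹ * ∫ t in (0 : ℝ)..Real.pi, |q t| ≤ 1)
    {x : ℝ} (hx : x ∈ Icc 0 Real.pi) :
    |Real.exp (2 * L x) - 1| ≤ 2 * (κ⁻¹ * ∫ t in (0 : ℝ)..Real.pi, |q t|) := by
  have h1 := h.abs_two_mul_log_le hq hκ hx
  exact (Real.abs_exp_sub_one_le (h1.trans hκQ)).trans (by linarith)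

/-- An oscillating integral, after one integration by parts. -/
theorem integral_exp_mul_cos (hκ : 0 < κ) (hq : IntervalIntegrable q volume 0 Real.pi)
    (h : IsPruefer q (κ ^ 2) κ r₀ y y' η L) :
    2 * κ * ∫ t in (0 : ℝ)..Real.pi, Real.exp (2 * L t) * Real.cos (2 * η t)
      = Real.exp (2 * L Real.pi) * Real.sin (2 * η Real.pi) - Real.sin (2 * η 0)
        - κ⁻¹ * ∫ t in (0 : ℝ)..Real.pi, q t * (Real.exp (2 * L t) *
          (Real.sin (2 * η t) ^ 2 - 2 * Real.sin (η t) ^ 2 * Real.cos (2 * η t))) := by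
  have hη := h.angle.continuousOn
  have hL := h.log.continuousOn
  -- The derivative of exp(2L) sin 2η is 2κ exp(2L) cos 2η plus terms containing q.
  have h1 := ((h.exp_log_of_sq hκ).mul ((h.angle_of_sq hκ).const_mul 2).sin).integral_eq
    zero_mem_Icc_pi pi_mem_Icc_pi
  simp only [h.log_zero, mul_zero, Real.exp_zero, one_mul] at h1
  have hi1 : IntervalIntegrable (fun t => Real.exp (2 * L t) * Real.cos (2 * η t)) volume 0
      Real.pi := by
    refine ContinuousOn.intervalIntegrable ?_
    rw [uIcc_pi]
    fun_prop
  have hi2 : IntervalIntegrable (fun t => q t * (Real.exp (2 * L t) *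
      (Real.sin (2 * η t) ^ 2 - 2 * Real.sin (η t) ^ 2 * Real.cos (2 * η t)))) volume 0
      Real.pi := mul_sin_sq_intervalIntegrable hq (by fun_prop)
  rw [← h1, ← intervalIntegral.integral_const_mul, ← intervalIntegral.integral_const_mul,
    ← integral_sub ?_ (hi2.const_mul _)]
  rotate_left
  · refine (IntervalIntegrable.add (hi1.const_mul (2 * κ)) (hi2.const_mul κ⁻¹)).congr
      (fun t _ => ?_)
    ring
  exact integral_congr fun t _ => by ring

/-- Integration of the derivative of (π - x) exp(2L). The weight π - x vanishes at π, so the final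
value of L does not appear. -/
theorem integral_exp_log (hκ : 0 < κ) (h : IsPruefer q (κ ^ 2) κ r₀ y y' η L)
    (hq : IntervalIntegrable q volume 0 Real.pi) :
    ∫ t in (0 : ℝ)..Real.pi, Real.exp (2 * L t)
      = Real.pi + κ⁻¹ * ∫ t in (0 : ℝ)..Real.pi, q t *
        ((Real.pi - t) * (Real.exp (2 * L t) * Real.sin (2 * η t))) := by
  have hη := h.angle.continuousOn
  have hL := h.log.continuousOn
  have h0 : HasACDeriv (fun x => Real.pi - x) (fun _ => -1) :=
    HasACDeriv.of_hasDerivWithinAt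
      (fun x _ => by simpa using ((hasDerivAt_id x).const_sub Real.pi).hasDerivWithinAt)
      continuousOn_const
  have h1 := (h0.mul (h.exp_log_of_sq hκ)).integral_eq zero_mem_Icc_pi pi_mem_Icc_pi
  simp only [h.log_zero, mul_zero, Real.exp_zero, sub_self, zero_mul, sub_zero, mul_one,
    zero_sub] at h1
  have hi1 : IntervalIntegrable (fun t => Real.exp (2 * L t)) volume 0 Real.pi := by
    refine ContinuousOn.intervalIntegrable ?_
    rw [uIcc_pi]
    fun_prop
  have hi2 : IntervalIntegrable (fun t => q t *
      ((Real.pi - t) * (Real.exp (2 * L t) * Real.sin (2 * η t)))) volume 0 Real.pi :=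
    mul_sin_sq_intervalIntegrable hq (by fun_prop)
  have h2 : ∫ t in (0 : ℝ)..Real.pi, (-1 * Real.exp (2 * L t) + (Real.pi - t) *
      (q t * (κ⁻¹ * (Real.exp (2 * L t) * Real.sin (2 * η t)))))
      = ∫ t in (0 : ℝ)..Real.pi, (κ⁻¹ * (q t *
      ((Real.pi - t) * (Real.exp (2 * L t) * Real.sin (2 * η t)))) - Real.exp (2 * L t)) :=
    integral_congr fun t _ => by ring
  rw [h2, integral_sub (hi2.const_mul _) hi1, intervalIntegral.integral_const_mul] at h1
  linarith

/-- Since y² = r₀² exp(2L) (1 - cos 2η) / 2, the two preceding integrals give the value up to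
replacing exp(2L) by 1, a relative error of O(κ⁻¹) in a term already of order κ⁻¹. The boundary
sines are kept, because at the eigenvalues they are O(κ⁻¹) too. -/
theorem abs_integral_sq_sub_le (hq : IntervalIntegrable q volume 0 Real.pi) (hκ : 0 < κ)
    (h : IsPruefer q (κ ^ 2) κ r₀ y y' η L) (hκQ : κ⁻¹ * ∫ t in (0 : ℝ)..Real.pi, |q t| ≤ 1) :
    |(∫ t in (0 : ℝ)..Real.pi, y t ^ 2) - r₀ ^ 2 * (Real.pi / 2 + κ⁻¹ / 2 *
        ∫ t in (0 : ℝ)..Real.pi, q t * ((Real.pi - t) * Real.sin (2 * η t)))|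
      ≤ r₀ ^ 2 * ((Real.pi * (∫ t in (0 : ℝ)..Real.pi, |q t|) ^ 2
          + 9 / 4 * ∫ t in (0 : ℝ)..Real.pi, |q t|) * κ⁻¹ ^ 2
        + (3 * |Real.sin (2 * η Real.pi)| + |Real.sin (2 * η 0)|) * (κ⁻¹ / 4)) := by
  have hpi := Real.pi_pos
  have hη := h.angle.continuousOn
  have hL := h.log.continuousOn
  have hκi : 0 < κ⁻¹ := inv_pos.mpr hκ
  set Q := ∫ t in (0 : ℝ)..Real.pi, |q t| with hQ
  have hQ0 : 0 ≤ Q := integral_nonneg hpi.le fun t _ => abs_nonneg _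
  have hE : ∀ x ∈ Icc 0 Real.pi, |Real.exp (2 * L x) - 1| ≤ 2 * (κ⁻¹ * Q) := fun x hx =>
    h.abs_exp_log_sub_one_le hq hκ hκQ hx
  have hE3 : ∀ x ∈ Icc 0 Real.pi, Real.exp (2 * L x) ≤ 3 := fun x hx => by
    have := (abs_le.mp (hE x hx)).2
    linarith
  have hi1 : IntervalIntegrable (fun t => Real.exp (2 * L t)) volume 0 Real.pi := by
    refine ContinuousOn.intervalIntegrable ?_
    rw [uIcc_pi]
    fun_prop
  have hi2 : IntervalIntegrable (fun t => Real.exp (2 * L t) * Real.cos (2 * η t)) volume 0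
      Real.pi := by
    refine ContinuousOn.intervalIntegrable ?_
    rw [uIcc_pi]
    fun_prop
  have hi3 : IntervalIntegrable (fun t => q t *
      ((Real.pi - t) * (Real.exp (2 * L t) * Real.sin (2 * η t)))) volume 0 Real.pi :=
    mul_sin_sq_intervalIntegrable hq (by fun_prop)
  have hi4 : IntervalIntegrable (fun t => q t * ((Real.pi - t) * Real.sin (2 * η t)))
      volume 0 Real.pi := mul_sin_sq_intervalIntegrable hq (by fun_prop)
  have e1 : ∫ t in (0 : ℝ)..Real.pi, y t ^ 2 = r₀ ^ 2 * (1 / 2 *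
      (∫ t in (0 : ℝ)..Real.pi, Real.exp (2 * L t))
      - 1 / 2 * ∫ t in (0 : ℝ)..Real.pi, Real.exp (2 * L t) * Real.cos (2 * η t)) := by
    rw [← intervalIntegral.integral_const_mul, ← intervalIntegral.integral_const_mul,
      ← integral_sub (hi1.const_mul _) (hi2.const_mul _), ← intervalIntegral.integral_const_mul]
    refine integral_congr fun t ht => ?_
    rw [uIcc_pi] at ht
    rw [h.eq_sin t ht, mul_pow, mul_pow, Real.cos_two_mul, Real.cos_sq', two_mul (L t),
      Real.exp_add]
    ring
  have e2 := h.integral_exp_mul_cos hκ hq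
  have e3 := h.integral_exp_log hκ hq
  have e4 := integral_sub hi3 hi4
  set A := ∫ t in (0 : ℝ)..Real.pi, Real.exp (2 * L t)
  set B := ∫ t in (0 : ℝ)..Real.pi, Real.exp (2 * L t) * Real.cos (2 * η t)
  have b1 : |∫ t in (0 : ℝ)..Real.pi, (q t *
      ((Real.pi - t) * (Real.exp (2 * L t) * Real.sin (2 * η t)))
      - q t * ((Real.pi - t) * Real.sin (2 * η t)))| ≤ Real.pi * (2 * (κ⁻¹ * Q)) * Q := by
    have : (fun t => q t * ((Real.pi - t) * (Real.exp (2 * L t) * Real.sin (2 * η t)))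
        - q t * ((Real.pi - t) * Real.sin (2 * η t)))
        = fun t => q t * ((Real.pi - t) * (Real.exp (2 * L t) - 1) * Real.sin (2 * η t)) := by
      funext t; ring
    rw [this]
    refine abs_integral_mul_le_of_le hq fun t ht => ?_
    rw [abs_mul, abs_mul]
    refine (mul_le_of_le_one_right (by positivity) (Real.abs_sin_le_one _)).trans ?_
    refine mul_le_mul ?_ (hE t ht) (abs_nonneg _) hpi.le
    rw [abs_of_nonneg (by linarith [ht.2])]
    linarith [ht.1]
  have b2 : |∫ t in (0 : ℝ)..Real.pi, q t * (Real.exp (2 * L t) *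
      (Real.sin (2 * η t) ^ 2 - 2 * Real.sin (η t) ^ 2 * Real.cos (2 * η t)))| ≤ 9 * Q := by
    refine abs_integral_mul_le_of_le hq fun t ht => ?_
    -- One 3 bounds exp(2L), the other |sin² 2η - 2 sin² η cos 2η| ≤ 1 + 2.
    rw [abs_mul, abs_of_pos (Real.exp_pos _), show (9 : ℝ) = 3 * 3 by norm_num]
    refine mul_le_mul (hE3 t ht) ?_ (abs_nonneg _) (by norm_num)
    have c1 := Real.sin_sq_le_one (2 * η t)
    have c2 := Real.sin_sq_le_one (η t)
    have c3 := Real.abs_cos_le_one (2 * η t)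
    refine (abs_sub _ _).trans ?_
    rw [abs_of_nonneg (sq_nonneg _), abs_mul, abs_of_nonneg (by positivity)]
    nlinarith [abs_nonneg (Real.cos (2 * η t)), sq_nonneg (Real.sin (η t))]
  rw [e4] at b1
  set D := ∫ t in (0 : ℝ)..Real.pi, q t * ((Real.pi - t) * Real.sin (2 * η t))
  set D' := ∫ t in (0 : ℝ)..Real.pi, q t *
      ((Real.pi - t) * (Real.exp (2 * L t) * Real.sin (2 * η t)))
  set G := ∫ t in (0 : ℝ)..Real.pi, q t * (Real.exp (2 * L t) *
      (Real.sin (2 * η t) ^ 2 - 2 * Real.sin (η t) ^ 2 * Real.cos (2 * η t)))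
  have b3 : |Real.exp (2 * L Real.pi) * Real.sin (2 * η Real.pi)|
      ≤ 3 * |Real.sin (2 * η Real.pi)| := by
    rw [abs_mul, abs_of_pos (Real.exp_pos _)]
    exact mul_le_mul_of_nonneg_right (hE3 _ pi_mem_Icc_pi) (abs_nonneg _)
  have eB : B = κ⁻¹ / 2 * (Real.exp (2 * L Real.pi) * Real.sin (2 * η Real.pi)
      - Real.sin (2 * η 0) - κ⁻¹ * G) := by
    rw [← e2]
    field_simp
  rw [e1, e3, eB, ← mul_sub, abs_mul, abs_of_nonneg (sq_nonneg r₀)]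
  refine mul_le_mul_of_nonneg_left ?_ (sq_nonneg _)
  have e5 : 1 / 2 * (Real.pi + κ⁻¹ * D') - 1 / 2 * (κ⁻¹ / 2 * (Real.exp (2 * L Real.pi) *
      Real.sin (2 * η Real.pi) - Real.sin (2 * η 0) - κ⁻¹ * G)) - (Real.pi / 2 + κ⁻¹ / 2 * D)
      = κ⁻¹ / 2 * (D' - D) - κ⁻¹ / 4 * (Real.exp (2 * L Real.pi) * Real.sin (2 * η Real.pi))
        + κ⁻¹ / 4 * Real.sin (2 * η 0) + κ⁻¹ ^ 2 / 4 * G := by ring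
  rw [e5]
  have t1 : |κ⁻¹ / 2 * (D' - D)| ≤ κ⁻¹ / 2 * (Real.pi * (2 * (κ⁻¹ * Q)) * Q) := by
    rw [abs_mul, abs_of_pos (by positivity : 0 < κ⁻¹ / 2)]
    exact mul_le_mul_of_nonneg_left b1 (by positivity)
  have t2 : |κ⁻¹ / 4 * (Real.exp (2 * L Real.pi) * Real.sin (2 * η Real.pi))|
      ≤ κ⁻¹ / 4 * (3 * |Real.sin (2 * η Real.pi)|) := by
    rw [abs_mul, abs_of_pos (by positivity : 0 < κ⁻¹ / 4)]
    exact mul_le_mul_of_nonneg_left b3 (by positivity)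
  have t3 : |κ⁻¹ / 4 * Real.sin (2 * η 0)| = κ⁻¹ / 4 * |Real.sin (2 * η 0)| := by
    rw [abs_mul, abs_of_pos (by positivity : 0 < κ⁻¹ / 4)]
  have t4 : |κ⁻¹ ^ 2 / 4 * G| ≤ κ⁻¹ ^ 2 / 4 * (9 * Q) := by
    rw [abs_mul, abs_of_pos (by positivity : 0 < κ⁻¹ ^ 2 / 4)]
    exact mul_le_mul_of_nonneg_left b2 (by positivity)
  have s1 := abs_add_le (κ⁻¹ / 2 * (D' - D) - κ⁻¹ / 4 * (Real.exp (2 * L Real.pi) *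
    Real.sin (2 * η Real.pi)) + κ⁻¹ / 4 * Real.sin (2 * η 0)) (κ⁻¹ ^ 2 / 4 * G)
  have s2 := abs_add_le (κ⁻¹ / 2 * (D' - D) - κ⁻¹ / 4 * (Real.exp (2 * L Real.pi) *
    Real.sin (2 * η Real.pi))) (κ⁻¹ / 4 * Real.sin (2 * η 0))
  have s3 := abs_sub (κ⁻¹ / 2 * (D' - D)) (κ⁻¹ / 4 * (Real.exp (2 * L Real.pi) *
    Real.sin (2 * η Real.pi)))
  nlinarith

end IsPruefer

end SturmLiouville

end

noncomputable section

namespace SturmLiouville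

open MeasureTheory Set Filter Topology intervalIntegral Asymptotics

variable {q : ℝ → ℝ} {f F : BC} {ev nc : ℕ → ℝ}

/-! ### Asymptotics of the eigenvalues -/

theorem isPruefer_phi_sq (hq : IntervalIntegrable q volume 0 Real.pi) (f : BC) {μ : ℝ}
    (hμ : 1 ≤ μ) : IsPruefer q (√μ ^ 2) (√μ) (f.radius μ) (phi hq f μ) (phi' hq f μ)
      (phiAngle hq f μ) (phiLog hq f μ) := by
  rw [Real.sq_sqrt (by linarith)]
  have := isPruefer_phi hq f μ
  rwa [scale_of_one_le hμ] at this

theorem phiAngle_zero (hq : IntervalIntegrable q volume 0 Real.pi) (f : BC) (μ : ℝ) :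
    phiAngle hq f μ 0 = f.angle μ := prueferAngle_zero _ _ _ _ _

theorem inv_nat_isBigO_one : (fun n : ℕ => (n : ℝ)⁻¹) =O[atTop] fun _ => (1 : ℝ) :=
  tendsto_inv_atTop_nhds_zero_nat.isBigO_one ℝ

namespace IsSpectralData

theorem tendsto_sqrt (hq : IntervalIntegrable q volume 0 Real.pi) (h : IsSpectralData q f F ev nc) :
    Tendsto (fun n => √(ev n)) atTop atTop :=
  Real.tendsto_sqrt_atTop.comp (h.charAngle_eq hq).2

theorem angle_sub_isBigO (hq : IntervalIntegrable q volume 0 Real.pi)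
    (h : IsSpectralData q f F ev nc) (b : BC) :
    (fun n => b.angle (ev n) - (Real.pi * (b.ind + 1) / 2 - b.omega₁ / √(ev n)))
      =O[atTop] fun n => (√(ev n))⁻¹ ^ 2 := by
  refine (b.angle_sub_isBigO.comp_tendsto (h.charAngle_eq hq).2).congr' .rfl ?_
  filter_upwards [(h.charAngle_eq hq).2.eventually_ge_atTop 0] with n hn
  simp only [Function.comp, inv_pow, Real.sq_sqrt hn]

/-- The equation for the eigenvalues, with the integral term not yet evaluated. -/
theorem sqrt_sub_isBigO_aux (hq : IntervalIntegrable q volume 0 Real.pi)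
    (h : IsSpectralData q f F ev nc) :
    (fun n : ℕ => Real.pi * (√(ev n) - (n - ((f.ind : ℝ) + F.ind) / 2)) - (f.omega₁ + F.omega₁ +
      ∫ t in (0 : ℝ)..Real.pi, q t * Real.sin (phiAngle hq f (ev n) t) ^ 2) * (√(ev n))⁻¹)
      =O[atTop] fun n => (√(ev n))⁻¹ ^ 2 := by
  -- The shift -π in `charAngle` cancels the two halves of π from (ind + 1) / 2, leaving the shift
  -- (ind f + ind F) / 2.
  refine ((h.angle_sub_isBigO hq f).add (h.angle_sub_isBigO hq F)).neg_left.congr' ?_ .rfl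
  filter_upwards [(h.charAngle_eq hq).2.eventually_ge_atTop 1] with n hn
  have h1 := (isPruefer_phi_sq hq f hn).angle_eq hq
    (Real.sqrt_pos.mpr (by linarith)) pi_mem_Icc_pi
  have h2 := (h.charAngle_eq hq).1 n
  rw [charAngle, h1, phiAngle_zero] at h2
  simp only [div_eq_mul_inv] at *
  linear_combination -h2

theorem integral_sin_sq_isBigO (hq : IntervalIntegrable q volume 0 Real.pi) (f : BC) (ev : ℕ → ℝ) :
    (fun n : ℕ => ∫ t in (0 : ℝ)..Real.pi, q t * Real.sin (phiAngle hq f (ev n) t) ^ 2)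
      =O[atTop] fun _ => (1 : ℝ) := by
  refine IsBigO.of_bound (∫ t in (0 : ℝ)..Real.pi, |q t|) (.of_forall fun n => ?_)
  rw [norm_one, mul_one]
  refine abs_integral_mul_le hq (fun t => ?_) pi_mem_Icc_pi
  rw [abs_of_nonneg (sq_nonneg _)]
  exact Real.sin_sq_le_one _

theorem sqrt_sub_isBigO_sqrt (hq : IntervalIntegrable q volume 0 Real.pi)
    (h : IsSpectralData q f F ev nc) :
    (fun n : ℕ => √(ev n) - (n - ((f.ind : ℝ) + F.ind) / 2))
      =O[atTop] fun n => (√(ev n))⁻¹ := by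
  have h0 : (fun n => (√(ev n))⁻¹) =O[atTop] fun _ : ℕ => (1 : ℝ) :=
    (tendsto_inv_atTop_zero.comp (h.tendsto_sqrt hq)).isBigO_one ℝ
  have h1 : (fun n => (√(ev n))⁻¹ ^ 2) =O[atTop] fun n => (√(ev n))⁻¹ := by
    simpa [sq] using h0.mul (isBigO_refl (fun n => (√(ev n))⁻¹) atTop)
  have h2 := ((isBigO_const_const (f.omega₁ + F.omega₁) (one_ne_zero (α := ℝ)) atTop).add
    (integral_sin_sq_isBigO hq f ev)).mul (isBigO_refl (fun n => (√(ev n))⁻¹) atTop)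
  simp only [one_mul] at h2
  refine (((h.sqrt_sub_isBigO_aux hq).trans h1).add h2).const_mul_left Real.pi⁻¹ |>.congr_left
    fun n => ?_
  field_simp
  ring

/-- Bootstrap: the crude equation puts √λ within o(1) of n - (ind f + ind F) / 2, hence √λ ≥ n/2 for
large n, and powers of λ^(-1/2) become powers of 1/n. -/
theorem sqrt_inv_isBigO (hq : IntervalIntegrable q volume 0 Real.pi)
    (h : IsSpectralData q f F ev nc) :
    (fun n => (√(ev n))⁻¹) =O[atTop] fun n : ℕ => (n : ℝ)⁻¹ := by
  have h1 := (h.sqrt_sub_isBigO_sqrt hq).trans_tendsto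
    (tendsto_inv_atTop_zero.comp (h.tendsto_sqrt hq))
  have h2 := (tendsto_order.mp h1).1 (-1) (by norm_num)
  refine IsBigO.of_bound 2 ?_
  filter_upwards [h2, eventually_gt_atTop 0,
    tendsto_natCast_atTop_atTop.eventually_ge_atTop ((f.ind : ℝ) + F.ind + 2)] with n h3 h4 h5
  have h6 : (0 : ℝ) < n := by exact_mod_cast h4
  have h7 : (n : ℝ) / 2 ≤ √(ev n) := by linarith
  rw [Real.norm_of_nonneg (by positivity), Real.norm_of_nonneg (by positivity)]
  have := inv_anti₀ (by positivity) h7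
  rwa [inv_div, div_eq_mul_inv] at this

theorem sqrt_sub_isBigO (hq : IntervalIntegrable q volume 0 Real.pi)
    (h : IsSpectralData q f F ev nc) :
    (fun n : ℕ => √(ev n) - (n - ((f.ind : ℝ) + F.ind) / 2)) =O[atTop] fun n : ℕ => (n : ℝ)⁻¹ :=
  (h.sqrt_sub_isBigO_sqrt hq).trans (h.sqrt_inv_isBigO hq)

theorem nat_mul_sqrt_inv_sub_isBigO (hq : IntervalIntegrable q volume 0 Real.pi)
    (h : IsSpectralData q f F ev nc) :
    (fun n : ℕ => n * (√(ev n))⁻¹ - 1) =O[atTop] fun n : ℕ => (n : ℝ)⁻¹ := by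
  have h1 := ((isBigO_const_const (((f.ind : ℝ) + F.ind) / 2) (one_ne_zero (α := ℝ)) atTop).sub
    ((h.sqrt_sub_isBigO hq).trans inv_nat_isBigO_one)).mul (h.sqrt_inv_isBigO hq)
  simp only [one_mul] at h1
  refine h1.congr' ?_ .rfl
  filter_upwards [(h.tendsto_sqrt hq).eventually_gt_atTop 0] with n hn
  field_simp
  ring

theorem angle_sub_isBigO_nat (hq : IntervalIntegrable q volume 0 Real.pi)
    (h : IsSpectralData q f F ev nc) (b : BC) :
    (fun n => b.angle (ev n) - Real.pi * (b.ind + 1) / 2) =O[atTop] fun n : ℕ => (n : ℝ)⁻¹ := by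
  have h0 := h.sqrt_inv_isBigO hq
  have h1 : (fun n => (√(ev n))⁻¹ ^ 2) =O[atTop] fun n : ℕ => (n : ℝ)⁻¹ := by
    simpa [sq] using (h0.trans inv_nat_isBigO_one).mul h0
  refine (((h.angle_sub_isBigO hq b).trans h1).sub (h0.const_mul_left b.omega₁)).congr_left
    fun n => ?_
  rw [div_eq_mul_inv b.omega₁]
  ring

/-- Uniform asymptotics of the Prüfer angle of the eigenfunctions. -/
theorem exists_two_mul_phiAngle_sub_le (hq : IntervalIntegrable q volume 0 Real.pi)
    (h : IsSpectralData q f F ev nc) :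
    ∃ e : ℕ → ℝ, e =O[atTop] (fun n : ℕ => (n : ℝ)⁻¹) ∧ ∀ᶠ n : ℕ in atTop, ∀ x ∈ Icc 0 Real.pi,
      |2 * phiAngle hq f (ev n) x
        - (Real.pi * (f.ind + 1) + (2 * n - (f.ind + F.ind : ℤ)) * x)| ≤ e n := by
  set Q := ∫ t in (0 : ℝ)..Real.pi, |q t| with hQ
  have hpi := Real.pi_pos
  refine ⟨_, (((h.angle_sub_isBigO_nat hq f).norm_left.const_mul_left 2).add
    ((h.sqrt_sub_isBigO hq).norm_left.const_mul_left (2 * Real.pi))).add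
    ((h.sqrt_inv_isBigO hq).const_mul_left (2 * Q)), ?_⟩
  filter_upwards [(h.charAngle_eq hq).2.eventually_ge_atTop 1] with n hn x hx
  have h0 : 0 < √(ev n) := Real.sqrt_pos.mpr (by linarith)
  have h1 := (isPruefer_phi_sq hq f hn).angle_eq hq h0 hx
  have h2 := abs_integral_mul_le hq (g := fun t => Real.sin (phiAngle hq f (ev n) t) ^ 2)
    (fun t => by rw [abs_of_nonneg (sq_nonneg _)]; exact Real.sin_sq_le_one _) hx
  set S := ∫ t in (0 : ℝ)..x, q t * Real.sin (phiAngle hq f (ev n) t) ^ 2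
  rw [phiAngle_zero] at h1
  have e : 2 * phiAngle hq f (ev n) x
      - (Real.pi * (f.ind + 1) + (2 * n - (f.ind + F.ind : ℤ)) * x)
      = 2 * (f.angle (ev n) - Real.pi * (f.ind + 1) / 2)
        + 2 * x * (√(ev n) - (n - ((f.ind : ℝ) + F.ind) / 2)) - 2 * ((√(ev n))⁻¹ * S) := by
    rw [h1]
    push_cast
    ring
  rw [e]
  refine (abs_sub _ _).trans (add_le_add ((abs_add_le _ _).trans (add_le_add ?_ ?_)) ?_)
  · rw [abs_mul, abs_two, Real.norm_eq_abs]
  · rw [abs_mul, abs_of_nonneg (by linarith [hx.1] : 0 ≤ 2 * x), Real.norm_eq_abs]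
    exact mul_le_mul_of_nonneg_right (by linarith [hx.2]) (abs_nonneg _)
  · rw [abs_mul, abs_mul, abs_two, abs_of_pos (inv_pos.mpr h0)]
    have := mul_le_mul_of_nonneg_left h2 (inv_pos.mpr h0).le
    linarith

/-- Replacing 2η by its linear approximation changes the integral by O(1/n) uniformly, which is
itself an admissible remainder. What is left is a Fourier coefficient. -/
theorem isRemainder_integral_cos (hq : IntervalIntegrable q volume 0 Real.pi)
    (h : IsSpectralData q f F ev nc) {p : ℝ → ℝ} (hp : IntervalIntegrable p volume 0 Real.pi)
    (s : ℝ) : IsRemainder (MemLp p 2 (volume.restrict (Ioc 0 Real.pi)))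
      fun n => ∫ t in (0 : ℝ)..Real.pi, p t * Real.cos (2 * phiAngle hq f (ev n) t + s) := by
  refine (isRemainder_fourier hp (f.ind + F.ind) (Real.pi * (f.ind + 1) + s)).of_sub_isBigO ?_
  obtain ⟨e, he, hb⟩ := h.exists_two_mul_phiAngle_sub_le hq
  refine IsBigO.trans ?_ (he.const_mul_left (∫ t in (0 : ℝ)..Real.pi, |p t|))
  refine IsBigO.of_bound 1 ?_
  filter_upwards [hb, (h.charAngle_eq hq).2.eventually_ge_atTop 1] with n hn h1
  have hc := (isPruefer_phi hq f (ev n)).angle.continuousOn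
  rw [← integral_sub (mul_sin_sq_intervalIntegrable hp (by fun_prop))
    (mul_sin_sq_intervalIntegrable hp (by fun_prop))]
  simp only [← mul_sub]
  refine (abs_integral_mul_le_of_le hp (C := e n) fun t ht => ?_).trans ?_
  · refine le_trans ?_ (hn t ht)
    refine (Real.abs_cos_sub_cos_le _ _).trans_eq ?_
    congr 1
    ring
  · rw [one_mul, mul_comm]
    exact le_abs_self _

/-- The asymptotics of the eigenvalues. -/
theorem isRemainder_sqrt (hq : IntervalIntegrable q volume 0 Real.pi)
    (h : IsSpectralData q f F ev nc) :
    IsRemainder (MemLp q 2 (volume.restrict (Ioc 0 Real.pi)))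
      fun n : ℕ => n * (√(ev n) - (n - ((f.ind : ℝ) + F.ind) / 2))
        - 1 / Real.pi * (1 / 2 * (∫ x in (0 : ℝ)..Real.pi, q x) + f.omega₁ + F.omega₁) := by
  have hpi := Real.pi_pos
  -- The remainder is -(2π)⁻¹ ∫ q cos 2η, from sin² η = (1 - cos 2η) / 2; all else is O(1/n) after
  -- multiplication by n.
  refine ((h.isRemainder_integral_cos hq hq 0).const_mul (-(1 / (2 * Real.pi)))).of_sub_isBigO ?_
  have h0 := h.sqrt_inv_isBigO hq
  have h1 : (fun n : ℕ => (n : ℝ) * (√(ev n))⁻¹ ^ 2) =O[atTop] fun n : ℕ => (n : ℝ)⁻¹ := by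
    refine ((isBigO_refl (fun n : ℕ => (n : ℝ)) atTop).mul (h0.pow 2)).trans_eventuallyEq ?_
    filter_upwards [eventually_gt_atTop 0] with n hn
    have : (0 : ℝ) < n := by exact_mod_cast hn
    field_simp
  have h2 := ((isBigO_refl (fun n : ℕ => (n : ℝ)) atTop).mul (h.sqrt_sub_isBigO_aux hq)).trans h1
  have h3 := ((isBigO_const_const (f.omega₁ + F.omega₁) (one_ne_zero (α := ℝ)) atTop).add
    (integral_sin_sq_isBigO hq f ev)).mul (h.nat_mul_sqrt_inv_sub_isBigO hq)
  simp only [one_mul] at h3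
  refine ((h2.add h3).const_mul_left Real.pi⁻¹).congr_left fun n => ?_
  have hc := (isPruefer_phi hq f (ev n)).angle.continuousOn
  have e : ∫ t in (0 : ℝ)..Real.pi, q t * Real.sin (phiAngle hq f (ev n) t) ^ 2
      = 1 / 2 * (∫ t in (0 : ℝ)..Real.pi, q t)
        - 1 / 2 * ∫ t in (0 : ℝ)..Real.pi, q t * Real.cos (2 * phiAngle hq f (ev n) t + 0) := by
    rw [← intervalIntegral.integral_const_mul, ← intervalIntegral.integral_const_mul,
      ← integral_sub (hq.const_mul _)
        ((mul_sin_sq_intervalIntegrable hq (by fun_prop)).const_mul _)]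
    refine integral_congr fun t _ => ?_
    rw [add_zero, Real.cos_two_mul, Real.cos_sq']
    ring
  rw [e]
  field_simp
  ring

end IsSpectralData

end SturmLiouville

end

noncomputable section

namespace SturmLiouville

open MeasureTheory Set Filter Topology intervalIntegral Asymptotics

variable {q : ℝ → ℝ} {f F : BC} {ev nc : ℕ → ℝ}

/-! ### Asymptotics of the norming constants -/

theorem IsRemainder.mono {P P' : Prop} {x : ℕ → ℝ} (h : IsRemainder P x) (hP : P' → P) :
    IsRemainder P' x := ⟨h.1, fun h' => h.2 (hP h')⟩

theorem intervalIntegrable_mul_pi_sub (hq : IntervalIntegrable q volume 0 Real.pi) :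
    IntervalIntegrable (fun t => q t * (Real.pi - t)) volume 0 Real.pi :=
  mul_sin_sq_intervalIntegrable hq (by fun_prop)

theorem memLp_mul_pi_sub (h : MemLp q 2 (volume.restrict (Ioc 0 Real.pi))) :
    MemLp (fun t => q t * (Real.pi - t)) 2 (volume.restrict (Ioc 0 Real.pi)) := by
  refine h.of_le_mul (c := Real.pi) (h.1.mul (by fun_prop)) ?_
  refine (ae_restrict_iff' measurableSet_Ioc).mpr (.of_forall fun t ht => ?_)
  rw [norm_mul, mul_comm]
  refine mul_le_mul_of_nonneg_right ?_ (norm_nonneg _)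
  rw [Real.norm_of_nonneg (by linarith [ht.2])]
  linarith [ht.1]

theorem abs_sin_le_abs_sub_int_mul_pi (x : ℝ) (k : ℤ) : |Real.sin x| ≤ |x - k * Real.pi| := by
  simpa using Real.abs_sin_sub_sin_le x (k * Real.pi)

theorem zpow_sub_one_isBigO {u g : ℕ → ℝ} (k : ℤ) (hu : (fun n => u n - 1) =O[atTop] g)
    (hg : Tendsto g atTop (𝓝 0)) : (fun n => u n ^ k - 1) =O[atTop] g := by
  have h1 : Tendsto u atTop (𝓝 1) := by simpa using (hu.trans_tendsto hg).add_const 1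
  have h2 := (hasDerivAt_zpow k (1 : ℝ) (.inl one_ne_zero)).isBigO_sub.comp_tendsto h1
  simp only [one_zpow] at h2
  exact h2.trans hu

namespace IsSpectralData

/-- Twice the boundary angle is within O(1/n) of the multiple π (ind + 1) of π. -/
theorem sin_two_mul_angle_isBigO (hq : IntervalIntegrable q volume 0 Real.pi)
    (h : IsSpectralData q f F ev nc) (b : BC) :
    (fun n => Real.sin (2 * b.angle (ev n))) =O[atTop] fun n : ℕ => (n : ℝ)⁻¹ := by
  refine IsBigO.trans (IsBigO.of_bound 2 (.of_forall fun n => ?_)) (h.angle_sub_isBigO_nat hq b)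
  refine (abs_sin_le_abs_sub_int_mul_pi _ (b.ind + 1)).trans_eq ?_
  rw [Real.norm_eq_abs, ← abs_two, ← abs_mul, abs_two]
  congr 1
  push_cast
  ring

/-- At an eigenvalue η(π) = (n + 1)π - `F.angle`, so the sine at π is controlled by the second
boundary angle. -/
theorem abs_sin_two_mul_phiAngle_pi (hq : IntervalIntegrable q volume 0 Real.pi)
    (h : IsSpectralData q f F ev nc) (n : ℕ) :
    |Real.sin (2 * phiAngle hq f (ev n) Real.pi)| = |Real.sin (2 * F.angle (ev n))| := by
  have h1 := (h.charAngle_eq hq).1 n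
  rw [charAngle] at h1
  have : 2 * phiAngle hq f (ev n) Real.pi
      = -(2 * F.angle (ev n)) + ((n + 1 : ℕ) : ℝ) * (2 * Real.pi) := by
    push_cast
    linear_combination 2 * h1
  rw [this, Real.sin_add_nat_mul_two_pi, Real.sin_neg, abs_neg]

theorem inv_nat_sq_mul_nat : (fun n : ℕ => (n : ℝ) * (n : ℝ)⁻¹ ^ 2) = fun n : ℕ => (n : ℝ)⁻¹ := by
  funext n
  rcases eq_or_ne (n : ℝ) 0 with h | h
  · simp [h]
  · field_simp

theorem integral_sq_isBigO (hq : IntervalIntegrable q volume 0 Real.pi)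
    (h : IsSpectralData q f F ev nc) :
    (fun n => (∫ t in (0 : ℝ)..Real.pi, phi hq f (ev n) t ^ 2) / f.radius (ev n) ^ 2
      - (Real.pi / 2 + (√(ev n))⁻¹ / 2 * ∫ t in (0 : ℝ)..Real.pi,
        q t * ((Real.pi - t) * Real.sin (2 * phiAngle hq f (ev n) t))))
      =O[atTop] fun n : ℕ => (n : ℝ)⁻¹ ^ 2 := by
  have h0 := h.sqrt_inv_isBigO hq
  set Q := ∫ t in (0 : ℝ)..Real.pi, |q t| with hQ
  have h1 := ((h0.pow 2).const_mul_left (Real.pi * Q ^ 2 + 9 / 4 * Q)).add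
    (((((h.sin_two_mul_angle_isBigO hq F).norm_left.const_mul_left 3).add
      (h.sin_two_mul_angle_isBigO hq f).norm_left).mul h0).const_mul_left (1 / 4)
      |>.congr_right fun n => (sq _).symm)
  refine IsBigO.trans (IsBigO.of_bound 1 ?_) h1
  have hlim : Tendsto (fun n => (√(ev n))⁻¹ * Q) atTop (𝓝 0) := by
    simpa using (h0.trans_tendsto tendsto_inv_atTop_nhds_zero_nat).mul_const Q
  filter_upwards [(h.charAngle_eq hq).2.eventually_ge_atTop 1,
    (tendsto_order.mp hlim).2 1 one_pos] with n hn hnQ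
  have h2 := (isPruefer_phi_sq hq f hn).abs_integral_sq_sub_le hq
    (Real.sqrt_pos.mpr (by linarith)) hnQ.le
  have hr : 0 < f.radius (ev n) ^ 2 := pow_pos (f.radius_pos _) 2
  rw [phiAngle_zero, h.abs_sin_two_mul_phiAngle_pi hq] at h2
  rw [one_mul, Real.norm_eq_abs, Real.norm_eq_abs]
  refine le_trans ?_ (le_abs_self _)
  rw [div_sub' hr.ne', abs_div, abs_of_pos hr, div_le_iff₀ hr]
  refine h2.trans_eq ?_
  simp only [Real.norm_eq_abs]
  ring

/-- Relative to r(0)² the boundary terms are W_f / r_f² and exp(2L(π)) W_F / r_F², both O(1/λ). Here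
1/β² was expressed through the two radii. -/
theorem norming_div_isBigO (hq : IntervalIntegrable q volume 0 Real.pi)
    (h : IsSpectralData q f F ev nc) :
    (fun n => nc n / f.radius (ev n) ^ 2
      - (Real.pi / 2 + (√(ev n))⁻¹ / 2 * ∫ t in (0 : ℝ)..Real.pi,
        q t * ((Real.pi - t) * Real.sin (2 * phiAngle hq f (ev n) t))))
      =O[atTop] fun n : ℕ => (n : ℝ)⁻¹ ^ 2 := by
  have h0 := h.sqrt_inv_isBigO hq
  have hw : ∀ b : BC, (fun n => b.wronskian.eval (ev n) / b.radius (ev n) ^ 2)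
      =O[atTop] fun n : ℕ => (n : ℝ)⁻¹ ^ 2 := fun b => by
    refine IsBigO.trans ?_ (h0.pow 2)
    refine (b.wronskian_div_radius_sq_isBigO.comp_tendsto (h.charAngle_eq hq).2).congr' .rfl ?_
    filter_upwards [(h.charAngle_eq hq).2.eventually_ge_atTop 0] with n hn
    simp only [Function.comp, inv_pow, Real.sq_sqrt hn]
  set Q := ∫ t in (0 : ℝ)..Real.pi, |q t| with hQ
  have hlim : Tendsto (fun n => (√(ev n))⁻¹ * Q) atTop (𝓝 0) := by
    simpa using (h0.trans_tendsto tendsto_inv_atTop_nhds_zero_nat).mul_const Q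
  have hE : (fun n => Real.exp (2 * phiLog hq f (ev n) Real.pi)) =O[atTop] fun _ => (1 : ℝ) := by
    refine IsBigO.of_bound 3 ?_
    filter_upwards [(h.charAngle_eq hq).2.eventually_ge_atTop 1,
      (tendsto_order.mp hlim).2 1 one_pos] with n hn hnQ
    have h2 := (isPruefer_phi_sq hq f hn).abs_exp_log_sub_one_le hq
      (Real.sqrt_pos.mpr (by linarith)) hnQ.le pi_mem_Icc_pi
    rw [Real.norm_of_nonneg (Real.exp_pos _).le, norm_one]
    linarith [(abs_le.mp h2).2]
  have h3 := hE.mul (hw F)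
  simp only [one_mul] at h3
  refine (((h.integral_sq_isBigO hq).add (hw f)).add h3).congr_left fun n => ?_
  have hr := (f.radius_pos (ev n)).ne'
  rw [(h.norming n).eq hq (k := n) (by exact_mod_cast (h.charAngle_eq hq).1 n), add_div, add_div]
  rw [show f.radius (ev n) ^ 2 * Real.exp (2 * phiLog hq f (ev n) Real.pi) / F.radius (ev n) ^ 2
    * F.wronskian.eval (ev n) / f.radius (ev n) ^ 2
    = Real.exp (2 * phiLog hq f (ev n) Real.pi) *
      (F.wronskian.eval (ev n) / F.radius (ev n) ^ 2) by field_simp]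
  ring

/-- The error must be O(n⁻²) to survive multiplication by n. It is, since √λ differs from n - (ind f
+ ind F) / 2 by O(1/n), a relative error of O(n⁻²). -/
theorem radius_sq_div_isBigO (hq : IntervalIntegrable q volume 0 Real.pi)
    (h : IsSpectralData q f F ev nc) :
    (fun n : ℕ => f.radius (ev n) ^ 2 / ((n : ℝ) - ((f.ind : ℝ) + F.ind) / 2) ^ (2 * f.ind) - 1)
      =O[atTop] fun n : ℕ => (n : ℝ)⁻¹ ^ 2 := by
  have h0 := h.sqrt_inv_isBigO hq
  have hg1 : Tendsto (fun n : ℕ => (n : ℝ)⁻¹ ^ 2) atTop (𝓝 0) := by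
    simpa using tendsto_inv_atTop_nhds_zero_nat (𝕜 := ℝ).pow 2
  have h1 : (fun n => f.radius (ev n) ^ 2 / ev n ^ f.ind - 1)
      =O[atTop] fun n : ℕ => (n : ℝ)⁻¹ ^ 2 := by
    refine IsBigO.trans ?_ (h0.pow 2)
    refine (f.radius_sq_isBigO.comp_tendsto (h.charAngle_eq hq).2).congr' .rfl ?_
    filter_upwards [(h.charAngle_eq hq).2.eventually_ge_atTop 0] with n hn
    simp only [Function.comp, inv_pow, Real.sq_sqrt hn]
  have h2 : (fun n : ℕ => ((n : ℝ) - ((f.ind : ℝ) + F.ind) / 2) * (√(ev n))⁻¹ - 1)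
      =O[atTop] fun n : ℕ => (n : ℝ)⁻¹ ^ 2 := by
    refine ((h.sqrt_sub_isBigO hq).neg_left.mul h0).congr' ?_ (.of_eq (by simp only [sq]))
    filter_upwards [(h.tendsto_sqrt hq).eventually_gt_atTop 0] with n hn
    field_simp
    ring
  have h3 := zpow_sub_one_isBigO (-(2 * f.ind)) h2 hg1
  refine (isBigO_mul_sub_one h1 h3 (hg1.isBigO_one ℝ)).congr' ?_ .rfl
  filter_upwards [(h.charAngle_eq hq).2.eventually_gt_atTop 0] with n hn
  have h4 : √(ev n) ^ (2 * f.ind) = ev n ^ f.ind := by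
    rw [zpow_mul, zpow_ofNat, Real.sq_sqrt hn.le]
  have h5 : ev n ^ f.ind ≠ 0 := (zpow_pos hn _).ne'
  rw [zpow_neg, mul_zpow, inv_zpow, h4]
  field_simp

/-- The main part of the remainder is π⁻¹ ∫ q (π - t) sin 2η, a perturbed Fourier coefficient of q
(π - t), which is in L² together with q. All other contributions are O(1/n). -/
theorem isRemainder_norming (hq : IntervalIntegrable q volume 0 Real.pi)
    (h : IsSpectralData q f F ev nc) :
    IsRemainder (MemLp q 2 (volume.restrict (Ioc 0 Real.pi)))
      fun n : ℕ => n * (nc n / (Real.pi / 2 *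
        ((n : ℝ) - ((f.ind : ℝ) + F.ind) / 2) ^ (2 * f.ind)) - 1) := by
  have hpi := Real.pi_pos
  have hg1 : (fun n : ℕ => (n : ℝ)⁻¹ ^ 2) =O[atTop] fun _ => (1 : ℝ) := by
    simpa using inv_nat_isBigO_one.pow 2
  -- The phase -π/2 turns the cosine into the sine.
  have hd := (h.isRemainder_integral_cos hq (intervalIntegrable_mul_pi_sub hq)
    (-(Real.pi / 2))).mono memLp_mul_pi_sub
  have e : ∀ n, ∫ t in (0 : ℝ)..Real.pi, q t * (Real.pi - t) *
      Real.cos (2 * phiAngle hq f (ev n) t + -(Real.pi / 2)) = ∫ t in (0 : ℝ)..Real.pi,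
        q t * ((Real.pi - t) * Real.sin (2 * phiAngle hq f (ev n) t)) := fun n =>
    integral_congr fun t _ => by
      rw [← sub_eq_add_neg, Real.cos_sub_pi_div_two, mul_assoc]
  simp only [e] at hd
  refine (hd.const_mul Real.pi⁻¹).of_sub_isBigO ?_
  have hd1 := hd.1.isBigO_one ℝ
  set d : ℕ → ℝ := fun n => ∫ t in (0 : ℝ)..Real.pi,
    q t * ((Real.pi - t) * Real.sin (2 * phiAngle hq f (ev n) t))
  have h1 : (fun n => nc n / f.radius (ev n) ^ 2 - (Real.pi / 2 + (√(ev n))⁻¹ / 2 * d n))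
      =O[atTop] fun n : ℕ => (n : ℝ)⁻¹ ^ 2 := h.norming_div_isBigO hq
  have h2 := h.radius_sq_div_isBigO hq
  have h3 : (fun n => nc n / f.radius (ev n) ^ 2) =O[atTop] fun _ => (1 : ℝ) := by
    have := ((((h.sqrt_inv_isBigO hq).trans inv_nat_isBigO_one).mul hd1).const_mul_left (1 / 2))
    have := ((h1.trans hg1).add (this.congr_right fun _ => mul_one 1)).add
      (isBigO_const_const (Real.pi / 2) (one_ne_zero (α := ℝ)) atTop)
    refine this.congr_left fun n => ?_
    ring
  have h4 := h3.mul h2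
  simp only [one_mul] at h4
  have h5 := (isBigO_refl (fun n : ℕ => (n : ℝ)) atTop).mul
    ((h1.add h4).const_mul_left (2 / Real.pi))
  rw [inv_nat_sq_mul_nat] at h5
  have h6 := (hd1.mul (h.nat_mul_sqrt_inv_sub_isBigO hq)).const_mul_left Real.pi⁻¹
  simp only [one_mul] at h6
  refine (h5.add h6).congr_left fun n => ?_
  change _ = _ - Real.pi⁻¹ * d n
  have hr := (f.radius_pos (ev n)).ne'
  rw [show nc n / (Real.pi / 2 * ((n : ℝ) - ((f.ind : ℝ) + F.ind) / 2) ^ (2 * f.ind))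
    = 2 / Real.pi * (nc n / f.radius (ev n) ^ 2) * (f.radius (ev n) ^ 2 /
      ((n : ℝ) - ((f.ind : ℝ) + F.ind) / 2) ^ (2 * f.ind)) by field_simp]
  field_simp
  ring

end IsSpectralData

end SturmLiouville

end

theorem mainTheorem4 (q : ℝ → ℝ) (hq : IntervalIntegrable q MeasureTheory.volume 0 Real.pi)
    (f F : SturmLiouville.BC) :
    (∃ ev nc : ℕ → ℝ, SturmLiouville.IsSpectralData q f F ev nc) ∧
    ∀ ev nc : ℕ → ℝ, SturmLiouville.IsSpectralData q f F ev nc →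
      ∃ ξ ξ' : ℕ → ℝ,
        (∀ᶠ n : ℕ in Filter.atTop,
          Real.sqrt (ev n) = n - ((f.ind : ℝ) + F.ind) / 2
            + 1 / (Real.pi * n)
              * (1 / 2 * (∫ x in (0 : ℝ)..Real.pi, q x) + f.omega₁ + F.omega₁)
            + ξ n / n) ∧
        (∀ᶠ n : ℕ in Filter.atTop,
          nc n = Real.pi / 2 * ((n : ℝ) - ((f.ind : ℝ) + F.ind) / 2) ^ (2 * f.ind)
            * (1 + ξ' n / n)) ∧
        Filter.Tendsto ξ Filter.atTop (nhds 0) ∧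
        Filter.Tendsto ξ' Filter.atTop (nhds 0) ∧
        (MeasureTheory.MemLp q 2 (MeasureTheory.volume.restrict (Set.Ioc 0 Real.pi)) →
          Memℓp ξ 2 ∧ Memℓp ξ' 2) := by
  refine ⟨SturmLiouville.exists_isSpectralData hq f F, fun ev nc h => ?_⟩
  have h1 := h.isRemainder_sqrt hq
  have h2 := h.isRemainder_norming hq
  -- The witnesses are the scaled remainders themselves; they are found by unification with the two
  -- limits.
  refine ⟨_, _, ?_, ?_, h1.1, h2.1, fun hL => ⟨h1.2 hL, h2.2 hL⟩⟩
  · filter_upwards [Filter.eventually_gt_atTop 0] with n hn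
    have hn' : (n : ℝ) ≠ 0 := by exact_mod_cast hn.ne'
    have := Real.pi_ne_zero
    field_simp
    ring
  -- Beyond (ind f + ind F) / 2 the base of the integer power is positive, so the power is nonzero
  -- and can be cancelled.
  · filter_upwards [Filter.eventually_gt_atTop 0, tendsto_natCast_atTop_atTop.eventually_gt_atTop
      (((f.ind : ℝ) + F.ind) / 2)] with n hn hm
    have hn' : (n : ℝ) ≠ 0 := by exact_mod_cast hn.ne'
    have hm' : ((n : ℝ) - ((f.ind : ℝ) + F.ind) / 2) ^ (2 * f.ind) ≠ 0 :=
      zpow_ne_zero _ (by linarith)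
    rw [mul_div_cancel_left₀ _ hn', add_sub_cancel, mul_div_cancel₀]
    exact mul_ne_zero (by positivity) hm'
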